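/- \textbf{Setting.} For $n\ge 2$ let $E_n$ be the edge set of the complete graph $K_n$ and $\mathcal T_n$ the set of its spanning trees. A \emph{strategy} is a map $\sigma:2^{E_n}\times\mathcal T_n\to E_n$ with $\sigma(F,T)\in E(T)$ for all $F,T$; let $\mathcal S_n$ be the set of strategies. Let $T_1,T_2,\dots$ be independent uniformly random elements of $\mathcal T_n$. Starting from the graph $G_{\sigma,0}$ on the vertices of $K_n$ with no edges, in round $i\ge 1$ the edge $\sigma(E(G_{\sigma,i-1}),T_i)$ is added to $G_{\sigma,i-1}$ (if it is not already present), which gives $G_{\sigma,i}$. A graph is \emph{$k$-connected} if it has more than $k$ vertices and remains connected after the deletion of any fewer than $k$ vertices. Let $\mathcal P_{\mathrm{con},k}$ be the set of $k$-connected graphs on the vertex set of $K_n$, and let $\tau(\sigma,\mathcal P_{\mathrm{con},k})=\min\{i\ge 0: G_{\sigma,i}\in\mathcal P_{\mathrm{con},k}\}$ (with $\min\emptyset=\infty$). An event depending on $n$ holds \emph{whp} if its probability tends to $1$ as $n\to\infty$. \textbf{Theorem.} Let $k=k(n)$ be integers with $k(n)\ge 2$ for all large $n$ and $k=o(n)$,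 and let $\omega=\omega(n)\to\infty$ be any real function. Then there are strategies $\sigma=\sigma_n\in\mathcal S_n$ ($n\ge 2$) such that whp $$\tau(\sigma,\mathcal P_{\mathrm{con},k})\le \frac{nk}{2}+\omega k\max\{k,n^{3/4}\}.$$ Moreover, if $k=o\!\left(\frac{n^{1/2}}{(\log n)^2}\right)$, then for the same strategies, whp $\tau=\tau(\sigma,\mathcal P_{\mathrm{con},k})$ is finite and $G_{\sigma,\tau}$ has a spanning $k$-connected subgraph all of whose vertices have degree $k$ or $k+1$. -/

import Mathlib

open Filter Topology Asymptotics MeasureTheory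

namespace USTSR

/-- The set `𝒯ₙ` of spanning trees of the complete graph on the `n` vertices `Fin n`. -/
def SpanningTree (n : ℕ) : Type := {T : SimpleGraph (Fin n) // T.IsTree}

/-- `𝒯ₙ` is finite; every subset is an event. -/
instance (n : ℕ) : MeasurableSpace (SpanningTree n) := ⊤

/-- A strategy: given the graph `F` built so far (a subset of the edges of `Kₙ`) and the offered
spanning tree `T`, it selects an edge of `T`. There is none for `n = 1`. -/
structure Strategy (n : ℕ) where
  pick : SimpleGraph (Fin n) → SpanningTree n → Sym2 (Fin n)
  pick_mem : ∀ (F : SimpleGraph (Fin n)) (T : SpanningTree n), pick F T ∈ T.1.edgeSet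

/-- The graph `G_{σ,i}` built after `i` rounds, when `T j` is the tree offered in
round `j + 1`. -/
def graphAfter {n : ℕ} (σ : Strategy n) (T : ℕ → SpanningTree n) : ℕ → SimpleGraph (Fin n)
  | 0 => ⊥
  | i + 1 => graphAfter σ T i ⊔
      SimpleGraph.fromEdgeSet {σ.pick (graphAfter σ T i) (T i)}

/-- The law of the sequence of offered trees: independent and uniform on `𝒯ₙ`
(a probability measure for every `n ≥ 1`). -/
noncomputable def treesLaw (n : ℕ) : Measure (ℕ → SpanningTree n) :=
  Measure.infinitePi fun _ : ℕ => ProbabilityTheory.uniformOn (Set.univ : Set (SpanningTree n))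

/-- The hitting time `τ(σ, 𝒫) = min {i ≥ 0 : G_{σ,i} ∈ 𝒫}`, which is `⊤` if there is no
such `i`. -/
noncomputable def hittingTime {n : ℕ} (σ : Strategy n) (P : Set (SimpleGraph (Fin n)))
    (T : ℕ → SpanningTree n) : ℕ∞ :=
  ⨅ (i : ℕ) (_ : graphAfter σ T i ∈ P), (i : ℕ∞)

/-- `G` is `k`-connected: it has more than `k` vertices and it stays connected after the deletion
of any fewer than `k` vertices. -/
def IsKConnected {V : Type*} [Fintype V] (k : ℕ) (G : SimpleGraph V) : Prop :=
  k < Fintype.card V ∧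
    ∀ X : Finset V, X.card < k → (G.induce {v : V | v ∉ X}).Connected

/-- The property `𝒫_{con,k}` of being a `k`-connected graph on `n` vertices. -/
def kConnectedGraphs (n k : ℕ) : Set (SimpleGraph (Fin n)) := {G | IsKConnected k G}

open Classical in
/-- All degrees of `H` are `k` or `k + 1`. -/
def DegreesKOrSucc {V : Type*} [Fintype V] (k : ℕ) (H : SimpleGraph V) : Prop :=
  ∀ v : V, H.degree v = k ∨ H.degree v = k + 1

/-- The events `A n` about the offered trees hold with high probability. -/
def Whp (A : (n : ℕ) → Set (ℕ → SpanningTree n)) : Prop :=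
  Tendsto (fun n => treesLaw n (A n)) atTop (𝓝 1)

end USTSR

/-!
A strategy is built from a set of graphs that it tries not to leave. In each round it adds a
useful edge, one that leads to another graph of this set, if the tree has such an edge, and
otherwise repeats an edge that is already present; it fails if the tree offers neither. Encoding
trees by parent functions gives at least `n ^ (n - 2)` trees, and it bounds the number of trees
avoiding a given set of `L` pairs, so that a random tree avoids the set with probability at most
`n * exp (-L / n)`. Hence a round with many more than `n * log n` useful pairs hardly ever fails
to make progress, and once the graph has that many edges failure is unlikely even if useful
pairs are scarce. In this case averaging over relabellings bounds the waiting time by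
`O(n * log n / s)`, where `s` is the number of useful pairs, and a star at a vertex that misses
only `w` other vertices is avoided with probability at most `2 * w / n`. Potentials that
decrease in expectation control the total probability of failure and the number of rounds lost.

Let `n` be about `r ^ 80`. If `k > r ^ 22`, collecting all edges of the `⌈k / 2⌉`-th power of
the `n`-cycle is affordable: the number of rounds lost is smaller than
`k * r ^ 60 ≤ k * n ^ (3 / 4)`. If `k ≤ r ^ 22`, cover the vertices by induced paths on at most
`r ^ 30` vertices, and join `2 * r ^ 26` long ones pairwise by single edges. Deleting fewer than
`k` vertices does not separate those of these paths that stay intact from each other, and this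
remains true when further paths are attached one after another to `k` earlier ones. Finally the
vertices of degree less than `k` receive edges, at most one to each path. In a graph of minimum
degree `k`, fewer than `k` deletions cannot cut off any vertices from all the intact paths,
since the neighbours of a vertex off its own path lie on distinct paths. So the graph is
`k`-connected as soon as its minimum degree is `k`, and no degree ever exceeds `k + 1`.
-/

namespace USTSR

section RootedForests

/-- A partial parent function whose iteration leads every vertex to a root, a vertex without
parent. Well-foundedness is witnessed by a height function that decreases along the parents. -/
def IsRootedForest {V : Type*} (p : V → Option V) : Prop :=
  ∃ h : V → ℕ, ∀ v w, p v = some w → h w < h v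

theorem IsRootedForest.exists_rootMap {V : Type*} {p : V → Option V} (hp : IsRootedForest p) :
    ∃ ρ : V → V, (∀ v, p (ρ v) = none) ∧ (∀ v, p v = none → ρ v = v) ∧
      ∀ v w, p v = some w → ρ v = ρ w := by
  obtain ⟨h, hh⟩ := hp
  let step (v : V) (root : ∀ w, h w < h v → V) : V :=
    match hv : p v with
    | none => v
    | some w => root w (hh v w hv)
  let ρ : V → V := (measure h).wf.fix step
  have hρ (v : V) : ρ v = step v fun w _ => ρ w := WellFounded.fix_eq ..
  clear_value ρ
  have hnone : ∀ v, p v = none → ρ v = v := fun v hv => by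
    rw [hρ]
    simp only [step]
    clear hρ
    split
    · rfl
    · simp_all only [reduceCtorEq]
  have hsome : ∀ v w, p v = some w → ρ v = ρ w := fun v w hv => by
    rw [hρ]
    simp only [step]
    clear hρ
    split
    · simp_all only [reduceCtorEq]
    · simp_all only [Option.some.injEq]
  refine ⟨ρ, fun v => ?_, hnone, hsome⟩
  induction hm : h v using Nat.strong_induction_on generalizing v with
  | _ m ih =>
    cases hv : p v with
    | none => rw [hnone v hv, hv]
    | some w => exact hsome v w hv ▸ ih (h w) (hm ▸ hh v w hv) w rfl

variable {V : Type*}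

theorem IsRootedForest.update [Finite V] [DecidableEq V] {p : V → Option V} (hp : IsRootedForest p)
    {ρ : V → V} (hρ : ∀ v w, p v = some w → ρ v = ρ w) {r v : V} (hv : ρ v ≠ r) (hr : ρ r = r) :
    IsRootedForest (Function.update p r (some v)) := by
  classical
  obtain ⟨h, hh⟩ := hp
  obtain ⟨M, hM⟩ := (Set.finite_range h).bddAbove
  refine ⟨fun x => h x + if ρ x = r then M + 1 else 0, fun x w hxw => ?_⟩
  obtain rfl | hx := eq_or_ne x r
  · have hvw : v = w := by simpa using hxw
    have hhv : h v ≤ M := hM ⟨v, rfl⟩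
    simp only [← hvw, hv, hr, if_true, if_false]
    lia
  · rw [Function.update_of_ne hx] at hxw
    have hlt := hh x w hxw
    simp only [hρ x w hxw]
    lia

variable [Fintype V] [DecidableEq V]

open Classical in
/-- The rooted forests on `V` with `j` edges. -/
noncomputable def rootedForests (V : Type*) [Fintype V] [DecidableEq V] (j : ℕ) :
    Finset (V → Option V) :=
  {p | IsRootedForest p ∧ Finset.card {v | (p v).isSome} = j}

theorem mem_rootedForests {j : ℕ} {p : V → Option V} :
    p ∈ rootedForests V j ↔ IsRootedForest p ∧ Finset.card {v | (p v).isSome} = j := by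
  simp [rootedForests]

theorem card_roots_add {j : ℕ} {p : V → Option V} (hp : p ∈ rootedForests V j) :
    Finset.card {v | p v = none} + j = Fintype.card V := by
  have hsplit := Finset.card_filter_add_card_filter_not (s := Finset.univ) fun v => p v = none
  rwa [← (mem_rootedForests.1 hp).2, ← Finset.card_univ, Finset.filter_congr fun v _ =>
    Option.isSome_iff_ne_none]

/-- `q` arises from `p` by giving a parent to one of the roots. -/
def IsRootExtension (p q : V → Option V) : Prop :=
  ∃ r v, p r = none ∧ q = Function.update p r (some v)

/-- A root can be attached to any vertex outside its own tree. -/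
theorem le_card_isRootExtension {j : ℕ} {p : V → Option V} (hp : p ∈ rootedForests V j)
    [DecidableRel (IsRootExtension (V := V))] :
    Fintype.card V * (Fintype.card V - j - 1) ≤
      ((rootedForests V (j + 1)).bipartiteAbove IsRootExtension p).card := by
  obtain ⟨hpf, hpj⟩ := mem_rootedForests.1 hp
  obtain ⟨ρ, hρ_root, hρ_fix, hρ⟩ := hpf.exists_rootMap
  let attachments : Finset (Σ _ : V, V) :=
    Finset.univ.sigma fun v => ({r | p r = none} : Finset V).erase (ρ v)
  have hcard : attachments.card = Fintype.card V * (Fintype.card V - j - 1) := by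
    rw [Finset.card_sigma, Finset.sum_const_nat (m := Fintype.card V - j - 1), Finset.card_univ]
    intro v _
    rw [Finset.card_erase_of_mem (by simp [hρ_root]), ← card_roots_add hp, Nat.add_sub_cancel]
  rw [← hcard]
  refine Finset.card_le_card_of_injOn (fun x => Function.update p x.2 (some x.1)) ?_ ?_
  · rintro ⟨v, r⟩ hx
    obtain ⟨hr, hvr⟩ : p r = none ∧ r ≠ ρ v := by simpa [attachments] using hx
    refine Finset.mem_filter.2 ⟨mem_rootedForests.2 ⟨?_, ?_⟩, r, v, hr, rfl⟩
    · exact hpf.update hρ hvr.symm (hρ_fix r hr)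
    · rw [← hpj, ← Finset.card_insert_of_notMem (a := r) (by simp [hr])]
      congr 1
      ext x
      by_cases hxr : x = r <;> simp [hxr]
  · rintro ⟨v, r⟩ hx ⟨v', r'⟩ hx' heq
    have hr : p r = none := by simp_all [attachments]
    have hr' : p r' = none := by simp_all [attachments]
    have hrr : r = r' := by
      by_contra hne
      simpa [hne, hr] using congrFun heq r
    subst hrr
    simpa using congrFun heq r

theorem card_isRootExtension_le {j : ℕ} {q : V → Option V} (hq : q ∈ rootedForests V (j + 1))
    [DecidableRel (IsRootExtension (V := V))] :
    ((rootedForests V j).bipartiteBelow IsRootExtension q).card ≤ j + 1 := by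
  rw [← (mem_rootedForests.1 hq).2]
  refine (Finset.card_le_card fun p hp => ?_).trans
    (Finset.card_image_le (f := fun r => Function.update q r none))
  obtain ⟨-, r, v, hr, rfl⟩ := Finset.mem_filter.1 hp
  exact Finset.mem_image.2 ⟨r, by simp, by simp [← hr]⟩

theorem card_rootedForests_mul_le (j : ℕ) :
    (rootedForests V j).card * (Fintype.card V * (Fintype.card V - j - 1)) ≤
      (rootedForests V (j + 1)).card * (j + 1) := by
  classical
  exact Finset.card_mul_le_card_mul IsRootExtension (fun _ hp => le_card_isRootExtension hp)
    fun _ hq => card_isRootExtension_le hq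

theorem pow_mul_descFactorial_le_card_rootedForests (j : ℕ) :
    Fintype.card V ^ j * (Fintype.card V - 1).descFactorial j ≤
      (rootedForests V j).card * j.factorial := by
  set n := Fintype.card V
  induction j with
  | zero =>
    have hempty : (fun _ => none) ∈ rootedForests V 0 :=
      mem_rootedForests.2 ⟨⟨fun _ => 0, by simp⟩, by simp⟩
    simpa using Finset.card_pos.2 ⟨_, hempty⟩
  | succ j ih =>
    rw [Nat.descFactorial_succ, Nat.factorial_succ]
    calc n ^ (j + 1) * ((n - 1 - j) * (n - 1).descFactorial j)
        = (n ^ j * (n - 1).descFactorial j) * (n * (n - j - 1)) := by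
          rw [Nat.sub_right_comm]; ring
      _ ≤ ((rootedForests V j).card * j.factorial) * (n * (n - j - 1)) := by gcongr
      _ = ((rootedForests V j).card * (n * (n - j - 1))) * j.factorial := by ring
      _ ≤ ((rootedForests V (j + 1)).card * (j + 1)) * j.factorial :=
          Nat.mul_le_mul_right _ (card_rootedForests_mul_le j)
      _ = _ := by ring

end RootedForests

section Trees

variable {V : Type*}

/-- The graph joining every vertex to its parent. -/
def parentGraph (p : V → Option V) : SimpleGraph V :=
  SimpleGraph.fromRel fun x y => p x = some y

theorem parentGraph_adj {p : V → Option V} (hp : IsRootedForest p) {x y : V} :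
    (parentGraph p).Adj x y ↔ p x = some y ∨ p y = some x := by
  obtain ⟨h, hh⟩ := hp
  rw [parentGraph, SimpleGraph.fromRel_adj]
  refine ⟨And.right, fun H => ⟨?_, H⟩⟩
  rintro rfl
  exact (hh _ _ (or_self_iff.1 H)).false

theorem parentGraph_connected {p : V → Option V} (hp : IsRootedForest p) {r : V}
    (hr : ∀ v, p v = none → v = r) : (parentGraph p).Connected := by
  have hreach : ∀ v, (parentGraph p).Reachable v r := by
    obtain ⟨h, hh⟩ := id hp
    intro v
    induction hv : h v using Nat.strong_induction_on generalizing v with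
    | _ m ih =>
      cases hpv : p v with
      | none => rw [hr v hpv]
      | some w =>
        have hadj : (parentGraph p).Adj v w := (parentGraph_adj hp).2 (Or.inl hpv)
        exact hadj.reachable.trans (ih (h w) (hv ▸ hh v w hpv) w rfl)
  exact { preconnected := fun u v => (hreach u).trans (hreach v).symm, nonempty := ⟨r⟩ }

theorem parentGraph_injective {p p' : V → Option V} (hp : IsRootedForest p)
    (hp' : IsRootedForest p') (hroots : ∀ v, p v = none ↔ p' v = none)
    (h : parentGraph p = parentGraph p') : p = p' := by
  obtain ⟨f, hf⟩ := id hp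
  funext x
  induction hx : f x using Nat.strong_induction_on generalizing x with
  | _ m ih =>
    cases hpx : p x with
    | none => exact ((hroots x).1 hpx).symm
    | some w =>
      have hadj : (parentGraph p').Adj x w := h ▸ (parentGraph_adj hp).2 (Or.inl hpx)
      rcases (parentGraph_adj hp').1 hadj with hxw | hwx
      · exact hxw.symm
      · have hlt := hf x w hpx
        have hpw : p w = some x := (ih (f w) (hx ▸ hlt) w rfl).trans hwx
        exact absurd (hf w x hpw) hlt.not_gt

theorem isTree_parentGraph [Finite V] {p : V → Option V} (hp : IsRootedForest p) {r : V}
    (hr : ∀ v, p v = none ↔ v = r) : (parentGraph p).IsTree := by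
  classical
  have := Fintype.ofFinite V
  have hconn := parentGraph_connected hp fun v => (hr v).1
  rw [SimpleGraph.isTree_iff_connected_and_card]
  refine ⟨hconn, le_antisymm ?_ hconn.card_vert_le_card_edgeSet_add_one⟩
  have hsub : (parentGraph p).edgeSet ⊆
      ((Finset.univ.erase r).image fun v => s(v, (p v).getD v) : Finset (Sym2 V)) := by
    have hmem {x y : V} (hxy : p x = some y) :
        s(x, y) ∈ (Finset.univ.erase r).image fun v => s(v, (p v).getD v) :=
      Finset.mem_image.2 ⟨x, by simp [← hr, hxy], by simp [hxy]⟩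
    rintro ⟨x, y⟩ hxy
    rcases (parentGraph_adj hp).1 hxy with hxy | hyx
    · exact hmem hxy
    · have hmem_swap := hmem hyx
      rwa [Sym2.eq_swap] at hmem_swap
  have hcard := ((Set.ncard_le_ncard hsub (Finset.finite_toSet _)).trans_eq
    (Set.ncard_coe_finset _)).trans Finset.card_image_le
  rw [Finset.card_erase_of_mem (Finset.mem_univ r), Finset.card_univ] at hcard
  have hpos : 0 < Fintype.card V := Fintype.card_pos_iff.2 ⟨r⟩
  rw [Nat.card_coe_set_eq, Nat.card_eq_fintype_card]
  lia

/-- The lower bound in Cayley's formula `n ^ (n - 2)` for the number of spanning trees: a rooted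
forest with `n - 1` edges is a tree together with one of its vertices. -/
theorem pow_card_le_card_mul_card_isTree [Fintype V] [Nonempty V] :
    Fintype.card V ^ (Fintype.card V - 1) ≤
      Fintype.card V * Nat.card {T : SimpleGraph V // T.IsTree} := by
  classical
  set n := Fintype.card V with hn
  have hforests : n ^ (n - 1) ≤ (rootedForests V (n - 1)).card := by
    have h := pow_mul_descFactorial_le_card_rootedForests (V := V) (n - 1)
    rw [Nat.descFactorial_self] at h
    exact Nat.le_of_mul_le_mul_right h (Nat.factorial_pos _)
  refine hforests.trans ?_
  have hroot (p : rootedForests V (n - 1)) : ∃ r, ∀ v, p.1 v = none ↔ v = r := by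
    have hpos : 0 < n := Fintype.card_pos
    obtain ⟨r, hr⟩ := Finset.card_eq_one.1
      (show Finset.card {v | p.1 v = none} = 1 by have := card_roots_add p.2; lia)
    exact ⟨r, fun v => by simpa using Finset.ext_iff.1 hr v⟩
  choose r hr using hroot
  have hforest (p : rootedForests V (n - 1)) : IsRootedForest p.1 := (mem_rootedForests.1 p.2).1
  rw [Nat.card_eq_fintype_card, hn, ← Fintype.card_prod, ← Fintype.card_coe]
  refine Fintype.card_le_of_injective (fun p => (r p, ⟨parentGraph p.1,
    isTree_parentGraph (hforest p) (hr p)⟩)) fun p p' hpp => ?_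
  simp only [Prod.mk.injEq, Subtype.mk.injEq] at hpp
  exact Subtype.ext (parentGraph_injective (hforest p) (hforest p')
    (fun v => by rw [hr p, hr p', hpp.1]) hpp.2)

theorem exists_adj_dist_lt {T : SimpleGraph V} (hT : T.Connected) {r v : V} (hv : v ≠ r) :
    ∃ w, T.Adj v w ∧ T.dist w r < T.dist v r := by
  obtain ⟨walk, hwalk⟩ := hT.exists_walk_length_eq_dist v r
  cases walk with
  | nil => exact absurd rfl hv
  | cons h q =>
    refine ⟨_, h, ?_⟩
    rw [← hwalk, SimpleGraph.Walk.length_cons]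
    exact Nat.lt_succ_of_le (SimpleGraph.dist_le q)

theorem exists_parentGraph_eq {T : SimpleGraph V} (hT : T.IsTree) (r : V) :
    ∃ p, (∀ v, p v = none ↔ v = r) ∧ (∀ v w, p v = some w → T.Adj v w) ∧ parentGraph p = T := by
  classical
  choose f hf using fun v : {v // v ≠ r} => exists_adj_dist_lt hT.connected v.2
  let p (v : V) : Option V := if hv : v = r then none else some (f ⟨v, hv⟩)
  have hroot (v : V) : p v = none ↔ v = r := by simp [p]
  have hadj (v w : V) (h : p v = some w) : T.Adj v w ∧ T.dist w r < T.dist v r := by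
    by_cases hv : v = r
    · simp [p, hv] at h
    · obtain rfl : f ⟨v, hv⟩ = w := by simpa [p, hv] using h
      exact hf ⟨v, hv⟩
  have hforest : IsRootedForest p := ⟨fun v => T.dist v r, fun v w h => (hadj v w h).2⟩
  refine ⟨p, hroot, fun v w h => (hadj v w h).1, ?_⟩
  have hle : parentGraph p ≤ T := fun v w h => by
    rcases (parentGraph_adj hforest).1 h with h | h
    · exact (hadj _ _ h).1
    · exact (hadj _ _ h).1.symm
  exact (SimpleGraph.isTree_iff_minimal_connected.1 hT).eq_of_le
    (parentGraph_connected hforest fun v => (hroot v).1) hle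

variable [Fintype V]

theorem card_isTree_avoiding_le [DecidableEq V] (S : Finset (V × V)) (r : V) :
    Nat.card {T : SimpleGraph V // T.IsTree ∧ ∀ x ∈ S, ¬ T.Adj x.1 x.2} ≤
      ∏ v ∈ Finset.univ.erase r, Finset.card {w | w ≠ v ∧ (v, w) ∉ S} := by
  let parents (v : V) : Finset (Option V) :=
    if v = r then {none} else ({w | w ≠ v ∧ (v, w) ∉ S} : Finset V).image some
  choose p hroot hadj hgraph using
    fun T : {T : SimpleGraph V // T.IsTree ∧ ∀ x ∈ S, ¬ T.Adj x.1 x.2} =>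
      exists_parentGraph_eq T.2.1 r
  have hmem T : p T ∈ Fintype.piFinset parents := by
    refine Fintype.mem_piFinset.2 fun v => ?_
    by_cases hv : v = r
    · simpa [parents, hv] using (hroot T r).2 rfl
    · obtain ⟨w, hw⟩ := Option.ne_none_iff_exists'.1 (mt (hroot T v).1 hv)
      have hvw := hadj T v w hw
      simpa [parents, hv, hw] using ⟨hvw.ne', fun hS => T.2.2 _ hS hvw⟩
  calc Nat.card {T : SimpleGraph V // T.IsTree ∧ ∀ x ∈ S, ¬ T.Adj x.1 x.2}
      ≤ Nat.card (Fintype.piFinset parents) :=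
        Nat.card_le_card_of_injective (fun T => ⟨p T, hmem T⟩) fun T T' h =>
          Subtype.ext (by rw [← hgraph T, ← hgraph T', Subtype.mk.inj h])
    _ = ∏ v, (parents v).card := by
        rw [Nat.card_eq_fintype_card, Fintype.card_coe, Fintype.card_piFinset]
    _ = _ := by
        rw [← Finset.mul_prod_erase _ _ (Finset.mem_univ r)]
        simp only [parents, if_true, Finset.card_singleton, one_mul]
        refine Finset.prod_congr rfl fun v hv => ?_
        rw [if_neg (Finset.ne_of_mem_erase hv),
          Finset.card_image_of_injective _ (Option.some_injective V)]

theorem prod_erase_le_pow_mul_exp [DecidableEq V] {s c : V → ℕ}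
    (hc : ∀ v, c v + (s v + 1) = Fintype.card V) (r : V) :
    ∏ v ∈ Finset.univ.erase r, (c v : ℝ) ≤ (Fintype.card V : ℝ) ^ (Fintype.card V - 1) *
      Real.exp (-((∑ v, s v : ℕ) / Fintype.card V : ℝ)) := by
  set n := Fintype.card V
  have hn : (0 : ℝ) < n := by exact_mod_cast Fintype.card_pos_iff.2 ⟨r⟩
  have hfactor (v : V) : (c v : ℝ) ≤ n * Real.exp (-((s v + 1 : ℝ) / n)) := by
    have hcv : (c v : ℝ) + (s v + 1) = n := by exact_mod_cast hc v
    calc (c v : ℝ) = n * (-((s v + 1 : ℝ) / n) + 1) := by field_simp; linarith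
      _ ≤ _ := by gcongr; exact Real.add_one_le_exp _
  refine (Finset.prod_le_prod (fun _ _ => Nat.cast_nonneg _) fun v _ => hfactor v).trans ?_
  have hcard : (Finset.univ.erase r).card = n - 1 := by
    rw [Finset.card_erase_of_mem (Finset.mem_univ r), Finset.card_univ]
  rw [Finset.prod_mul_distrib, Finset.prod_const, hcard, ← Real.exp_sum, Finset.sum_neg_distrib,
    ← Finset.sum_div]
  gcongr
  have hle : ∑ v, s v ≤ ∑ v ∈ Finset.univ.erase r, (s v + 1) := by
    rw [Finset.sum_add_distrib, Finset.sum_const, hcard, ← Finset.add_sum_erase _ s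
      (Finset.mem_univ r), smul_eq_mul]
    have := hc r
    lia
  exact_mod_cast hle

theorem card_isTree_avoiding_le_exp {S : Finset (V × V)} (hS : ∀ x ∈ S, x.1 ≠ x.2)
    [Nonempty V] :
    (Nat.card {T : SimpleGraph V // T.IsTree ∧ ∀ x ∈ S, ¬ T.Adj x.1 x.2} : ℝ) ≤
      Nat.card {T : SimpleGraph V // T.IsTree} *
        (Fintype.card V * Real.exp (-(S.card / Fintype.card V : ℝ))) := by
  classical
  obtain ⟨r⟩ := id ‹Nonempty V›
  let s (v : V) : ℕ := Finset.card {w | (v, w) ∈ S}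
  have hsum : S.card = ∑ v, s v := by
    rw [← Finset.card_sigma]
    exact Finset.card_equiv (Equiv.sigmaEquivProd V V).symm fun x => by simp
  have hc (v : V) : Finset.card {w | w ≠ v ∧ (v, w) ∉ S} + (s v + 1) = Fintype.card V := by
    rw [← Finset.card_insert_of_notMem (a := v) (by simpa using fun h => hS _ h rfl), add_comm,
      ← Finset.card_add_card_compl]
    congr 2
    ext w
    simp
  calc (Nat.card {T : SimpleGraph V // T.IsTree ∧ ∀ x ∈ S, ¬ T.Adj x.1 x.2} : ℝ)
      ≤ ∏ v ∈ Finset.univ.erase r, (Finset.card {w | w ≠ v ∧ (v, w) ∉ S} : ℝ) := by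
        exact_mod_cast card_isTree_avoiding_le S r
    _ ≤ (Fintype.card V : ℝ) ^ (Fintype.card V - 1) *
          Real.exp (-(S.card / Fintype.card V : ℝ)) := by
        rw [hsum]
        exact prod_erase_le_pow_mul_exp hc r
    _ ≤ (Fintype.card V * Nat.card {T : SimpleGraph V // T.IsTree} : ℝ) *
          Real.exp (-(S.card / Fintype.card V : ℝ)) := by
        gcongr
        exact_mod_cast pow_card_le_card_mul_card_isTree (V := V)
    _ = _ := by ring

end Trees

section Averaging

variable {G X : Type*} [Group G] [MulAction G X]

theorem card_filter_smul_mem_mul [Fintype G] [DecidableEq X] {A W : Finset X}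
    (htrans : ∀ x ∈ A, ∀ y ∈ A, ∃ g : G, g • x = y) (hinv : ∀ (g : G), ∀ x ∈ A, g • x ∈ A)
    {x : X} (hx : x ∈ A) (hW : W ⊆ A) :
    Finset.card {g : G | g • x ∈ W} * A.card = W.card * Fintype.card G := by
  have hconst z (hz : z ∈ A) :
      Finset.card {g : G | g • x = z} = Finset.card {g : G | g • x = x} := by
    obtain ⟨h, rfl⟩ := htrans z hz x hx
    exact Finset.card_equiv (Equiv.mulLeft h) fun g => by simp [mul_smul]
  have hcard (Y : Finset X) (hY : Y ⊆ A) :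
      Finset.card {g : G | g • x ∈ Y} = Y.card * Finset.card {g : G | g • x = x} := by
    rw [Finset.card_eq_sum_card_fiberwise (f := fun g : G => g • x) (t := Y)
      fun g hg => by simpa using hg, ← smul_eq_mul, ← Finset.sum_const]
    refine Finset.sum_congr rfl fun z hz => ?_
    rw [← hconst z (hY hz), Finset.filter_filter]
    congr 1
    ext g
    simp only [Finset.mem_filter_univ, and_iff_right_iff_imp]
    exact fun hgz => hgz ▸ hz
  have hall : Finset.card {g : G | g • x ∈ A} = Fintype.card G := by
    rw [Finset.filter_true_of_mem fun g _ => hinv g x hx, Finset.card_univ]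
  rw [← hall, hcard W hW, hcard A subset_rfl]
  ring

theorem exists_card_filter_smul_mem_mul_le [Finite G] [DecidableEq X] {A S W : Finset X}
    (htrans : ∀ x ∈ A, ∀ y ∈ A, ∃ g : G, g • x = y) (hinv : ∀ (g : G), ∀ x ∈ A, g • x ∈ A)
    (hS : S ⊆ A) (hW : W ⊆ A) :
    ∃ g : G, Finset.card {x ∈ S | g • x ∈ W} * A.card ≤ S.card * W.card := by
  have := Fintype.ofFinite G
  have hswap : ∑ g : G, Finset.card {x ∈ S | g • x ∈ W} =
      ∑ x ∈ S, Finset.card {g : G | g • x ∈ W} :=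
    Finset.sum_card_bipartiteAbove_eq_sum_card_bipartiteBelow fun (g : G) x => g • x ∈ W
  have htotal : ∑ g : G, Finset.card {x ∈ S | g • x ∈ W} * A.card = ∑ _g : G, S.card * W.card := by
    rw [← Finset.sum_mul, hswap, Finset.sum_mul, Finset.sum_congr rfl fun x hx =>
      card_filter_smul_mem_mul htrans hinv (hS hx) hW, Finset.sum_const, Finset.sum_const,
      Finset.card_univ, smul_eq_mul, smul_eq_mul]
    ring
  obtain ⟨g, -, hg⟩ := Finset.exists_le_of_sum_le Finset.univ_nonempty htotal.le
  exact ⟨g, hg⟩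

end Averaging

section TreeLaw

variable {n : ℕ}

instance : Finite (SpanningTree n) := Subtype.finite

instance : DiscreteMeasurableSpace (SpanningTree n) := ⟨fun _ => trivial⟩

instance [NeZero n] : Nonempty (SpanningTree n) := by
  obtain ⟨T, -, hT⟩ := (SimpleGraph.connected_top (V := Fin n)).exists_isTree_le
  exact ⟨⟨T, hT⟩⟩

/-- The uniform law on the spanning trees, the law of a single offered tree. -/
noncomputable def treeLaw (n : ℕ) : Measure (SpanningTree n) :=
  ProbabilityTheory.uniformOn Set.univ

instance [NeZero n] : IsProbabilityMeasure (treeLaw n) :=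
  inferInstanceAs (IsProbabilityMeasure (ProbabilityTheory.uniformOn Set.univ))

theorem treeLaw_real_eq (A : Set (SpanningTree n)) :
    (treeLaw n).real A = A.ncard / Nat.card (SpanningTree n) := by
  have := Fintype.ofFinite (SpanningTree n)
  rw [Measure.real, treeLaw, ProbabilityTheory.uniformOn_univ, ENNReal.toReal_div,
    ← Nat.card_eq_fintype_card, ENNReal.toReal_natCast, Measure.count_apply .of_discrete,
    ← A.toFinite.cast_ncard_eq, ENat.toENNReal_coe, ENNReal.toReal_natCast]

/-- The trees with an edge among the pairs in `S`. -/
def hits (S : Finset (Fin n × Fin n)) : Set (SpanningTree n) :=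
  {T | ∃ x ∈ S, T.1.Adj x.1 x.2}

theorem hits_union [DecidableEq (Fin n × Fin n)] (S S' : Finset (Fin n × Fin n)) :
    hits (S ∪ S') = hits S ∪ hits S' := by
  ext T
  simp only [hits, Finset.mem_union, Set.mem_union, Set.mem_ofPred_eq, or_and_right, exists_or]

theorem treeLaw_real_compl_hits_le [NeZero n] {S : Finset (Fin n × Fin n)}
    (hS : S ⊆ Finset.univ.offDiag) :
    (treeLaw n).real (hits S)ᶜ ≤ n * Real.exp (-(S.card / n : ℝ)) := by
  rw [treeLaw_real_eq, div_le_iff₀' (by exact_mod_cast Nat.card_pos)]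
  refine le_trans (Nat.cast_le.2 ?_) ((card_isTree_avoiding_le_exp fun x hx =>
    (Finset.mem_offDiag.1 (hS hx)).2.2).trans_eq (by rw [Fintype.card_fin]; rfl))
  exact Nat.card_le_card_of_injective (fun T : ((hits S)ᶜ : Set (SpanningTree n)) =>
    ⟨T.1.1, T.1.2, fun x hx hadj => T.2 ⟨x, hx, hadj⟩⟩) fun T T' h =>
      Subtype.ext (Subtype.ext (Subtype.mk.inj h))

/-- Relabelling spanning trees by a permutation of the vertices. -/
def relabelTree (π : Equiv.Perm (Fin n)) : SpanningTree n ≃ SpanningTree n where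
  toFun T := ⟨T.1.comap π, (SimpleGraph.Iso.comap π T.1).isTree_iff.2 T.2⟩
  invFun T := ⟨T.1.comap π.symm, (SimpleGraph.Iso.comap π.symm T.1).isTree_iff.2 T.2⟩
  left_inv T := Subtype.ext (by ext; simp)
  right_inv T := Subtype.ext (by ext; simp)

theorem treeLaw_real_preimage_relabelTree (π : Equiv.Perm (Fin n)) (A : Set (SpanningTree n)) :
    (treeLaw n).real (relabelTree π ⁻¹' A) = (treeLaw n).real A := by
  rw [treeLaw_real_eq, treeLaw_real_eq, Set.ncard, Set.ncard,
    Set.encard_preimage_of_bijective (relabelTree π).bijective]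

theorem treeLaw_real_hits_image (π : Equiv.Perm (Fin n)) (S : Finset (Fin n × Fin n)) :
    (treeLaw n).real (hits (S.image (π • ·))) = (treeLaw n).real (hits S) := by
  rw [← treeLaw_real_preimage_relabelTree π (hits S)]
  congr 1
  ext T
  simp only [hits, Finset.exists_mem_image, Set.mem_preimage, Set.mem_ofPred_eq]
  rfl

theorem exists_perm_smul_eq {x y : Fin n × Fin n} (hx : x ∈ Finset.univ.offDiag)
    (hy : y ∈ Finset.univ.offDiag) : ∃ π : Equiv.Perm (Fin n), π • x = y := by
  obtain ⟨π, hπ₁, hπ₂⟩ := MulAction.is_two_pretransitive_iff.1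
    (Equiv.Perm.isMultiplyPretransitive (Fin n) 2) (Finset.mem_offDiag.1 hx).2.2
    (Finset.mem_offDiag.1 hy).2.2
  exact ⟨π, Prod.ext hπ₁ hπ₂⟩

theorem perm_smul_mem_offDiag (π : Equiv.Perm (Fin n)) {x : Fin n × Fin n}
    (hx : x ∈ Finset.univ.offDiag) : π • x ∈ Finset.univ.offDiag := by
  simpa using hx

theorem card_offDiag_fin : (Finset.univ : Finset (Fin n)).offDiag.card = n * (n - 1) := by
  rw [Finset.offDiag_card, Finset.card_univ, Fintype.card_fin, Nat.mul_sub_one]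

theorem card_filter_adj {V : Type*} [Fintype V] (G : SimpleGraph V) [DecidableRel G.Adj] :
    Finset.card {x : V × V | G.Adj x.1 x.2} = 2 * G.edgeFinset.card := by
  classical
  rw [← G.dart_card_eq_twice_card_edges, ← Fintype.card_subtype]
  exact Fintype.card_congr ⟨fun x => ⟨x.1, x.2⟩, fun d => ⟨d.toProd, d.adj⟩, fun _ => rfl,
    fun _ => rfl⟩

theorem treeLaw_real_hits_singleton (hn : 2 ≤ n) {x : Fin n × Fin n}
    (hx : x ∈ Finset.univ.offDiag) : (treeLaw n).real (hits {x}) = 2 / n := by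
  classical
  have : NeZero n := ⟨by lia⟩
  have hconst y (hy : y ∈ Finset.univ.offDiag) :
      (treeLaw n).real (hits {y}) = (treeLaw n).real (hits {x}) := by
    obtain ⟨π, rfl⟩ := exists_perm_smul_eq hx hy
    rw [← treeLaw_real_hits_image π {x}, Finset.image_singleton]
  have hedges (T : SpanningTree n) :
      ∑ y ∈ Finset.univ.offDiag, (hits {y}).indicator (fun _ => (1 : ℝ)) T = 2 * (n - 1) := by
    have hT := T.2.card_edgeFinset
    have hpairs := card_filter_adj T.1
    rw [Fintype.card_fin] at hT
    have : ({y ∈ Finset.univ.offDiag | T ∈ hits {y}} : Finset (Fin n × Fin n)) =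
        ({y | T.1.Adj y.1 y.2} : Finset _) := by
      ext y
      simpa [hits] using fun h => h.ne
    simp only [Set.indicator_apply, Finset.sum_boole, this, hpairs, ← hT]
    push_cast
    ring
  have hmean : (n * (n - 1) : ℝ) * (treeLaw n).real (hits {x}) = 2 * (n - 1) :=
    calc (n * (n - 1) : ℝ) * (treeLaw n).real (hits {x})
        = ∑ y ∈ Finset.univ.offDiag, (treeLaw n).real (hits {y}) := by
          rw [Finset.sum_congr rfl hconst, Finset.sum_const, card_offDiag_fin, nsmul_eq_mul,
            Nat.cast_mul, Nat.cast_pred (by lia)]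
      _ = ∫ T, ∑ y ∈ Finset.univ.offDiag, (hits {y}).indicator (fun _ => (1 : ℝ)) T
            ∂treeLaw n := by
          rw [integral_finsetSum _ fun _ _ => .of_finite]
          refine Finset.sum_congr rfl fun y _ => ?_
          rw [integral_indicator_const _ .of_discrete, smul_eq_mul, mul_one]
      _ = 2 * (n - 1) := by simp [hedges]
  have hn' : (2 : ℝ) ≤ n := by exact_mod_cast hn
  field_simp
  nlinarith

theorem treeLaw_real_compl_hits_star_le (hn : 2 ≤ n) {S : Finset (Fin n × Fin n)} {v : Fin n}
    {W : Finset (Fin n)} (hS : ∀ w ≠ v, w ∉ W → (v, w) ∈ S) :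
    (treeLaw n).real (hits S)ᶜ ≤ 2 * W.card / n := by
  have : NeZero n := ⟨by lia⟩
  have : Nontrivial (Fin n) := Fin.nontrivial_iff_two_le.2 hn
  have hsub : (hits S)ᶜ ⊆ ⋃ w ∈ W.erase v, hits {(v, w)} := by
    intro T hT
    obtain ⟨w, hw⟩ := T.2.connected.preconnected.exists_adj_of_nontrivial v
    refine Set.mem_biUnion (x := w) (Finset.mem_coe.2 (Finset.mem_erase.2 ⟨hw.ne', ?_⟩))
      ⟨_, Finset.mem_singleton_self _, hw⟩
    by_contra hwW
    exact hT ⟨_, hS w hw.ne' hwW, hw⟩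
  calc (treeLaw n).real (hits S)ᶜ
      ≤ (treeLaw n).real (⋃ w ∈ W.erase v, hits {(v, w)}) :=
        measureReal_mono hsub (measure_ne_top _ _)
    _ ≤ ∑ w ∈ W.erase v, (treeLaw n).real (hits {(v, w)}) := measureReal_biUnion_finset_le _ _
    _ = (W.erase v).card * (2 / n) := by
      rw [Finset.sum_congr rfl fun w hw => treeLaw_real_hits_singleton hn
        (Finset.mem_offDiag.2 ⟨Finset.mem_univ _, Finset.mem_univ _,
          (Finset.ne_of_mem_erase hw).symm⟩), Finset.sum_const, nsmul_eq_mul]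
    _ ≤ W.card * (2 / n) := by gcongr; exact Finset.erase_subset _ _
    _ = 2 * W.card / n := by ring

theorem exists_hits_le_mul_hits (hn : 2 ≤ n) {S : Finset (Fin n × Fin n)}
    (hS : S ⊆ Finset.univ.offDiag) (t : ℕ) :
    ∃ W ⊆ Finset.univ.offDiag, (t * S.card ≤ 2 * W.card ∨ n * (n - 1) ≤ 2 * W.card) ∧
      (treeLaw n).real (hits W) ≤ t * (treeLaw n).real (hits S) := by
  classical
  have : NeZero n := ⟨by lia⟩
  induction t with
  | zero => exact ⟨∅, by simp, by simp, by simp [hits]⟩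
  | succ t ih =>
    obtain ⟨W, hW, hcard, hprob⟩ := ih
    by_cases hbig : n * (n - 1) ≤ 2 * W.card
    · exact ⟨W, hW, Or.inr hbig, hprob.trans (by gcongr; lia)⟩
    obtain ⟨π, hπ⟩ := exists_card_filter_smul_mem_mul_le
      (fun x hx y hy => exists_perm_smul_eq hx hy) (fun π x => perm_smul_mem_offDiag π) hS hW
    refine ⟨W ∪ S.image (π • ·), Finset.union_subset hW (Finset.image_subset_iff.2 fun x hx =>
      perm_smul_mem_offDiag π (hS hx)), Or.inl ?_, ?_⟩
    · have hoverlap : 2 * Finset.card {x ∈ S | π • x ∈ W} ≤ S.card := by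
        rw [card_offDiag_fin] at hπ
        have hpos : 0 < n * (n - 1) := Nat.mul_pos (by lia) (by lia)
        refine Nat.le_of_mul_le_mul_right ?_ hpos
        nlinarith
      have hinter : (W ∩ S.image (π • ·)).card ≤ Finset.card {x ∈ S | π • x ∈ W} := by
        rw [Finset.inter_comm, ← Finset.filter_mem_eq_inter, Finset.filter_image]
        exact Finset.card_image_le
      have hunion := Finset.card_union_add_card_inter W (S.image (π • ·))
      rw [Finset.card_image_of_injective S (MulAction.injective π)] at hunion
      have := hcard.resolve_right hbig
      rw [Nat.succ_mul]
      lia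
    · calc (treeLaw n).real (hits (W ∪ S.image (π • ·)))
          ≤ (treeLaw n).real (hits W) + (treeLaw n).real (hits S) := by
            rw [hits_union, ← treeLaw_real_hits_image π S]
            exact measureReal_union_le _ _
        _ ≤ (t + 1 : ℕ) * (treeLaw n).real (hits S) := by push_cast; linarith

theorem le_treeLaw_real_hits (hn : 2 ≤ n) {S : Finset (Fin n × Fin n)}
    (hS : S ⊆ Finset.univ.offDiag) (hS₀ : S.Nonempty) {L : ℕ} (hSL : S.card ≤ L)
    (hL : 2 * L ≤ n * (n - 1)) (hexp : n * Real.exp (-(L / n : ℝ)) ≤ 1 / 2) :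
    S.card / (6 * L) ≤ (treeLaw n).real (hits S) := by
  have : NeZero n := ⟨by lia⟩
  have hSpos := hS₀.card_pos
  set t := 2 * L / S.card + 1 with ht
  obtain ⟨W, hW, hcard, hprob⟩ := exists_hits_le_mul_hits hn hS t
  have hLW : L ≤ W.card := by
    rcases hcard with h | h
    · have : 2 * L < t * S.card := mul_comm S.card t ▸ Nat.lt_mul_div_succ _ hSpos
      lia
    · lia
  have hmiss : (treeLaw n).real (hits W)ᶜ ≤ 1 / 2 :=
    calc (treeLaw n).real (hits W)ᶜ ≤ n * Real.exp (-(W.card / n : ℝ)) :=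
          treeLaw_real_compl_hits_le hW
      _ ≤ n * Real.exp (-(L / n : ℝ)) := by gcongr
      _ ≤ 1 / 2 := hexp
  rw [probReal_compl_eq_one_sub .of_discrete] at hmiss
  have htS : (t : ℝ) * S.card ≤ 3 * L := by
    have : t * S.card ≤ 3 * L := by
      rw [ht, Nat.succ_mul]
      have := Nat.div_mul_le_self (2 * L) S.card
      lia
    exact_mod_cast this
  have hL₀ : (0 : ℝ) < L := by exact_mod_cast hSpos.trans_le hSL
  rw [div_le_iff₀ (by positivity)]
  nlinarith [measureReal_nonneg (μ := treeLaw n) (s := hits S), Nat.cast_nonneg (α := ℝ) S.card]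

end TreeLaw

section RandomRecursion

variable {α β : Type*}

/-- The recursion `x (t + 1) = g (x t) (T t)` driven by the inputs `T`. -/
def driven (g : α → β → α) (x : α) (T : ℕ → β) : ℕ → α
  | 0 => x
  | t + 1 => g (driven g x T t) (T t)

theorem driven_congr (g : α → β → α) (x : α) {T T' : ℕ → β} {t : ℕ}
    (h : ∀ i < t, T i = T' i) : driven g x T t = driven g x T' t := by
  induction t with
  | zero => rfl
  | succ t ih => rw [driven, driven, ih fun i hi => h i (by lia), h t (by lia)]

open Classical in
/-- The recursion step that stays put once it has entered `A`. -/
noncomputable def stopAt (A : Set α) (g : α → β → α) (x : α) (b : β) : α :=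
  if x ∈ A then x else g x b

theorem exists_driven_stopAt_eq (A : Set α) (g : α → β → α) (x : α) (T : ℕ → β) (N : ℕ) :
    ∃ t ≤ N, driven (stopAt A g) x T N = driven g x T t ∧ (driven g x T t ∉ A → t = N) ∧
      ∀ s < t, driven g x T s ∉ A := by
  induction N with
  | zero => exact ⟨0, le_rfl, rfl, fun _ => rfl, by simp⟩
  | succ N ih =>
    obtain ⟨t, ht, heq, hmem, hbefore⟩ := ih
    by_cases h : driven g x T t ∈ A
    · exact ⟨t, by lia, by rw [driven, heq, stopAt, if_pos h], fun h' => absurd h h', hbefore⟩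
    · obtain rfl := hmem h
      refine ⟨t + 1, le_rfl, by rw [driven, heq, stopAt, if_neg h, driven], fun _ => rfl,
        fun s hs => ?_⟩
      rcases Nat.lt_succ_iff_lt_or_eq.1 hs with hs | rfl
      exacts [hbefore s hs, h]

variable [MeasurableSpace β] {μ : Measure β}

/-- The mean of `f` after one step with a random input, as a function of the present state. -/
noncomputable def stepMean (μ : Measure β) (g : α → β → α) (f : α → ℝ) (x : α) : ℝ :=
  ∫ b, f (g x b) ∂μ

variable {A : Set α} {g : α → β → α} {f : α → ℝ} {x : α}

theorem stepMean_stopAt_of_notMem (hx : x ∉ A) :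
    stepMean μ (stopAt A g) f x = ∫ b, f (g x b) ∂μ := by
  simp [stepMean, stopAt, hx]

variable [IsProbabilityMeasure μ]

theorem stepMean_stopAt_of_mem (hx : x ∈ A) : stepMean μ (stopAt A g) f x = f x := by
  simp [stepMean, stopAt, hx]

theorem iterate_stepMean_stopAt_of_mem (hx : x ∈ A) (t : ℕ) :
    (stepMean μ (stopAt A g))^[t] f x = f x := by
  induction t with
  | zero => rfl
  | succ t ih => rw [Function.iterate_succ_apply', stepMean_stopAt_of_mem hx, ih]

variable [Finite β] [DiscreteMeasurableSpace β]

theorem iterate_stepMean_le {c : ℝ} (hf : ∀ y, f y ≤ c) (t : ℕ) :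
    (stepMean μ g)^[t] f x ≤ c := by
  induction t generalizing x with
  | zero => exact hf x
  | succ t ih =>
    rw [Function.iterate_succ_apply', stepMean]
    exact (integral_mono .of_finite (integrable_const c) fun b => ih).trans_eq (by simp)

theorem indepFun_driven [MeasurableSpace α] (g : α → β → α) (x : α) (t : ℕ) :
    ProbabilityTheory.IndepFun (fun T : ℕ → β => driven g x T t) (fun T => T t)
      (Measure.infinitePi fun _ => μ) := by
  have hindep : ProbabilityTheory.iIndepFun (fun (i : ℕ) (T : ℕ → β) => T i)
      (Measure.infinitePi fun _ : ℕ => μ) :=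
    ProbabilityTheory.iIndepFun_infinitePi (X := fun _ => id) fun _ => measurable_id
  obtain ⟨b₀⟩ : Nonempty β := nonempty_of_isProbabilityMeasure μ
  classical
  let past (y : Finset.range t → β) : α :=
    driven g x (fun i => if hi : i ∈ Finset.range t then y ⟨i, hi⟩ else b₀) t
  have h := (hindep.indepFun_finset (Finset.range t) {t} (by simp) measurable_pi_apply).comp
    (measurable_of_countable past) (measurable_pi_apply ⟨t, Finset.mem_singleton_self t⟩)
  rwa [show past ∘ _ = fun T => driven g x T t from
    funext fun T => driven_congr g x fun i hi => by simp [hi]] at h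

theorem measurable_driven [Finite α] [MeasurableSpace α] [DiscreteMeasurableSpace α]
    (g : α → β → α) (x : α) (t : ℕ) : Measurable fun T : ℕ → β => driven g x T t := by
  induction t with
  | zero => exact measurable_const
  | succ t ih =>
    exact (measurable_of_countable (Function.uncurry g)).comp (ih.prodMk (measurable_pi_apply t))

theorem integral_driven [Finite α] (g : α → β → α) (f : α → ℝ) (x : α) (t : ℕ) :
    ∫ T, f (driven g x T t) ∂(Measure.infinitePi fun _ : ℕ => μ) = (stepMean μ g)^[t] f x := by
  let _ : MeasurableSpace α := ⊤
  have : DiscreteMeasurableSpace α := ⟨fun _ => trivial⟩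
  have hmeas := measurable_driven (β := β) g x
  induction t generalizing f with
  | zero => simp [driven]
  | succ t ih =>
    rw [Function.iterate_succ_apply, ← ih]
    set ν := Measure.infinitePi fun _ : ℕ => μ
    have hlaw : ν.map (fun T => (driven g x T t, T t)) = (ν.map (driven g x · t)).prod μ := by
      rw [(ProbabilityTheory.indepFun_iff_map_prod_eq_prod_map_map (hmeas t).aemeasurable
        (measurable_pi_apply t).aemeasurable).1 (indepFun_driven g x t)]
      congr 1
      exact Measure.infinitePi_map_eval (fun _ : ℕ => μ) t
    have := Measure.isProbabilityMeasure_map (μ := ν) (hmeas t).aemeasurable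
    calc ∫ T, f (driven g x T (t + 1)) ∂ν
        = ∫ y, f (g y.1 y.2) ∂(ν.map fun T => (driven g x T t, T t)) := by
          rw [integral_map ((hmeas t).prodMk (measurable_pi_apply t)).aemeasurable
            (measurable_of_countable _).aestronglyMeasurable]
          rfl
      _ = ∫ y, stepMean μ g f y ∂(ν.map (driven g x · t)) := by
          rw [hlaw, integral_prod _ .of_finite]
          rfl
      _ = ∫ T, stepMean μ g f (driven g x T t) ∂ν :=
          integral_map (hmeas t).aemeasurable
            (measurable_of_countable _).aestronglyMeasurable

theorem measureReal_driven_mem [Finite α] (g : α → β → α) (B : Set α) (x : α) (t : ℕ) :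
    (Measure.infinitePi fun _ : ℕ => μ).real {T | driven g x T t ∈ B} =
      (stepMean μ g)^[t] (B.indicator 1) x := by
  let _ : MeasurableSpace α := ⊤
  have : DiscreteMeasurableSpace α := ⟨fun _ => trivial⟩
  rw [← integral_driven]
  exact (integral_indicator_one (measurable_driven g x t .of_discrete)).symm

/-- A potential argument for one random step: a success in `E` pays `(1 + w * b) / l`, which
makes up for a unit charge per step and for the loss `w` suffered in `E'`. -/
theorem integral_le_sub_one {f : β → ℝ} {E E' : Set β} {B w l b : ℝ} (hw : 0 ≤ w) (hl : 0 < l)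
    (hlE : l ≤ μ.real E) (hb : μ.real (Eᶜ ∩ E') ≤ b) (hE : ∀ y ∈ E, f y ≤ B - (1 + w * b) / l)
    (hE' : ∀ y ∈ Eᶜ ∩ E', f y ≤ B + w) (hB : ∀ y ∈ Eᶜ \ E', f y ≤ B) :
    ∫ y, f y ∂μ ≤ B - 1 := by
  have hle y : f y ≤ B - E.indicator (fun _ => (1 + w * b) / l) y +
      (Eᶜ ∩ E').indicator (fun _ => w) y := by
    by_cases hyE : y ∈ E
    · simpa [hyE] using hE y hyE
    by_cases hyE' : y ∈ E'
    · simpa [hyE, hyE'] using hE' y ⟨hyE, hyE'⟩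
    · simpa [hyE, hyE'] using hB y ⟨hyE, hyE'⟩
  have hb₀ : 0 ≤ b := measureReal_nonneg.trans hb
  calc ∫ y, f y ∂μ
      ≤ ∫ y, B - E.indicator (fun _ => (1 + w * b) / l) y +
          (Eᶜ ∩ E').indicator (fun _ => w) y ∂μ := integral_mono .of_finite .of_finite hle
    _ = B - μ.real E * ((1 + w * b) / l) + μ.real (Eᶜ ∩ E') * w := by
      rw [integral_add .of_finite .of_finite, integral_sub .of_finite .of_finite,
        integral_indicator_const _ .of_discrete, integral_indicator_const _ .of_discrete]
      simp
    _ ≤ B - l * ((1 + w * b) / l) + b * w := by gcongr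
    _ = B - 1 := by field_simp; ring

end RandomRecursion

section Rounds

/-- The graph obtained by adding the edge between the two vertices of a pair. -/
def addPair {V : Type*} (F : SimpleGraph V) (x : V × V) : SimpleGraph V :=
  F ⊔ SimpleGraph.fromEdgeSet {s(x.1, x.2)}

theorem addPair_adj {V : Type*} {F : SimpleGraph V} {x : V × V} (hx : x.1 ≠ x.2) {a b : V} :
    (addPair F x).Adj a b ↔ F.Adj a b ∨ (a = x.1 ∧ b = x.2) ∨ (a = x.2 ∧ b = x.1) := by
  rw [addPair, SimpleGraph.sup_adj, SimpleGraph.fromEdgeSet_adj, Set.mem_singleton_iff,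
    Sym2.eq_iff, and_iff_left_iff_imp.2]
  rintro (⟨rfl, rfl⟩ | ⟨rfl, rfl⟩)
  exacts [hx, hx.symm]

theorem ncard_edgeSet_addPair {V : Type*} [Finite V] {F : SimpleGraph V} {x : V × V}
    (hx : x.1 ≠ x.2) (hF : ¬ F.Adj x.1 x.2) :
    (addPair F x).edgeSet.ncard = F.edgeSet.ncard + 1 := by
  have : (addPair F x).edgeSet = insert s(x.1, x.2) F.edgeSet := by
    rw [addPair, SimpleGraph.edgeSet_sup, SimpleGraph.edgeSet_fromEdgeSet, Set.union_comm,
      sdiff_eq_left.2 (by simpa using hx), Set.singleton_union]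
  rw [this, Set.ncard_insert_of_notMem (by simpa using hF) (Set.toFinite _)]

variable {n : ℕ}

/-- The graph after one more round of the strategy `σ`. -/
def nextGraph (σ : Strategy n) (F : SimpleGraph (Fin n)) (T : SpanningTree n) :
    SimpleGraph (Fin n) :=
  F ⊔ SimpleGraph.fromEdgeSet {σ.pick F T}

theorem graphAfter_eq_driven (σ : Strategy n) (T : ℕ → SpanningTree n) (t : ℕ) :
    graphAfter σ T t = driven (nextGraph σ) ⊥ T t := by
  induction t with
  | zero => rfl
  | succ t ih => rw [graphAfter, driven, nextGraph, ih]

theorem hittingTime_eq {σ : Strategy n} {P : Set (SimpleGraph (Fin n))}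
    {T : ℕ → SpanningTree n} {t : ℕ} (ht : graphAfter σ T t ∈ P)
    (hbefore : ∀ s < t, graphAfter σ T s ∉ P) : hittingTime σ P T = t := by
  refine le_antisymm (iInf₂_le t ht) (le_iInf₂ fun i hi => ?_)
  by_contra hlt
  exact hbefore i (by exact_mod_cast not_le.1 hlt) hi

/-- The strategy `σ` picks a preferred pair whenever the tree has one, and otherwise it repeats an
edge whenever it can. -/
def Prefers (σ : Strategy n) (S : SimpleGraph (Fin n) → Finset (Fin n × Fin n)) : Prop :=
  ∀ F, (∀ T ∈ hits (S F), ∃ x ∈ S F, nextGraph σ F T = addPair F x) ∧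
    ∀ T ∉ hits (S F), ¬ Disjoint T.1.edgeSet F.edgeSet → nextGraph σ F T = F

theorem exists_prefers (hn : 2 ≤ n) (S : SimpleGraph (Fin n) → Finset (Fin n × Fin n)) :
    ∃ σ : Strategy n, Prefers σ S := by
  have : Nontrivial (Fin n) := Fin.nontrivial_iff_two_le.2 hn
  have hpick F (T : SpanningTree n) : ∃ e ∈ T.1.edgeSet,
      (T ∈ hits (S F) → ∃ x ∈ S F, e = s(x.1, x.2)) ∧
      (T ∉ hits (S F) → ¬ Disjoint T.1.edgeSet F.edgeSet → e ∈ F.edgeSet) := by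
    by_cases hT : T ∈ hits (S F)
    · obtain ⟨x, hx, hadj⟩ := id hT
      exact ⟨s(x.1, x.2), hadj, fun _ => ⟨x, hx, rfl⟩, fun h => absurd hT h⟩
    by_cases hd : Disjoint T.1.edgeSet F.edgeSet
    · obtain ⟨w, hw⟩ := T.2.connected.preconnected.exists_adj_of_nontrivial ⟨0, by lia⟩
      exact ⟨s(_, w), hw, fun h => absurd h hT, fun _ h => absurd hd h⟩
    · obtain ⟨e, he, heF⟩ := Set.not_disjoint_iff.1 hd
      exact ⟨e, he, fun h => absurd h hT, fun _ _ => heF⟩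
  choose pick hmem hhit hrepeat using hpick
  refine ⟨⟨pick, hmem⟩, fun F => ⟨fun T hT => ?_, fun T hT hd => ?_⟩⟩
  · obtain ⟨x, hx, he⟩ := hhit F T hT
    exact ⟨x, hx, by simp only [nextGraph, addPair, he]⟩
  · rw [nextGraph, sup_eq_left, ← SimpleGraph.edgeSet_subset_edgeSet,
      SimpleGraph.edgeSet_fromEdgeSet]
    exact Set.sdiff_subset.trans (Set.singleton_subset_iff.2 (hrepeat F T hT hd))

/-- The probability that the process started from a given graph does not reach `Valid ∩ P` within
`t` rounds before leaving `Valid`. -/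
noncomputable def missProb (σ : Strategy n) (Valid P : Set (SimpleGraph (Fin n))) (t : ℕ) :
    SimpleGraph (Fin n) → ℝ :=
  (stepMean (treeLaw n) (stopAt (Valid \ P)ᶜ (nextGraph σ)))^[t] ((Valid ∩ P)ᶜ.indicator 1)

section MissProb

variable {σ : Strategy n} {Valid P : Set (SimpleGraph (Fin n))} {t : ℕ} {F : SimpleGraph (Fin n)}

theorem missProb_succ (hF : F ∈ Valid \ P) :
    missProb σ Valid P (t + 1) F =
      ∫ T, missProb σ Valid P t (nextGraph σ F T) ∂treeLaw n := by
  rw [missProb, Function.iterate_succ_apply', stepMean_stopAt_of_notMem (not_not.2 hF)]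
  rfl

variable [NeZero n]

instance : IsProbabilityMeasure (treesLaw n) :=
  inferInstanceAs (IsProbabilityMeasure (Measure.infinitePi fun _ => treeLaw n))

theorem missProb_le_one : missProb σ Valid P t F ≤ 1 :=
  iterate_stepMean_le (fun _ => Set.indicator_apply_le' (fun _ => le_rfl) fun _ => zero_le_one) t

theorem missProb_eq_zero (hF : F ∈ Valid ∩ P) : missProb σ Valid P t F = 0 := by
  rw [missProb, iterate_stepMean_stopAt_of_mem fun h => h.2 hF.2,
    Set.indicator_of_notMem (not_not.2 hF)]

theorem one_sub_missProb_le (σ : Strategy n) (Valid P : Set (SimpleGraph (Fin n))) (N : ℕ) :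
    1 - missProb σ Valid P N ⊥ ≤ (treesLaw n).real {T | ∃ t ≤ N, hittingTime σ P T = (t : ℕ∞) ∧
      graphAfter σ T t ∈ Valid ∩ P} := by
  set E := {T | ∃ t ≤ N, hittingTime σ P T = (t : ℕ∞) ∧ graphAfter σ T t ∈ Valid ∩ P}
  set miss := {T | driven (stopAt (Valid \ P)ᶜ (nextGraph σ)) ⊥ T N ∈ (Valid ∩ P)ᶜ} with hmiss
  have hcover : E ∪ miss = Set.univ := by
    refine Set.eq_univ_of_forall fun T => or_iff_not_imp_right.2 fun hT => ?_
    obtain ⟨t, ht, heq, -, hbefore⟩ :=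
      exists_driven_stopAt_eq (Valid \ P)ᶜ (nextGraph σ) ⊥ T N
    rw [hmiss, Set.mem_ofPred_eq, Set.notMem_compl_iff, heq, ← graphAfter_eq_driven] at hT
    refine ⟨t, ht, hittingTime_eq hT.2 fun s hs => ?_, hT⟩
    rw [graphAfter_eq_driven]
    exact (not_not.1 (hbefore s hs)).2
  have hprob : (treesLaw n).real miss = missProb σ Valid P N ⊥ := measureReal_driven_mem _ _ _ _
  have := measureReal_union_le (μ := treesLaw n) E miss
  rw [hcover, probReal_univ, hprob] at this
  linarith

/-- Each pair in `S` can be joined by a new edge within `Valid`. -/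
structure IsMoves {V : Type*} (Valid : Set (SimpleGraph V)) (F : SimpleGraph V)
    (S : Finset (V × V)) : Prop where
  ne : ∀ x ∈ S, x.1 ≠ x.2
  not_adj : ∀ x ∈ S, ¬ F.Adj x.1 x.2
  addPair_mem : ∀ x ∈ S, addPair F x ∈ Valid

/-- A step towards `P` inside `Valid`: a pair of `S` can be added with probability at least `l`,
and a round is lost without a repeated edge with probability at most `b`. Adding a pair pays `b / l`
from the potential `Φ` of failure and `1 / l - 1` from the potential `Ψ` of repeated edges. -/
structure IsAdvance (Valid : Set (SimpleGraph (Fin n))) (Φ Ψ : SimpleGraph (Fin n) → ℝ)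
    (F : SimpleGraph (Fin n)) (S : Finset (Fin n × Fin n)) (l b : ℝ) : Prop
    extends IsMoves Valid F S where
  pos : 0 < l
  le_hits : l ≤ (treeLaw n).real (hits S)
  lost_le : (treeLaw n).real ((hits S)ᶜ ∩ {T | Disjoint T.1.edgeSet F.edgeSet}) ≤ b
  failure_le : ∀ x ∈ S, Φ (addPair F x) + b / l ≤ Φ F
  waiting_le : ∀ x ∈ S, Ψ (addPair F x) + (1 / l - 1) ≤ Ψ F

theorem IsAdvance.ncard_edgeSet_lt {Φ Ψ : SimpleGraph (Fin n) → ℝ} {S : Finset (Fin n × Fin n)}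
    {l b : ℝ} {N : ℕ} (h : IsAdvance Valid Φ Ψ F S l b)
    (hN : ∀ F ∈ Valid, F.edgeSet.ncard ≤ N) : F.edgeSet.ncard < N := by
  obtain ⟨x, hx⟩ : S.Nonempty := by
    by_contra hS
    have := h.pos.trans_le h.le_hits
    simp [hits, Finset.not_nonempty_iff_eq_empty.1 hS] at this
  have := hN _ (h.addPair_mem x hx)
  rwa [ncard_edgeSet_addPair (h.ne x hx) (h.not_adj x hx)] at this

theorem mul_missProb_le {Φ Ψ : SimpleGraph (Fin n) → ℝ}
    {S : SimpleGraph (Fin n) → Finset (Fin n × Fin n)} {l b : SimpleGraph (Fin n) → ℝ}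
    (hσ : Prefers σ S) {N : ℕ} (hΦ : ∀ F, 0 ≤ Φ F) (hΨ : ∀ F, 0 ≤ Ψ F)
    (hN : ∀ F ∈ Valid, F.edgeSet.ncard ≤ N)
    (hstep : ∀ F ∈ Valid \ P, IsAdvance Valid Φ Ψ F (S F) (l F) (b F)) {w : ℕ}
    (hF : F ∈ Valid) (hw : t + 1 = N - F.edgeSet.ncard + w) :
    w * missProb σ Valid P t F ≤ Ψ F + w * Φ F := by
  induction t using Nat.strong_induction_on generalizing F w with
  | _ t ih =>
  have h₀ : 0 ≤ Ψ F + w * Φ F := add_nonneg (hΨ F) (mul_nonneg w.cast_nonneg (hΦ F))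
  by_cases hP : F ∈ P
  · simpa [missProb_eq_zero ⟨hF, hP⟩] using h₀
  rcases w.eq_zero_or_pos with rfl | hw₀
  · simpa using h₀
  have hadv := hstep F ⟨hF, hP⟩
  have hlt := hadv.ncard_edgeSet_lt hN
  obtain ⟨t, rfl⟩ : ∃ s, t = s + 1 := Nat.exists_eq_add_one.2 (by lia)
  rw [missProb_succ ⟨hF, hP⟩, ← integral_const_mul, ← add_sub_cancel_right (_ + _) (1 : ℝ)]
  refine integral_le_sub_one (Nat.cast_nonneg w) hadv.pos hadv.le_hits hadv.lost_le
    (fun T hT => ?_) (fun T _ => ?_) fun T hT => ?_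
  · obtain ⟨x, hx, hnext⟩ := (hσ F).1 T hT
    have hcard := ncard_edgeSet_addPair (hadv.ne x hx) (hadv.not_adj x hx)
    calc w * missProb σ Valid P t (nextGraph σ F T)
        ≤ Ψ (addPair F x) + w * Φ (addPair F x) :=
          by rw [hnext]; exact ih t t.lt_succ_self (hadv.addPair_mem x hx) (by lia)
      _ ≤ Ψ F - (1 / l F - 1) + w * (Φ F - b F / l F) := by
          gcongr
          exacts [le_sub_iff_add_le.2 (hadv.waiting_le x hx),
            le_sub_iff_add_le.2 (hadv.failure_le x hx)]
      _ = Ψ F + w * Φ F + 1 - (1 + w * b F) / l F := by ring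
  · have := mul_le_of_le_one_right (Nat.cast_nonneg (α := ℝ) w)
      (missProb_le_one (σ := σ) (Valid := Valid) (P := P) (t := t) (F := nextGraph σ F T))
    linarith
  · rw [(hσ F).2 T hT.1 hT.2]
    obtain ⟨w, rfl⟩ := Nat.exists_eq_add_one.2 hw₀
    have := ih t t.lt_succ_self (w := w) hF (by lia)
    have := missProb_le_one (σ := σ) (Valid := Valid) (P := P) (t := t) (F := F)
    have := hΦ F
    push_cast
    linarith

end MissProb

theorem exists_strategy_of_potential (hn : 2 ≤ n) {Valid P : Set (SimpleGraph (Fin n))}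
    {Φ Ψ : SimpleGraph (Fin n) → ℝ} {N W : ℕ} (hW : 0 < W)
    (hΦ : ∀ F, 0 ≤ Φ F) (hΨ : ∀ F, 0 ≤ Ψ F) (hbot : ⊥ ∈ Valid)
    (hN : ∀ F ∈ Valid, F.edgeSet.ncard ≤ N)
    (hstep : ∀ F ∈ Valid \ P, ∃ S l b, IsAdvance Valid Φ Ψ F S l b) :
    ∃ σ : Strategy n, 1 - (Φ ⊥ + Ψ ⊥ / W) ≤ (treesLaw n).real {T | ∃ t < N + W,
      hittingTime σ P T = (t : ℕ∞) ∧ graphAfter σ T t ∈ Valid ∩ P} := by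
  have : NeZero n := ⟨by lia⟩
  choose! S l b hadv using hstep
  obtain ⟨σ, hσ⟩ := exists_prefers hn S
  refine ⟨σ, ?_⟩
  have hmiss : W * missProb σ Valid P (N + W - 1) ⊥ ≤ Ψ ⊥ + W * Φ ⊥ :=
    mul_missProb_le hσ hΦ hΨ hN hadv hbot (by simp; lia)
  have hW' : (0 : ℝ) < W := by exact_mod_cast hW
  calc 1 - (Φ ⊥ + Ψ ⊥ / W) ≤ 1 - missProb σ Valid P (N + W - 1) ⊥ := by
        rw [← le_div_iff₀' hW', add_div, mul_div_cancel_left₀ _ hW'.ne'] at hmiss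
        linarith
    _ ≤ _ := one_sub_missProb_le σ Valid P _
    _ = _ := by simp only [Nat.le_sub_one_iff_lt (by lia : 0 < N + W)]

end Rounds

section Graphs

variable {V : Type*}

/-- The graph `G` has no edge from `S` to a vertex outside `X ∪ S`, and `S` avoids `X`: a nonempty
such `S` that misses a vertex outside `X` witnesses that `X` separates `G`. -/
def IsClosedOff (G : SimpleGraph V) (X : Finset V) (S : Set V) : Prop :=
  (∀ u ∈ S, u ∉ X) ∧ ∀ u ∈ S, ∀ v, G.Adj u v → v ∉ X → v ∈ S

theorem IsClosedOff.compl {G : SimpleGraph V} {X : Finset V} {S : Set V}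
    (h : IsClosedOff G X S) : IsClosedOff G X {v | v ∉ X ∧ v ∉ S} :=
  ⟨fun _ hu => hu.1, fun u hu v hadj hv => ⟨hv, fun hvS => hu.2 (h.2 v hvS u hadj.symm hu.1)⟩⟩

variable [Fintype V] {F G : SimpleGraph V} {k : ℕ}

theorem isKConnected_of_forall_isClosedOff (hk : k < Fintype.card V)
    (h : ∀ X : Finset V, X.card < k → ∀ S, IsClosedOff G X S → S.Nonempty →
      ∀ v ∉ X, v ∈ S) : IsKConnected k G := by
  refine ⟨hk, fun X hX => ?_⟩
  obtain ⟨v₀, hv₀⟩ : ∃ v, v ∉ X := by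
    by_contra! hall
    exact (hX.trans hk).ne (Finset.card_eq_iff_eq_univ X |>.2 (Finset.eq_univ_of_forall hall))
  refine { preconnected := fun u v => ?_, nonempty := ⟨v₀, hv₀⟩ }
  obtain ⟨_, hreach⟩ := h X hX {w | ∃ hw, (G.induce {v | v ∉ X}).Reachable u ⟨w, hw⟩}
    ⟨fun w hw => hw.1, fun w ⟨hw, hr⟩ x hadj hx => ⟨hx, hr.trans (SimpleGraph.Adj.reachable hadj)⟩⟩
    ⟨u, u.2, SimpleGraph.Reachable.rfl⟩ v v.2
  exact hreach

open Classical in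
/-- The ordered pairs of adjacent vertices. -/
noncomputable def adjPairs (F : SimpleGraph V) : Finset (V × V) := {x | F.Adj x.1 x.2}

open Classical in
/-- The neighbours of a vertex, as a finset that needs no decidability of the adjacency. -/
noncomputable def nbrs (F : SimpleGraph V) (v : V) : Finset V := {w | F.Adj v w}

theorem mem_nbrs {v w : V} : w ∈ nbrs F v ↔ F.Adj v w := by
  simp [nbrs]

theorem mem_adjPairs {x : V × V} : x ∈ adjPairs F ↔ F.Adj x.1 x.2 := by
  simp [adjPairs]

theorem card_nbrs_eq_degree (F : SimpleGraph V) (v : V) [Fintype (F.neighborSet v)] :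
    (nbrs F v).card = F.degree v := by
  rw [← SimpleGraph.card_neighborFinset_eq_degree]
  congr 1
  ext w
  simp [mem_nbrs]

theorem sum_card_nbrs (F : SimpleGraph V) : ∑ v, (nbrs F v).card = 2 * F.edgeSet.ncard := by
  classical
  simp only [card_nbrs_eq_degree]
  rw [F.sum_degrees_eq_twice_card_edges, ← Set.ncard_coe_finset, SimpleGraph.coe_edgeFinset]

theorem card_adjPairs (F : SimpleGraph V) : (adjPairs F).card = 2 * F.edgeSet.ncard := by
  classical
  rw [← SimpleGraph.coe_edgeFinset, Set.ncard_coe_finset, ← card_filter_adj]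
  congr!

theorem IsKConnected.le_card_nbrs (h : IsKConnected k G) (v : V) : k ≤ (nbrs G v).card := by
  classical
  by_contra! hlt
  have hv : v ∉ nbrs G v := by simp [mem_nbrs]
  obtain ⟨w, hw⟩ : ∃ w, w ∉ insert v (nbrs G v) := by
    by_contra! hall
    have hcard := h.1
    rw [← Finset.card_univ, ← Finset.eq_univ_of_forall hall,
      Finset.card_insert_of_notMem hv] at hcard
    lia
  rw [Finset.mem_insert, not_or] at hw
  have : Nontrivial {x : V | x ∉ nbrs G v} :=
    ⟨⟨v, hv⟩, ⟨w, hw.2⟩, fun h => hw.1 (congrArg Subtype.val h).symm⟩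
  obtain ⟨⟨x, hx⟩, hadj⟩ := (h.2 (nbrs G v) hlt).preconnected.exists_adj_of_nontrivial ⟨v, hv⟩
  exact hx (mem_nbrs.2 hadj)

theorem IsKConnected.degreesKOrSucc (h : IsKConnected k G) (hd : ∀ v, (nbrs G v).card ≤ k + 1) :
    DegreesKOrSucc k G := by
  intro v
  rw [← card_nbrs_eq_degree]
  have := h.le_card_nbrs v
  have := hd v
  lia

theorem IsKConnected.mul_le_two_mul_ncard_edgeSet (h : IsKConnected k G) :
    Fintype.card V * k ≤ 2 * G.edgeSet.ncard := by
  rw [← sum_card_nbrs, ← Finset.card_univ, ← smul_eq_mul]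
  exact Finset.card_nsmul_le_sum _ _ _ fun v _ => h.le_card_nbrs v

end Graphs

section Circulant

variable {n r : ℕ}

/-- The vertex `j` places after `a` in cyclic order. -/
def cyc (a : Fin n) (j : ℕ) : Fin n := ⟨(a.val + j) % n, Nat.mod_lt _ a.pos⟩

/-- The graph joining vertices at cyclic distance at most `r`. -/
def cyclePower (n r : ℕ) : SimpleGraph (Fin n) :=
  SimpleGraph.fromRel fun u v => ∃ j, 1 ≤ j ∧ j ≤ r ∧ v = cyc u j

theorem cyc_zero (a : Fin n) : cyc a 0 = a := by
  simp [cyc, Nat.mod_eq_of_lt a.2]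

theorem cyc_cyc (a : Fin n) (i j : ℕ) : cyc (cyc a i) j = cyc a (i + j) := by
  simp [cyc, add_assoc]

theorem cyc_self (a : Fin n) : cyc a n = a := by
  simp [cyc, Nat.mod_eq_of_lt a.2]

theorem injOn_cyc (a : Fin n) : Set.InjOn (cyc a) (Set.Iio n) := fun i hi j hj h =>
  (Nat.ModEq.add_left_cancel' a.val (congrArg Fin.val h : (a.val + i) % n = (a.val + j) % n)
    ).eq_of_lt_of_lt hi hj

theorem exists_cyc_eq (a b : Fin n) : ∃ j < n, cyc a j = b := by
  have hinj : Function.Injective fun j : Fin n => cyc a j :=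
    fun i j h => Fin.ext (injOn_cyc a i.2 j.2 h)
  obtain ⟨j, hj⟩ := Finite.injective_iff_surjective.1 hinj b
  exact ⟨j, j.2, hj⟩

theorem cyclePower_adj_cyc (a : Fin n) {i j : ℕ} (hij : i < j) (hjr : j ≤ i + r)
    (hne : cyc a i ≠ cyc a j) : (cyclePower n r).Adj (cyc a i) (cyc a j) := by
  rw [cyclePower, SimpleGraph.fromRel_adj]
  exact ⟨hne, Or.inl ⟨j - i, by lia, by lia, by rw [cyc_cyc, Nat.add_sub_cancel' hij.le]⟩⟩

theorem le_card_filter_Ioo_cyc_mem {X : Finset (Fin n)} {S : Set (Fin n)}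
    (hS : IsClosedOff (cyclePower n r) X S) {a : Fin n} {i j : ℕ} (hij : i < j)
    (hi : cyc a i ∈ S) (hjX : cyc a j ∉ X) (hjS : cyc a j ∉ S) :
    r ≤ Finset.card {l ∈ Finset.Ioo i j | cyc a l ∈ X} := by
  classical
  obtain ⟨l, hl, hlast⟩ := Finset.exists_max_image {l ∈ Finset.Ico i j | cyc a l ∈ S} id
    ⟨i, Finset.mem_filter.2 ⟨Finset.left_mem_Ico.2 hij, hi⟩⟩
  obtain ⟨hl, hlS⟩ := Finset.mem_filter.1 hl
  obtain ⟨hil, hlj⟩ := Finset.mem_Ico.1 hl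
  have hnear m (hlm : l < m) (hmr : m ≤ l + r) (hmS : cyc a m ∉ S) : cyc a m ∈ X := by
    by_contra hmX
    exact hmS (hS.2 _ hlS _ (cyclePower_adj_cyc a hlm hmr fun h => hmS (h ▸ hlS)) hmX)
  have hlr : l + r < j := by
    by_contra! hge
    exact hjX (hnear j hlj hge hjS)
  calc r = (Finset.Ioc l (l + r)).card := by simp
    _ ≤ _ := Finset.card_le_card fun m hm => by
      obtain ⟨hlm, hmr⟩ := Finset.mem_Ioc.1 hm
      refine Finset.mem_filter.2 ⟨Finset.mem_Ioo.2 (by lia), hnear m hlm hmr fun hmS => ?_⟩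
      have := hlast m (Finset.mem_filter.2 ⟨Finset.mem_Ico.2 (by lia), hmS⟩)
      simp only [id] at this
      lia

theorem isKConnected_cyclePower {k : ℕ} (hk : k ≤ 2 * r) (hkn : k < n) :
    IsKConnected k (cyclePower n r) := by
  refine isKConnected_of_forall_isClosedOff (by simpa using hkn) fun X hX S hS ⟨a, ha⟩ b hb => ?_
  by_contra hbS
  obtain ⟨L, hLn, rfl⟩ := exists_cyc_eq a b
  have hL₀ : 0 < L := Nat.pos_of_ne_zero fun h => hbS (by rwa [h, cyc_zero])
  have hfst : r ≤ Finset.card {l ∈ Finset.Ioo 0 L | cyc a l ∈ X} :=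
    le_card_filter_Ioo_cyc_mem hS hL₀ (by rwa [cyc_zero]) hb hbS
  have hsnd : r ≤ Finset.card {l ∈ Finset.Ioo L n | cyc a l ∈ X} :=
    le_card_filter_Ioo_cyc_mem hS.compl hLn ⟨hb, hbS⟩ (by rw [cyc_self]; exact hS.1 a ha)
      (by rw [cyc_self]; exact fun h => h.2 ha)
  have hdisj : Disjoint {l ∈ Finset.Ioo 0 L | cyc a l ∈ X} {l ∈ Finset.Ioo L n | cyc a l ∈ X} :=
    Finset.disjoint_filter_filter (Finset.disjoint_left.2 fun l hl hl' => by
      simp only [Finset.mem_Ioo] at hl hl'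
      lia)
  have hcard : ({l ∈ Finset.Ioo 0 L | cyc a l ∈ X} ∪
      {l ∈ Finset.Ioo L n | cyc a l ∈ X} : Finset ℕ).card ≤ X.card := by
    rw [← Finset.filter_union]
    refine Finset.card_le_card_of_injOn (cyc a) (fun l hl => (Finset.mem_filter.1 hl).2)
      ((injOn_cyc a).mono fun l hl => ?_)
    simp only [Finset.coe_filter, Finset.mem_union, Finset.mem_Ioo, Set.mem_ofPred_eq] at hl
    exact Set.mem_Iio.2 (by lia)
  rw [Finset.card_union_of_disjoint hdisj] at hcard
  lia

theorem card_nbrs_cyclePower_le (hrn : r ≤ n) (v : Fin n) :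
    (nbrs (cyclePower n r) v).card ≤ 2 * r := by
  have hsub : nbrs (cyclePower n r) v ⊆
      (Finset.Icc 1 r).image (cyc v) ∪ (Finset.Icc 1 r).image fun j => cyc v (n - j) := by
    intro w hw
    rw [mem_nbrs, cyclePower, SimpleGraph.fromRel_adj] at hw
    rw [Finset.mem_union, Finset.mem_image, Finset.mem_image]
    rcases hw.2 with ⟨j, h1, hr, rfl⟩ | ⟨j, h1, hr, rfl⟩
    · exact Or.inl ⟨j, Finset.mem_Icc.2 ⟨h1, hr⟩, rfl⟩
    · exact Or.inr ⟨j, Finset.mem_Icc.2 ⟨h1, hr⟩, by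
        rw [cyc_cyc, Nat.add_sub_cancel' (hr.trans hrn), cyc_self]⟩
  calc (nbrs (cyclePower n r) v).card ≤ _ := Finset.card_le_card hsub
    _ ≤ (Finset.Icc 1 r).card + (Finset.Icc 1 r).card :=
      (Finset.card_union_le _ _).trans (add_le_add Finset.card_image_le Finset.card_image_le)
    _ = 2 * r := by rw [Nat.card_Icc]; lia

theorem ncard_edgeSet_cyclePower_le (hrn : r ≤ n) : (cyclePower n r).edgeSet.ncard ≤ n * r := by
  refine Nat.le_of_mul_le_mul_left ?_ zero_lt_two
  calc 2 * (cyclePower n r).edgeSet.ncard = ∑ v, (nbrs (cyclePower n r) v).card :=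
        (sum_card_nbrs _).symm
    _ ≤ ∑ _v : Fin n, 2 * r := Finset.sum_le_sum fun v _ => card_nbrs_cyclePower_le hrn v
    _ = 2 * (n * r) := by simp [Nat.mul_left_comm]

end Circulant

section Advances

variable {n k L : ℕ} {η : ℝ} {F : SimpleGraph (Fin n)} {S : Finset (Fin n × Fin n)}
  {Valid : Set (SimpleGraph (Fin n))} {Φ Ψ : SimpleGraph (Fin n) → ℝ}

theorem treeLaw_real_compl_hits_le_of_le_card [NeZero n] (hS : S ⊆ Finset.univ.offDiag)
    (hSL : L ≤ S.card) (hη : n * Real.exp (-(L / n)) ≤ η) :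
    (treeLaw n).real (hits S)ᶜ ≤ η :=
  calc (treeLaw n).real (hits S)ᶜ ≤ n * Real.exp (-(S.card / n)) := treeLaw_real_compl_hits_le hS
    _ ≤ n * Real.exp (-(L / n)) := by gcongr
    _ ≤ η := hη

theorem adjPairs_subset_offDiag (F : SimpleGraph (Fin n)) : adjPairs F ⊆ Finset.univ.offDiag :=
  fun x hx => by simpa using (mem_adjPairs.1 hx).ne

theorem lost_le_of_le_card_adjPairs [NeZero n] (S : Finset (Fin n × Fin n))
    (hF : L ≤ (adjPairs F).card) (hη : n * Real.exp (-(L / n)) ≤ η) :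
    (treeLaw n).real ((hits S)ᶜ ∩ {T | Disjoint T.1.edgeSet F.edgeSet}) ≤ η := by
  refine (measureReal_mono ?_ (measure_ne_top _ _)).trans
    (treeLaw_real_compl_hits_le_of_le_card (adjPairs_subset_offDiag F) hF hη)
  rintro T ⟨-, hT⟩ ⟨x, hx, hadj⟩
  have hedge : s(x.1, x.2) ∈ T.1.edgeSet := hadj
  exact Set.disjoint_left.1 hT hedge (mem_adjPairs.1 hx)

theorem IsMoves.subset_offDiag (h : IsMoves Valid F S) : S ⊆ Finset.univ.offDiag :=
  fun x hx => by simpa using h.ne x hx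

theorem IsMoves.isAdvance_of_le_card [NeZero n] (h : IsMoves Valid F S) (hSL : L ≤ S.card)
    (hη : n * Real.exp (-(L / n)) ≤ η) (hη₂ : η ≤ 1 / 2)
    (hΦ : ∀ x ∈ S, Φ (addPair F x) + 2 * η ≤ Φ F) (hΨ : ∀ x ∈ S, Ψ (addPair F x) + 2 * η ≤ Ψ F) :
    IsAdvance Valid Φ Ψ F S (1 - η) η := by
  have hmiss := treeLaw_real_compl_hits_le_of_le_card h.subset_offDiag hSL hη
  have hη₀ : 0 ≤ η := measureReal_nonneg.trans hmiss
  have hpos : 0 < 1 - η := by linarith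
  have hratio : η / (1 - η) ≤ 2 * η := by
    rw [div_le_iff₀ hpos]
    nlinarith
  have hwait : 1 / (1 - η) - 1 = η / (1 - η) := by
    field_simp
    ring
  refine { h with
    pos := hpos
    le_hits := ?_
    lost_le := (measureReal_mono Set.inter_subset_left (measure_ne_top _ _)).trans hmiss
    failure_le := fun x hx => (add_le_add_right hratio _).trans (hΦ x hx)
    waiting_le := fun x hx => hwait ▸ (add_le_add_right hratio _).trans (hΨ x hx) }
  rw [probReal_compl_eq_one_sub .of_discrete] at hmiss
  linarith

theorem IsMoves.isAdvance_of_card_le (hn : 2 ≤ n) (h : IsMoves Valid F S) (hS₀ : S.Nonempty)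
    (hSL : S.card ≤ L) (hL : 2 * L ≤ n * (n - 1)) (hF : L ≤ (adjPairs F).card)
    (hη : n * Real.exp (-(L / n)) ≤ η) (hη₂ : η ≤ 1 / 2)
    (hΦ : ∀ x ∈ S, Φ (addPair F x) + 6 * L * η / S.card ≤ Φ F)
    (hΨ : ∀ x ∈ S, Ψ (addPair F x) + 6 * L / S.card ≤ Ψ F) :
    IsAdvance Valid Φ Ψ F S (S.card / (6 * L)) η := by
  have : NeZero n := ⟨by lia⟩
  have hS : (0 : ℝ) < S.card := by exact_mod_cast hS₀.card_pos
  have hL₀ : (0 : ℝ) < L := hS.trans_le (by exact_mod_cast hSL)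
  exact { h with
    pos := by positivity
    le_hits := le_treeLaw_real_hits hn h.subset_offDiag hS₀ hSL hL (hη.trans hη₂)
    lost_le := lost_le_of_le_card_adjPairs S hF hη
    failure_le := fun x hx => by
      rw [div_div_eq_mul_div, mul_comm η]
      exact hΦ x hx
    waiting_le := fun x hx => by
      rw [one_div_div]
      linarith [hΨ x hx] }

end Advances

section FixedTarget

variable {n k L : ℕ} {η : ℝ} {F H : SimpleGraph (Fin n)}

theorem isMoves_adjPairs_sdiff (hFH : F ≤ H) :
    IsMoves {F | F ≤ H} F (adjPairs H \ adjPairs F) where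
  ne x hx := (mem_adjPairs.1 (Finset.mem_sdiff.1 hx).1).ne
  not_adj x hx h := (Finset.mem_sdiff.1 hx).2 (mem_adjPairs.2 h)
  addPair_mem x hx := by
    have hadj := mem_adjPairs.1 (Finset.mem_sdiff.1 hx).1
    intro a b hab
    rcases (addPair_adj hadj.ne).1 hab with h | ⟨rfl, rfl⟩ | ⟨rfl, rfl⟩
    exacts [hFH h, hadj, hadj.symm]

theorem card_adjPairs_sdiff (hFH : F ≤ H) :
    (adjPairs H \ adjPairs F).card = 2 * (H.edgeSet.ncard - F.edgeSet.ncard) := by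
  rw [Finset.card_sdiff_of_subset fun x hx => mem_adjPairs.2 (hFH (mem_adjPairs.1 hx)),
    card_adjPairs, card_adjPairs, Nat.mul_sub]

theorem ncard_edgeSet_lt (h : F < H) : F.edgeSet.ncard < H.edgeSet.ncard :=
  Set.ncard_lt_ncard (SimpleGraph.edgeSet_ssubset_edgeSet.2 h) (Set.toFinite _)

/-- Bounds the expected number of lost rounds while the last `u` edges of a fixed graph are
collected, as in the coupon collector's problem. -/
noncomputable def collectTime (η : ℝ) (L u : ℕ) : ℝ :=
  ∑ j ∈ Finset.range u, (2 * η + 3 * L / (j + 1))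

theorem collectTime_succ (η : ℝ) (L u : ℕ) :
    collectTime η L (u + 1) = collectTime η L u + (2 * η + 3 * L / (u + 1)) :=
  Finset.sum_range_succ _ _

theorem collectTime_le (η : ℝ) (L u : ℕ) :
    collectTime η L u ≤ 2 * η * u + 3 * L * (1 + Real.log u) := by
  have hsum : collectTime η L u = 2 * η * u + 3 * L * (harmonic u : ℝ) := by
    simp only [collectTime, harmonic, Finset.sum_add_distrib, div_eq_mul_inv, ← Finset.mul_sum]
    simp
    ring
  rw [hsum]
  gcongr
  exact harmonic_le_one_add_log u

theorem isAdvance_adjPairs_sdiff (hn : 2 ≤ n) (hL : 2 * L ≤ n * (n - 1)) (hL₀ : 0 < L)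
    (hLH : L ≤ H.edgeSet.ncard) (hη : n * Real.exp (-(L / n)) ≤ η) (hη₂ : η ≤ 1 / 2) (hFH : F < H) :
    ∃ l b, IsAdvance {F | F ≤ H} (fun F => 6 * L * η * (H.edgeSet.ncard - F.edgeSet.ncard : ℕ))
      (fun F => collectTime η L (H.edgeSet.ncard - F.edgeSet.ncard)) F
      (adjPairs H \ adjPairs F) l b := by
  have : NeZero n := ⟨by lia⟩
  have hmoves := isMoves_adjPairs_sdiff hFH.le
  have hcard := card_adjPairs_sdiff hFH.le
  obtain ⟨u, hu⟩ := Nat.exists_eq_add_of_lt (ncard_edgeSet_lt hFH)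
  have hu₁ : H.edgeSet.ncard - F.edgeSet.ncard = u + 1 := by lia
  have hnext : ∀ x ∈ adjPairs H \ adjPairs F,
      H.edgeSet.ncard - (addPair F x).edgeSet.ncard = u := fun x hx => by
    rw [ncard_edgeSet_addPair (hmoves.ne x hx) (hmoves.not_adj x hx)]
    lia
  have hη₀ : 0 ≤ η := le_trans (by positivity) hη
  have hL₁ : (1 : ℝ) ≤ L := by exact_mod_cast hL₀
  have hLη : η ≤ L * η := le_mul_of_one_le_left hη₀ hL₁
  rw [hu₁] at hcard
  by_cases hbig : L ≤ (adjPairs H \ adjPairs F).card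
  · refine ⟨_, _, hmoves.isAdvance_of_le_card hbig hη hη₂ (fun x hx => ?_) fun x hx => ?_⟩ <;>
      simp only [hnext x hx, hu₁, collectTime_succ]
    · push_cast
      linarith
    · have : (0 : ℝ) ≤ 3 * L / (u + 1) := by positivity
      linarith
  · refine ⟨_, _, hmoves.isAdvance_of_card_le hn (Finset.card_pos.1 (by lia)) (not_le.1 hbig).le hL
      (by rw [card_adjPairs]; lia) hη hη₂ (fun x hx => ?_) fun x hx => ?_⟩ <;>
      simp only [hnext x hx, hu₁, collectTime_succ, hcard] <;> push_cast
    · have : 6 * L * η / (2 * (u + 1)) ≤ 6 * L * η :=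
        div_le_self (by positivity) (by linarith [u.cast_nonneg (α := ℝ)])
      linarith
    · have : 6 * (L : ℝ) / (2 * (u + 1)) = 3 * L / (u + 1) := by
        field_simp
        norm_num
      linarith

theorem exists_strategy_fixed_target (hn : 2 ≤ n) {W : ℕ} (hH : IsKConnected k H) (hL₀ : 0 < L)
    (hL : 2 * L ≤ n * (n - 1)) (hLk : 2 * L ≤ n * k) (hη : n * Real.exp (-(L / n)) ≤ η)
    (hη₂ : η ≤ 1 / 2) (hW : 0 < W) :
    ∃ σ : Strategy n, 1 - (6 * L * η * H.edgeSet.ncard +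
        (2 * η * H.edgeSet.ncard + 3 * L * (1 + Real.log H.edgeSet.ncard)) / W) ≤
      (treesLaw n).real {T | ∃ t < H.edgeSet.ncard + W,
        hittingTime σ (kConnectedGraphs n k) T = (t : ℕ∞) ∧
        graphAfter σ T t ∈ {F | F ≤ H} ∩ kConnectedGraphs n k} := by
  have hη₀ : 0 ≤ η := le_trans (by positivity) hη
  have hedges := hH.mul_le_two_mul_ncard_edgeSet
  rw [Fintype.card_fin] at hedges
  obtain ⟨σ, hσ⟩ := exists_strategy_of_potential hn (Valid := {F | F ≤ H})
    (P := kConnectedGraphs n k) (N := H.edgeSet.ncard)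
    (Φ := fun F => 6 * L * η * (H.edgeSet.ncard - F.edgeSet.ncard : ℕ))
    (Ψ := fun F => collectTime η L (H.edgeSet.ncard - F.edgeSet.ncard)) hW
    (fun F => by positivity) (fun F => Finset.sum_nonneg fun j _ => by positivity) (bot_le (a := H))
    (fun F hF => Set.ncard_le_ncard (SimpleGraph.edgeSet_subset_edgeSet.2 hF) (Set.toFinite _))
    fun F hF => ⟨_, isAdvance_adjPairs_sdiff hn hL hL₀ (by lia) hη hη₂
      (hF.1.lt_of_ne fun h => hF.2 (h ▸ hH))⟩
  refine ⟨σ, le_trans ?_ hσ⟩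
  simp only [SimpleGraph.edgeSet_bot, Set.ncard_empty, Nat.sub_zero]
  gcongr
  exact collectTime_le _ _ _

end FixedTarget

/-- A partition of the vertices into paths: each vertex has the label of its path and a position
on it. -/
structure PathCover (V : Type*) where
  label : V → V
  pos : V → ℕ
  inj : ∀ u v, label u = label v → pos u = pos v → u = v
  down : ∀ v j, pos v = j + 1 → ∃ u, label u = label v ∧ pos u = j

namespace PathCover

section Paths

variable {V : Type*} (C : PathCover V)

/-- The union of the paths. -/
def graph : SimpleGraph V where
  Adj u v := C.label u = C.label v ∧ (C.pos v = C.pos u + 1 ∨ C.pos u = C.pos v + 1)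
  symm := ⟨fun _ _ h => ⟨h.1.symm, h.2.symm⟩⟩
  loopless := ⟨fun u h => by have := h.2; lia⟩

theorem graph_adj {u v : V} : C.graph.Adj u v ↔
    C.label u = C.label v ∧ (C.pos v = C.pos u + 1 ∨ C.pos u = C.pos v + 1) := Iff.rfl

theorem exists_of_le (v : V) {j : ℕ} (hj : j ≤ C.pos v) :
    ∃ u, C.label u = C.label v ∧ C.pos u = j := by
  induction h : C.pos v - j generalizing j with
  | zero => exact ⟨v, rfl, by lia⟩
  | succ d ih =>
    obtain ⟨u, hu, hju⟩ := ih (j := j + 1) (by lia) (by lia)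
    obtain ⟨w, hw, hjw⟩ := C.down u j hju
    exact ⟨w, hw.trans hu, hjw⟩

theorem exists_bottom (v : V) : ∃ u, C.label u = C.label v ∧ C.pos u = 0 :=
  C.exists_of_le v (Nat.zero_le _)

/-- The last vertex of its path. -/
def IsTop (v : V) : Prop := ∀ w, C.label w = C.label v → C.pos w ≠ C.pos v + 1

variable {C}

theorem IsTop.le {v : V} (h : C.IsTop v) {w : V} (hw : C.label w = C.label v) :
    C.pos w ≤ C.pos v := by
  by_contra! hlt
  obtain ⟨u, hu, hp⟩ := C.exists_of_le w (j := C.pos v + 1) hlt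
  exact h u (hu.trans hw) hp

theorem IsTop.eq {v w : V} (hv : C.IsTop v) (hw : C.IsTop w) (h : C.label v = C.label w) :
    v = w :=
  C.inj v w h (le_antisymm (hw.le h) (hv.le h.symm))

theorem exists_top [Finite V] (v : V) : ∃ u, C.label u = C.label v ∧ C.IsTop u := by
  obtain ⟨u, hu, hmax⟩ := Set.exists_max_image {w | C.label w = C.label v} C.pos (Set.toFinite _)
    ⟨v, rfl⟩
  refine ⟨u, hu, fun w hw hp => ?_⟩
  have := hmax w (hw.trans hu)
  lia

variable {F : SimpleGraph V} {X : Finset V} {S : Set V}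

theorem mem_iff_of_forall_notMem_Icc (hle : C.graph ≤ F) (hS : IsClosedOff F X S) {u v : V}
    (huv : C.label u = C.label v) (hpos : C.pos u ≤ C.pos v)
    (hX : ∀ w ∈ X, C.label w = C.label v → C.pos w ∉ Set.Icc (C.pos u) (C.pos v)) :
    u ∈ S ↔ v ∈ S := by
  induction h : C.pos v - C.pos u generalizing v with
  | zero => rw [C.inj u v huv (by lia)]
  | succ d ih =>
    obtain ⟨w, hw, hwv⟩ := C.down v (C.pos v - 1) (by lia)
    have hadj : F.Adj w v := hle ⟨hw, Or.inl (by lia)⟩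
    have hwX : w ∉ X := fun hwX => hX w hwX hw ⟨by lia, by lia⟩
    have hvX : v ∉ X := fun hvX => hX v hvX rfl ⟨hpos, le_rfl⟩
    rw [ih (huv.trans hw.symm) (by lia) (fun x hx hxw hxI => hX x hx (hxw.trans hw)
      ⟨hxI.1, hxI.2.trans (by lia)⟩) (by lia)]
    exact ⟨fun h => hS.2 w h v hadj hvX, fun h => hS.2 v h w hadj.symm hwX⟩

theorem mem_iff_of_label_eq [DecidableEq V] (hle : C.graph ≤ F) (hS : IsClosedOff F X S) {u v : V}
    (huv : C.label u = C.label v) (hX : C.label u ∉ X.image C.label) : u ∈ S ↔ v ∈ S := by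
  have hnX : ∀ w ∈ X, C.label w ≠ C.label u := fun w hw he =>
    hX (he ▸ Finset.mem_image_of_mem _ hw)
  rcases le_total (C.pos u) (C.pos v) with h | h
  · exact mem_iff_of_forall_notMem_Icc hle hS huv h fun w hw he =>
      absurd (he.trans huv.symm) (hnX w hw)
  · exact (mem_iff_of_forall_notMem_Icc hle hS huv.symm h fun w hw he =>
      absurd he (hnX w hw)).symm

end Paths

section Fits

variable {V : Type*} [Fintype V] [DecidableEq V] (C : PathCover V)

/-- The vertices of the path with a given label. -/
def piece (a : V) : Finset V := {v | C.label v = a}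

/-- The next vertex of the path of `v`, if there is one. -/
def succs (v : V) : Finset V := {w | C.label w = C.label v ∧ C.pos w = C.pos v + 1}

/-- The previous vertex of the path of `v`, if there is one. -/
def preds (v : V) : Finset V := {w | C.label w = C.label v ∧ C.pos v = C.pos w + 1}

/-- The neighbours of `v` on other paths. -/
noncomputable def flex (F : SimpleGraph V) (v : V) : Finset V :=
  {w ∈ nbrs F v | C.label w ≠ C.label v}

/-- The paths adjacent to the path with label `p`. -/
noncomputable def adjLabels (F : SimpleGraph V) (p : V) : Finset V :=
  ((C.piece p).biUnion (C.flex F)).image C.label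

theorem mem_piece {a v : V} : v ∈ C.piece a ↔ C.label v = a := by
  simp [piece]

theorem mem_flex {F : SimpleGraph V} {v w : V} :
    w ∈ C.flex F v ↔ F.Adj v w ∧ C.label w ≠ C.label v := by
  simp [flex, mem_nbrs]

theorem mem_adjLabels {F : SimpleGraph V} {p a : V} :
    a ∈ C.adjLabels F p ↔ a ≠ p ∧ ∃ u w, C.label u = p ∧ C.label w = a ∧ F.Adj u w := by
  simp only [adjLabels, Finset.mem_image, Finset.mem_biUnion, mem_piece, mem_flex]
  constructor
  · rintro ⟨w, ⟨u, rfl, h1, h2⟩, rfl⟩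
    exact ⟨h2, u, w, rfl, rfl, h1⟩
  · rintro ⟨hne, u, w, rfl, rfl, h⟩
    exact ⟨w, ⟨u, rfl, h, hne⟩, rfl⟩

theorem card_succs_le_one (v : V) : (C.succs v).card ≤ 1 := by
  rw [Finset.card_le_one]
  intro a ha b hb
  simp only [succs, Finset.mem_filter, Finset.mem_univ, true_and] at ha hb
  exact C.inj a b (ha.1.trans hb.1.symm) (ha.2.trans hb.2.symm)

theorem card_preds_le_one (v : V) : (C.preds v).card ≤ 1 := by
  rw [Finset.card_le_one]
  intro a ha b hb
  simp only [preds, Finset.mem_filter, Finset.mem_univ, true_and] at ha hb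
  exact C.inj a b (ha.1.trans hb.1.symm) (by lia)

theorem card_piece_le {M : ℕ} (hM : ∀ v, C.pos v < M) (a : V) : (C.piece a).card ≤ M := by
  rw [← Finset.card_range M]
  refine Finset.card_le_card_of_injOn C.pos (fun v _ => by simpa using hM v) fun u hu v hv h => ?_
  rw [Finset.mem_coe, mem_piece] at hu hv
  exact C.inj u v (hu.trans hv.symm) h

theorem card_label_mem_le {M : ℕ} (hM : ∀ v, C.pos v < M) (A : Finset V) :
    Finset.card {v | C.label v ∈ A} ≤ A.card * M := by
  have : ({v | C.label v ∈ A} : Finset V) = A.biUnion C.piece := by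
    ext v
    simp [mem_piece]
  rw [this]
  exact Finset.card_biUnion_le_card_mul _ _ _ fun a _ => C.card_piece_le hM a

variable {C}

theorem IsTop.succs_eq_empty {v : V} (h : C.IsTop v) : C.succs v = ∅ :=
  Finset.filter_eq_empty_iff.2 fun w _ hw => h w hw.1 hw.2

theorem preds_eq_empty {v : V} (h : C.pos v = 0) : C.preds v = ∅ :=
  Finset.filter_eq_empty_iff.2 fun w _ hw => by lia

variable (C) in
/-- The graph `F` has no edge inside the vertex set of a path apart from the edges of the path. -/
def Induced (F : SimpleGraph V) : Prop :=
  ∀ u v, F.Adj u v → C.label u = C.label v → C.graph.Adj u v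

variable (C) in
/-- The graph `F` contains the paths, no other edge inside the vertex set of a path, and at most
one edge from each vertex to each other path; degrees and paths are bounded. -/
structure Fits (F : SimpleGraph V) (k M : ℕ) : Prop where
  le : C.graph ≤ F
  internal : C.Induced F
  distinct : ∀ u v w, F.Adj u v → F.Adj u w → C.label v = C.label w →
    C.label v ≠ C.label u → v = w
  small : ∀ v, C.pos v < M
  deg : ∀ v, (nbrs F v).card ≤ k + 1

variable {F : SimpleGraph V} {k M : ℕ}

theorem Induced.card_nbrs_le (h : C.Induced F) (v : V) :
    (nbrs F v).card ≤ (C.succs v).card + (C.preds v).card + (C.flex F v).card := by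
  refine (Finset.card_le_card (t := C.succs v ∪ C.preds v ∪ C.flex F v) fun w hw => ?_).trans
    ((Finset.card_union_le _ _).trans (Nat.add_le_add_right (Finset.card_union_le _ _) _))
  rw [mem_nbrs] at hw
  simp only [Finset.mem_union, succs, preds, Finset.mem_filter, Finset.mem_univ, true_and, mem_flex]
  by_cases hl : C.label w = C.label v
  · have := (h v w hw hl.symm).2
    tauto
  · exact Or.inr ⟨hw, hl⟩

theorem Induced.card_nbrs_le_two_add (h : C.Induced F) (v : V) :
    (nbrs F v).card ≤ 2 + (C.flex F v).card := by
  have h1 := h.card_nbrs_le v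
  have h2 := C.card_succs_le_one v
  have h3 := C.card_preds_le_one v
  lia

theorem Fits.card_image_flex (h : C.Fits F k M) (v : V) :
    ((C.flex F v).image C.label).card = (C.flex F v).card := by
  refine Finset.card_image_of_injOn fun a ha b hb hab => ?_
  rw [Finset.mem_coe, mem_flex] at ha hb
  exact h.distinct v a b ha.1 hb.1 hab ha.2

end Fits

section Robust

variable {V : Type*} [DecidableEq V] {C : PathCover V} {F : SimpleGraph V} {k M : ℕ}

/-- Deleting fewer than `k` vertices does not separate those paths with labels in `A` that it
leaves intact. -/
def Robust (C : PathCover V) (F : SimpleGraph V) (k : ℕ) (A : Finset V) : Prop :=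
  ∀ X : Finset V, X.card < k → ∀ S, IsClosedOff F X S → ∀ u v, C.label u ∈ A → C.label v ∈ A →
    C.label u ∉ X.image C.label → C.label v ∉ X.image C.label → u ∈ S → v ∈ S

theorem Robust.mono {F' : SimpleGraph V} {A : Finset V} (h : C.Robust F k A) (hF : F ≤ F') :
    C.Robust F' k A := fun X hX S hS =>
  h X hX S ⟨hS.1, fun u hu v hadj hv => hS.2 u hu v (hF hadj) hv⟩

variable [Fintype V]

theorem mem_iff_of_adjLabels (hle : C.graph ≤ F) {X : Finset V} {S : Set V}
    (hS : IsClosedOff F X S) {u v : V} (hadj : C.label v ∈ C.adjLabels F (C.label u))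
    (hu : C.label u ∉ X.image C.label) (hv : C.label v ∉ X.image C.label) : u ∈ S ↔ v ∈ S := by
  obtain ⟨-, x, y, hx, hy, hxy⟩ := C.mem_adjLabels.1 hadj
  have hxX : x ∉ X := fun h => hu (hx ▸ Finset.mem_image_of_mem _ h)
  have hyX : y ∉ X := fun h => hv (hy ▸ Finset.mem_image_of_mem _ h)
  rw [mem_iff_of_label_eq hle hS hx.symm hu, mem_iff_of_label_eq hle hS hy.symm hv]
  exact ⟨fun h => hS.2 x h y hxy hyX, fun h => hS.2 y h x hxy.symm hxX⟩

theorem robust_of_pairwise (hle : C.graph ≤ F) {A : Finset V}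
    (hA : ∀ a ∈ A, ∀ b ∈ A, a ≠ b → b ∈ C.adjLabels F a) : C.Robust F k A := by
  intro X _ S hS u v hu hv huX hvX huS
  by_cases huv : C.label u = C.label v
  · exact (mem_iff_of_label_eq hle hS huv huX).1 huS
  · exact (mem_iff_of_adjLabels hle hS (hA _ hu _ hv huv) huX hvX).1 huS

theorem Robust.insert (hle : C.graph ≤ F) {A : Finset V} (h : C.Robust F k A) {p : V}
    (hp : k ≤ (C.adjLabels F p ∩ A).card) : C.Robust F k (insert p A) := by
  intro X hX S hS u v hu hv huX hvX huS
  obtain ⟨a, ha, haX⟩ : ∃ a ∈ C.adjLabels F p ∩ A, a ∉ X.image C.label := by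
    by_contra! hall
    have := (Finset.card_le_card hall).trans Finset.card_image_le
    lia
  rw [Finset.mem_inter] at ha
  obtain ⟨-, -, w, -, rfl, -⟩ := C.mem_adjLabels.1 ha.1
  have hw : ∀ x, C.label x ∈ Insert.insert p A → C.label x ∉ X.image C.label →
      (x ∈ S ↔ w ∈ S) := by
    intro x hx hxX
    rcases Finset.mem_insert.1 hx with rfl | hx
    · exact mem_iff_of_adjLabels hle hS ha.1 hxX haX
    · exact ⟨h X hX S hS x w hx ha.2 hxX haX, h X hX S hS w x ha.2 hx haX hxX⟩
  exact (hw v hv hvX).2 ((hw u hu huX).1 huS)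

variable {X : Finset V} {S : Set V}

theorem Fits.card_flex_lt (h : C.Fits F k M) (hS : IsClosedOff F X S)
    (hhit : ∀ u ∈ S, C.label u ∈ X.image C.label) {u : V} (hu : u ∈ S) :
    (C.flex F u).card < (X.image C.label).card := by
  rw [← h.card_image_flex u, ← Nat.add_one_le_iff,
    ← Finset.card_insert_of_notMem (a := C.label u) (fun hmem => ?_)]
  · refine Finset.card_le_card fun a ha => ?_
    rcases Finset.mem_insert.1 ha with rfl | ha
    · exact hhit u hu
    · obtain ⟨w, hw, rfl⟩ := Finset.mem_image.1 ha
      by_cases hwX : w ∈ X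
      · exact Finset.mem_image_of_mem _ hwX
      · exact hhit w (hS.2 u hu w (C.mem_flex.1 hw).1 hwX)
  · obtain ⟨w, hw, hwl⟩ := Finset.mem_image.1 hmem
    exact (C.mem_flex.1 hw).2 hwl

/- Each vertex of `S` has fewer than `k - 1` neighbours off its path, up to equality in all
estimates. Hence it is an inner vertex of its path, and the path loses only one vertex, so one of
the two ends of the path lies in `S` as well. -/
theorem Fits.eq_empty_of_isClosedOff (h : C.Fits F k M) (hk : ∀ v, k ≤ (nbrs F v).card)
    (hX : X.card < k) (hS : IsClosedOff F X S) (hhit : ∀ u ∈ S, C.label u ∈ X.image C.label) :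
    S = ∅ := by
  by_contra! hne
  have htight : ∀ u ∈ S, C.succs u ≠ ∅ ∧ C.preds u ≠ ∅ ∧ X.card ≤ (X.image C.label).card := by
    intro u hu
    have hnbrs := h.internal.card_nbrs_le u
    have hdeg := hk u
    have hflex := h.card_flex_lt hS hhit hu
    have hsucc := C.card_succs_le_one u
    have hpred := C.card_preds_le_one u
    have himage : (X.image C.label).card ≤ X.card := Finset.card_image_le
    rw [← Finset.card_pos.trans Finset.nonempty_iff_ne_empty,
      ← Finset.card_pos.trans Finset.nonempty_iff_ne_empty]
    lia
  obtain ⟨u, hu⟩ := hne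
  have hinj : Set.InjOn C.label X :=
    Finset.card_image_iff.1 (le_antisymm Finset.card_image_le (htight u hu).2.2)
  obtain ⟨x, hxX, hxu⟩ := Finset.mem_image.1 (hhit u hu)
  have honly : ∀ w ∈ X, C.label w = C.label u → w = x := fun w hw hl =>
    hinj hw hxX (hl.trans hxu.symm)
  rcases lt_trichotomy (C.pos u) (C.pos x) with hlt | heq | hlt
  · obtain ⟨b, hb, hb0⟩ := C.exists_bottom u
    refine (htight b ?_).2.1 (preds_eq_empty hb0)
    exact (mem_iff_of_forall_notMem_Icc h.le hS hb (by lia) fun w hw hl hI => by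
      rw [honly w hw hl] at hI; exact hI.2.not_gt hlt).2 hu
  · exact hS.1 u hu (C.inj u x hxu.symm heq ▸ hxX)
  · obtain ⟨t, ht, htop⟩ := exists_top (C := C) u
    refine (htight t ?_).1 htop.succs_eq_empty
    exact (mem_iff_of_forall_notMem_Icc h.le hS ht.symm (htop.le ht.symm) fun w hw hl hI => by
      rw [honly w hw (hl.trans ht)] at hI; exact hI.1.not_gt hlt).1 hu

theorem Fits.isKConnected [Nonempty V] (h : C.Fits F k M) (hk : ∀ v, k ≤ (nbrs F v).card)
    {A : Finset V} (hA : ∀ v, C.label v ∈ A) (hrob : C.Robust F k A) : IsKConnected k F := by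
  obtain ⟨v₀⟩ := ‹Nonempty V›
  have hcard : k < Fintype.card V := (hk v₀).trans_lt <|
    Finset.card_lt_univ_of_notMem (x := v₀) fun hv => F.loopless.irrefl _ (mem_nbrs.1 hv)
  refine isKConnected_of_forall_isClosedOff hcard fun X hX S hS hne v hv => ?_
  by_contra hvS
  by_cases hintact : ∃ u ∈ S, C.label u ∉ X.image C.label
  · obtain ⟨u, hu, huX⟩ := hintact
    refine Set.not_nonempty_iff_eq_empty.2
      (h.eq_empty_of_isClosedOff hk hX hS.compl fun w hw => ?_) ⟨v, hv, hvS⟩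
    by_contra hwX
    exact hw.2 (hrob X hX S hS u w (hA u) (hA w) huX hwX hu)
  · push Not at hintact
    exact hne.ne_empty (h.eq_empty_of_isClosedOff hk hX hS hintact)

end Robust

end PathCover

section Degrees

variable {V : Type*} [Fintype V] {F : SimpleGraph V} {k : ℕ} {a b : V}

theorem le_addPair {V : Type*} (F : SimpleGraph V) (x : V × V) : F ≤ addPair F x := le_sup_left

theorem nbrs_mono {F F' : SimpleGraph V} (h : F ≤ F') (v : V) : nbrs F v ⊆ nbrs F' v :=
  fun _ hw => mem_nbrs.2 (h (mem_nbrs.1 hw))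

theorem card_nbrs_addPair [DecidableEq V] (hab : a ≠ b) (hF : ¬ F.Adj a b) (v : V) :
    (nbrs (addPair F (a, b)) v).card = (nbrs F v).card + if v = a ∨ v = b then 1 else 0 := by
  have hmem : ∀ w, w ∈ nbrs (addPair F (a, b)) v ↔
      w ∈ nbrs F v ∨ (v = a ∧ w = b) ∨ (v = b ∧ w = a) := fun w => by
    rw [mem_nbrs, mem_nbrs, addPair_adj (x := (a, b)) hab]
  split_ifs with hv
  · obtain ⟨u, hu, hw⟩ : ∃ u ∉ nbrs F v, nbrs (addPair F (a, b)) v = insert u (nbrs F v) := by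
      rcases hv with rfl | rfl
      · exact ⟨b, by rwa [mem_nbrs], by ext w; rw [hmem]; grind⟩
      · exact ⟨a, by rwa [mem_nbrs, F.adj_comm], by ext w; rw [hmem]; grind⟩
    rw [hw, Finset.card_insert_of_notMem hu]
  · rw [add_zero]
    congr 1
    ext w
    rw [hmem]
    tauto

/-- The total number of edge ends that are missing for all degrees to be at least `k`. -/
noncomputable def deficit (F : SimpleGraph V) (k : ℕ) : ℕ := ∑ v, (k - (nbrs F v).card)

/-- The number of vertices of degree more than `k`. -/
noncomputable def excess (F : SimpleGraph V) (k : ℕ) : ℕ := Finset.card {v | k < (nbrs F v).card}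

theorem excess_eq_sum (F : SimpleGraph V) (k : ℕ) :
    excess F k = ∑ v, if k < (nbrs F v).card then 1 else 0 := by
  rw [excess, Finset.card_filter]

theorem deficit_le_mul_card (F : SimpleGraph V) (k : ℕ) :
    deficit F k ≤ k * Finset.card {v | (nbrs F v).card < k} := by
  rw [mul_comm, ← smul_eq_mul, ← Finset.sum_const, Finset.sum_filter]
  exact Finset.sum_le_sum fun v _ => by split_ifs <;> lia

theorem deficit_anti {F F' : SimpleGraph V} (h : F ≤ F') (k : ℕ) : deficit F' k ≤ deficit F k :=
  Finset.sum_le_sum fun v _ => Nat.sub_le_sub_left (Finset.card_le_card (nbrs_mono h v)) k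

theorem deficit_addPair_lt (hab : a ≠ b) (hF : ¬ F.Adj a b) (ha : (nbrs F a).card < k) :
    deficit (addPair F (a, b)) k < deficit F k := by
  classical
  refine Finset.sum_lt_sum (fun v _ => Nat.sub_le_sub_left (Finset.card_le_card
    (nbrs_mono (le_addPair F _) v)) k) ⟨a, Finset.mem_univ a, ?_⟩
  rw [card_nbrs_addPair hab hF, if_pos (Or.inl rfl)]
  lia

theorem excess_add_deficit_addPair_le (hab : a ≠ b) (hF : ¬ F.Adj a b)
    (ha : (nbrs F a).card < k) (hb : (nbrs F b).card ≤ k) :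
    excess (addPair F (a, b)) k + deficit (addPair F (a, b)) k ≤ excess F k + deficit F k := by
  classical
  suffices h : ∑ v, (((if k < (nbrs (addPair F (a, b)) v).card then 1 else 0) +
      (k - (nbrs (addPair F (a, b)) v).card)) + if v = a then 1 else 0) ≤
      ∑ v, (((if k < (nbrs F v).card then 1 else 0) + (k - (nbrs F v).card)) +
        if v = b then 1 else 0) by
    simpa [Finset.sum_add_distrib, excess_eq_sum, deficit] using h
  refine Finset.sum_le_sum fun v _ => ?_
  rw [card_nbrs_addPair hab hF]
  grind

theorem excess_addPair_le (hab : a ≠ b) (hF : ¬ F.Adj a b) (ha : (nbrs F a).card < k)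
    (hb : (nbrs F b).card < k) : excess (addPair F (a, b)) k ≤ excess F k := by
  classical
  refine Finset.card_le_card (Finset.monotone_filter_right _ fun v _ hv => ?_)
  rw [card_nbrs_addPair hab hF] at hv
  grind

theorem two_mul_ncard_edgeSet_le (h : ∀ v, (nbrs F v).card ≤ k + 1) :
    2 * F.edgeSet.ncard ≤ Fintype.card V * k + excess F k := by
  rw [← sum_card_nbrs, excess_eq_sum, ← smul_eq_mul, ← Finset.card_univ, ← Finset.sum_const,
    ← Finset.sum_add_distrib]
  refine Finset.sum_le_sum fun v _ => ?_
  have := h v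
  split_ifs <;> lia

theorem le_two_mul_ncard_edgeSet (F : SimpleGraph V) (k : ℕ) :
    Fintype.card V * k ≤ 2 * F.edgeSet.ncard + deficit F k := by
  rw [← sum_card_nbrs, deficit, ← smul_eq_mul, ← Finset.card_univ, ← Finset.sum_const,
    ← Finset.sum_add_distrib]
  exact Finset.sum_le_sum fun v _ => by lia

end Degrees

theorem mul_le_card_of_forall_le_card {α β : Type*} {S : Finset (α × β)} {D : Finset α} {m : ℕ}
    (h : ∀ a ∈ D, ∃ E : Finset β, m ≤ E.card ∧ ∀ b ∈ E, (a, b) ∈ S) : D.card * m ≤ S.card := by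
  choose! E hE hES using h
  calc D.card * m ≤ ∑ a ∈ D, (E a).card := Finset.card_nsmul_le_sum _ _ _ hE
    _ = (D.sigma E).card := (Finset.card_sigma _ _).symm
    _ ≤ S.card := Finset.card_le_card_of_injOn (fun x => (x.1, x.2))
        (fun x hx => hES _ (Finset.mem_sigma.1 hx).1 _ (Finset.mem_sigma.1 hx).2)
        fun x _ y _ hxy => by simp_all [Sigma.ext_iff]

namespace PathCover

variable {V : Type*} [Fintype V] {C : PathCover V} {F : SimpleGraph V} {k M : ℕ} {A : Finset V}
  {a b : V}

section AddPair

theorem Fits.addPair (h : C.Fits F k M) (hab : C.label a ≠ C.label b)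
    (hl : ∀ w, F.Adj a w → C.label w ≠ C.label b) (hr : ∀ w, F.Adj b w → C.label w ≠ C.label a)
    (ha : (nbrs F a).card ≤ k) (hb : (nbrs F b).card ≤ k) :
    C.Fits (addPair F (a, b)) k M := by
  classical
  have hne : a ≠ b := ne_of_apply_ne C.label hab
  have hF : ¬ F.Adj a b := fun h => hl b h rfl
  have hadj : ∀ u v, (USTSR.addPair F (a, b)).Adj u v ↔
    F.Adj u v ∨ (u = a ∧ v = b) ∨ (u = b ∧ v = a) := fun u v => addPair_adj (x := (a, b)) hne
  refine ⟨h.le.trans (le_addPair _ _), fun u v huv hlab => ?_, fun u v w huv huw hvw hvu => ?_,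
    h.small, fun v => ?_⟩
  · have := h.internal u v
    grind
  · have := h.distinct u v w
    grind
  · rw [card_nbrs_addPair hne hF]
    have := h.deg v
    grind

variable [DecidableEq V]

theorem adjLabels_mono {F' : SimpleGraph V} (h : F ≤ F') (p : V) :
    C.adjLabels F p ⊆ C.adjLabels F' p := by
  intro a ha
  obtain ⟨hne, u, w, hu, hw, hadj⟩ := C.mem_adjLabels.1 ha
  exact C.mem_adjLabels.2 ⟨hne, u, w, hu, hw, h hadj⟩

theorem card_flex_addPair (hab : C.label a ≠ C.label b) (hF : ¬ F.Adj a b) (v : V) :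
    (C.flex (USTSR.addPair F (a, b)) v).card =
      (C.flex F v).card + if v = a ∨ v = b then 1 else 0 := by
  have hne : a ≠ b := ne_of_apply_ne C.label hab
  have hsplit : ∀ F : SimpleGraph V, (nbrs F v).card = (C.flex F v).card +
      Finset.card {w ∈ nbrs F v | ¬ C.label w ≠ C.label v} := fun F =>
    (Finset.card_filter_add_card_filter_not (s := nbrs F v) (C.label · ≠ C.label v)).symm
  have hsame : ({w ∈ nbrs (USTSR.addPair F (a, b)) v | ¬ C.label w ≠ C.label v} : Finset V) =
      ({w ∈ nbrs F v | ¬ C.label w ≠ C.label v} : Finset V) := by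
    ext w
    simp only [Finset.mem_filter, mem_nbrs, addPair_adj (x := (a, b)) hne]
    grind
  have hcard := card_nbrs_addPair hne hF v
  rw [hsplit, hsplit F, hsame] at hcard
  lia

variable (C F) in
/-- The number of pairs `(v, w)` such that `w` is a neighbour of `v` on another path. -/
noncomputable def flexSum : ℕ := ∑ v, (C.flex F v).card

theorem flexSum_addPair (hab : C.label a ≠ C.label b) (hF : ¬ F.Adj a b) :
    C.flexSum (USTSR.addPair F (a, b)) = C.flexSum F + 2 := by
  have hpair : ({v | v = a ∨ v = b} : Finset V) = {a, b} := by ext; simp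
  simp only [flexSum, card_flex_addPair hab hF, Finset.sum_add_distrib, ← Finset.card_filter, hpair,
    Finset.card_pair (ne_of_apply_ne C.label hab)]

theorem Fits.mul_excess_le (h : C.Fits F k M) : (k - 1) * excess F k ≤ C.flexSum F := by
  rw [excess_eq_sum, flexSum, Finset.mul_sum]
  refine Finset.sum_le_sum fun v _ => ?_
  have := h.internal.card_nbrs_le_two_add v
  split_ifs <;> lia

end AddPair

section Attachable

variable [DecidableEq V]

variable (C) in
/-- The labels in use. -/
def labels : Finset V := Finset.univ.image C.label

variable (C) in
/-- The number of vertices with labels in `A`. -/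
def mass (A : Finset V) : ℕ := Finset.card {v | C.label v ∈ A}

variable (C F A) in
/-- The number of paths with labels in `A` that are adjacent to the path with label `p`. -/
noncomputable def attachments (p : V) : ℕ := (C.adjLabels F p ∩ A).card

variable (C F k) in
/-- The number of edge ends that are missing on the path with label `p`. -/
noncomputable def freeEnds (p : V) : ℕ := ∑ u ∈ C.piece p, (k - (nbrs F u).card)

variable (C F k M A) in
/-- The path cover fits, the paths with labels in `A` are robustly connected, and every other
path has enough free edge ends to be attached to `k` of them. -/
structure Attachable : Prop where
  fits : C.Fits F k M
  robust : C.Robust F k A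
  supply : ∀ v, C.label v ∉ A → k ≤ C.attachments F A (C.label v) + C.freeEnds F k (C.label v)

variable (C F k A) in
/-- The number of edges needed to attach all paths. -/
noncomputable def need : ℕ := ∑ p ∈ C.labels \ A, (k - C.attachments F A p)

variable (C F k A) in
/-- No further path is attached to `k` of the paths with labels in `A`. -/
def IsMaximal : Prop := ∀ p ∈ C.labels \ A, C.attachments F A p < k

theorem label_mem_labels_sdiff {v : V} : C.label v ∈ C.labels \ A ↔ C.label v ∉ A := by
  simp [labels]

theorem mass_mono {A A' : Finset V} (h : A ⊆ A') : C.mass A ≤ C.mass A' :=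
  Finset.card_le_card (Finset.monotone_filter_right _ fun _ _ hv => h hv)

theorem attachments_mono {F F' : SimpleGraph V} {A A' : Finset V} (hF : F ≤ F') (hA : A ⊆ A')
    (p : V) : C.attachments F A p ≤ C.attachments F' A' p :=
  Finset.card_le_card (Finset.inter_subset_inter (adjLabels_mono hF p) hA)

theorem Attachable.attach (h : C.Attachable F k M A) {p : V} (hp : k ≤ C.attachments F A p) :
    C.Attachable F k M (insert p A) where
  fits := h.fits
  robust := h.robust.insert h.fits.le hp
  supply v hv := (h.supply v fun hvA => hv (Finset.mem_insert_of_mem hvA)).trans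
    (Nat.add_le_add_right (attachments_mono le_rfl (Finset.subset_insert p A) _) _)

theorem need_insert_le (F : SimpleGraph V) (k : ℕ) (A : Finset V) (p : V) :
    C.need F k (insert p A) ≤ C.need F k A :=
  (Finset.sum_le_sum fun r _ => Nat.sub_le_sub_left
    (attachments_mono le_rfl (Finset.subset_insert p A) r) k).trans
  (Finset.sum_le_sum_of_subset
    (Finset.sdiff_subset_sdiff subset_rfl (Finset.subset_insert p A)))

theorem Attachable.exists_isMaximal (h : C.Attachable F k M A) :
    ∃ A', A ⊆ A' ∧ C.Attachable F k M A' ∧ C.need F k A' ≤ C.need F k A ∧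
      C.IsMaximal F k A' := by
  induction hm : (C.labels \ A).card using Nat.strong_induction_on generalizing A with
  | _ m ih =>
  by_cases hmax : C.IsMaximal F k A
  · exact ⟨A, subset_rfl, h, le_rfl, hmax⟩
  simp only [IsMaximal, not_forall, not_lt] at hmax
  obtain ⟨p, hp, hpk⟩ := hmax
  have hlt : (C.labels \ insert p A).card < m := by
    rw [← hm, Finset.sdiff_insert]
    exact Finset.card_erase_lt_of_mem hp
  obtain ⟨A', hsub, hatt, hneed, hmax⟩ := ih _ hlt (h.attach hpk) rfl
  exact ⟨A', (Finset.subset_insert p A).trans hsub, hatt, hneed.trans (need_insert_le F k A p),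
    hmax⟩

theorem Attachable.card_labels_sdiff_le (h : C.Attachable F k M A) (hmax : C.IsMaximal F k A) :
    (C.labels \ A).card ≤ Finset.card {a | C.label a ∉ A ∧ (nbrs F a).card < k} := by
  refine (Finset.card_le_card fun p hp => ?_).trans (Finset.card_image_le (f := C.label))
  obtain ⟨v, -, rfl⟩ := Finset.mem_image.1 (Finset.mem_sdiff.1 hp).1
  have hv := label_mem_labels_sdiff.1 hp
  have hsupply := h.supply v hv
  have hlt := hmax _ hp
  obtain ⟨u, hu, hpos⟩ : ∃ u ∈ C.piece (C.label v), 0 < k - (nbrs F u).card := by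
    by_contra! hall
    rw [freeEnds, Finset.sum_eq_zero fun u hu => Nat.le_zero.1 (hall u hu)] at hsupply
    lia
  rw [mem_piece] at hu
  exact Finset.mem_image.2 ⟨u, by simp [hu, hv]; lia, hu⟩

theorem Attachable.isKConnected [Nonempty V] (h : C.Attachable F k M A)
    (hmax : C.IsMaximal F k A) (hk : ∀ v, k ≤ (nbrs F v).card) : IsKConnected k F := by
  refine h.fits.isKConnected hk (fun v => ?_) h.robust
  by_contra hv
  have hcard := h.card_labels_sdiff_le hmax
  rw [Finset.filter_false_of_mem fun a _ ha => (hk a).not_gt ha.2, Finset.card_empty,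
    Nat.le_zero, Finset.card_eq_zero] at hcard
  exact Finset.notMem_empty _ (hcard ▸ label_mem_labels_sdiff.2 hv)

theorem Fits.card_label_notMem_le (h : C.Fits F k M) (A : Finset V) :
    Finset.card {v | C.label v ∉ A} ≤ (C.labels \ A).card * M := by
  simpa only [label_mem_labels_sdiff] using C.card_label_mem_le h.small (C.labels \ A)

theorem Fits.card_le_mass_add (h : C.Fits F k M) (A : Finset V) :
    Fintype.card V ≤ C.mass A + (C.labels \ A).card * M := by
  rw [← Finset.card_univ,
    ← Finset.card_filter_add_card_filter_not (s := Finset.univ) (C.label · ∈ A)]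
  exact Nat.add_le_add_left (h.card_label_notMem_le A) _

theorem mass_le_card_add_excess (F : SimpleGraph V) (k : ℕ) (A : Finset V) :
    C.mass A ≤ Finset.card {b | C.label b ∈ A ∧ (nbrs F b).card ≤ k} + excess F k := by
  refine (Finset.card_le_card fun v hv => ?_).trans (Finset.card_union_le _ _)
  have := le_or_gt (nbrs F v).card k
  simp_all

end Attachable

section CanJoin

variable [DecidableEq V]

variable (C F k A) in
/-- The edge `ab` may be added, to raise the degree of `a` which is less than `k`. -/
structure CanJoin (a b : V) : Prop where
  label_ne : C.label a ≠ C.label b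
  left : ∀ w, F.Adj a w → C.label w ≠ C.label b
  right : ∀ w, F.Adj b w → C.label w ≠ C.label a
  deg_left : (nbrs F a).card < k
  deg_right : (nbrs F b).card ≤ k
  mem : C.label b ∈ A
  fresh : C.label a ∉ A → C.label b ∉ C.adjLabels F (C.label a)

theorem CanJoin.ne (h : C.CanJoin F k A a b) : a ≠ b := ne_of_apply_ne C.label h.label_ne

theorem CanJoin.not_adj (h : C.CanJoin F k A a b) : ¬ F.Adj a b := fun hab => h.left b hab rfl

theorem CanJoin.attachments_lt (h : C.CanJoin F k A a b) (ha : C.label a ∉ A) :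
    C.attachments F A (C.label a) < C.attachments (addPair F (a, b)) A (C.label a) := by
  refine Finset.card_lt_card (Finset.ssubset_iff_subset_ne.2
    ⟨Finset.inter_subset_inter (adjLabels_mono (le_addPair F _) _) subset_rfl, fun heq => ?_⟩)
  have hadj : (USTSR.addPair F (a, b)).Adj a b :=
    (addPair_adj (x := (a, b)) h.ne).2 (Or.inr (Or.inl ⟨rfl, rfl⟩))
  have hmem : C.label b ∈ C.adjLabels (USTSR.addPair F (a, b)) (C.label a) :=
    C.mem_adjLabels.2 ⟨h.label_ne.symm, a, b, rfl, rfl, hadj⟩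
  exact h.fresh ha (Finset.mem_inter.1 (heq ▸ Finset.mem_inter.2 ⟨hmem, h.mem⟩)).1

theorem CanJoin.freeEnds_le (h : C.CanJoin F k A a b) {p : V} (hp : p ≠ C.label b) :
    C.freeEnds F k p ≤ C.freeEnds (addPair F (a, b)) k p + if p = C.label a then 1 else 0 := by
  have hone : (if p = C.label a then 1 else 0) = ∑ u ∈ C.piece p, if u = a then 1 else 0 := by
    simp [mem_piece, eq_comm]
  rw [freeEnds, freeEnds, hone, ← Finset.sum_add_distrib]
  refine Finset.sum_le_sum fun u hu => ?_
  have hub : u ≠ b := fun hub => hp (by rw [← C.mem_piece.1 hu, hub])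
  rw [card_nbrs_addPair h.ne h.not_adj]
  grind

theorem Attachable.addPair (h : C.Attachable F k M A) (hj : C.CanJoin F k A a b) :
    C.Attachable (addPair F (a, b)) k M A := by
  refine ⟨h.fits.addPair hj.label_ne hj.left hj.right hj.deg_left.le hj.deg_right,
    h.robust.mono (le_addPair _ _), fun v hv => ?_⟩
  have hsupply := h.supply v hv
  have hfree := hj.freeEnds_le (p := C.label v) fun hvb => hv (hvb ▸ hj.mem)
  by_cases hva : C.label v = C.label a
  · have hlt := hj.attachments_lt (hva ▸ hv)
    rw [hva] at hsupply hfree ⊢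
    rw [if_pos rfl] at hfree
    lia
  · have hle := attachments_mono (C := C) (le_addPair F (a, b)) (subset_refl A) (C.label v)
    rw [if_neg hva] at hfree
    lia

theorem CanJoin.need_addPair_lt (hj : C.CanJoin F k A a b) (hmax : C.IsMaximal F k A)
    (ha : C.label a ∉ A) : C.need (addPair F (a, b)) k A < C.need F k A := by
  have hmem := label_mem_labels_sdiff.2 ha
  refine Finset.sum_lt_sum (fun p _ => Nat.sub_le_sub_left
    (attachments_mono (le_addPair F _) subset_rfl p) k) ⟨C.label a, hmem, ?_⟩
  have := hmax _ hmem
  have := hj.attachments_lt ha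
  lia

variable (C F A) in
/-- The vertices that `a` cannot be joined to because of the paths that they lie on. -/
noncomputable def blocked (a : V) : Finset V :=
  C.piece (C.label a) ∪ Finset.univ.filter (C.label · ∈ (C.flex F a).image C.label) ∪
    (C.piece (C.label a)).biUnion (C.flex F) ∪
    Finset.univ.filter (C.label · ∈ if C.label a ∈ A then ∅ else C.adjLabels F (C.label a) ∩ A)

theorem canJoin_of_notMem_blocked (ha : (nbrs F a).card < k) (hbA : C.label b ∈ A)
    (hb : (nbrs F b).card ≤ k) (h : b ∉ C.blocked F A a) : C.CanJoin F k A a b := by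
  simp only [blocked, Finset.mem_union, not_or, mem_piece, Finset.mem_filter, Finset.mem_univ,
    true_and, Finset.mem_image, Finset.mem_biUnion, mem_flex] at h
  obtain ⟨⟨⟨hpiece, hleft⟩, hright⟩, hfresh⟩ := h
  refine ⟨Ne.symm hpiece, fun w hw hl => hleft ⟨w, ⟨hw, hl.trans_ne hpiece⟩, hl⟩,
    fun w hw hl => hright ⟨w, hl, hw.symm, hl.symm ▸ hpiece⟩, ha, hb, hbA,
    fun haA hmem => hfresh ?_⟩
  rw [if_neg haA]
  exact Finset.mem_inter.2 ⟨hmem, hbA⟩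

theorem Fits.card_blocked_le (h : C.Fits F k M) (hmax : C.IsMaximal F k A)
    (ha : (nbrs F a).card < k) : (C.blocked F A a).card ≤ (3 * k + 2) * M := by
  have hflex : ∀ u, (C.flex F u).card ≤ (nbrs F u).card := fun u => Finset.card_filter_le _ _
  have hadj : (if C.label a ∈ A then ∅ else C.adjLabels F (C.label a) ∩ A).card ≤ k := by
    split_ifs with haA
    · simp
    · exact (hmax _ (label_mem_labels_sdiff.2 haA)).le
  calc (C.blocked F A a).card
      ≤ M + k * M + M * (k + 1) + k * M := by
        refine (Finset.card_union_le _ _).trans (add_le_add ((Finset.card_union_le _ _).trans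
          (add_le_add ((Finset.card_union_le _ _).trans (add_le_add ?_ ?_)) ?_)) ?_)
        · exact C.card_piece_le h.small _
        · exact (C.card_label_mem_le h.small _).trans
            (Nat.mul_le_mul_right M (Finset.card_image_le.trans ((hflex a).trans ha.le)))
        · exact (Finset.card_biUnion_le_card_mul _ _ (k + 1) fun u _ =>
            (hflex u).trans (h.deg u)).trans (Nat.mul_le_mul_right _ (C.card_piece_le h.small _))
        · exact (C.card_label_mem_le h.small _).trans (Nat.mul_le_mul_right M hadj)
    _ = (3 * k + 2) * M := by ring

open scoped Classical in
theorem Fits.card_le_card_canJoin_add (h : C.Fits F k M) (hmax : C.IsMaximal F k A)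
    (ha : (nbrs F a).card < k) {D : Finset V}
    (hD : ∀ b ∈ D, C.label b ∈ A ∧ (nbrs F b).card ≤ k) :
    D.card ≤ Finset.card {b ∈ D | C.CanJoin F k A a b} + (3 * k + 2) * M := by
  refine (Finset.card_le_card fun b hb => ?_).trans ((Finset.card_union_le _ _).trans
    (Nat.add_le_add_left (h.card_blocked_le hmax ha) _))
  by_cases hblocked : b ∈ C.blocked F A a
  · exact Finset.mem_union_right _ hblocked
  · exact Finset.mem_union_left _ (Finset.mem_filter.2
      ⟨hb, canJoin_of_notMem_blocked ha (hD b hb).1 (hD b hb).2 hblocked⟩)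

open scoped Classical in
theorem Fits.mass_le_card_canJoin_add (h : C.Fits F k M) (hmax : C.IsMaximal F k A)
    (ha : (nbrs F a).card < k) : C.mass A ≤
      Finset.card {b | C.CanJoin F k A a b} + excess F k + (3 * k + 2) * M := by
  have hmass := mass_le_card_add_excess (C := C) F k A
  have hjoin := h.card_le_card_canJoin_add hmax ha
    (D := {b | C.label b ∈ A ∧ (nbrs F b).card ≤ k}) fun b hb => (Finset.mem_filter.1 hb).2
  have hsub := Finset.card_le_card (Finset.filter_subset_filter (C.CanJoin F k A a)
    (Finset.subset_univ {b | C.label b ∈ A ∧ (nbrs F b).card ≤ k}))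
  lia

end CanJoin

end PathCover

section States

open PathCover

variable {V : Type*} [Fintype V] {F : SimpleGraph V} {k : ℕ}

/-- At least `L` pairs can be joined by a new edge within `Valid`. -/
def HasMoves (F : SimpleGraph V) (Valid : Set (SimpleGraph V)) (L : ℕ) : Prop :=
  ∃ S, L ≤ S.card ∧ IsMoves Valid F S

/-- A vertex can be joined by a new edge within `Valid` to all but `w` vertices, and each such edge
decreases the deficit. -/
def HasStar (F : SimpleGraph V) (k : ℕ) (Valid : Set (SimpleGraph V)) (w : ℕ) : Prop :=
  ∃ (S : Finset (V × V)) (a : V) (W : Finset V), W.card ≤ w ∧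
    (∀ b ≠ a, b ∉ W → (a, b) ∈ S) ∧ IsMoves Valid F S ∧
    ∀ x ∈ S, deficit (addPair F x) k < deficit F k

theorem PathCover.isMoves_of_canJoin {C : PathCover V} [DecidableEq V] {A : Finset V}
    {Valid : Set (SimpleGraph V)} {S : Finset (V × V)}
    (hS : ∀ a b, (a, b) ∈ S → C.CanJoin F k A a b ∧ addPair F (a, b) ∈ Valid) :
    IsMoves Valid F S where
  ne x hx := (hS x.1 x.2 hx).1.ne
  not_adj x hx := (hS x.1 x.2 hx).1.not_adj
  addPair_mem x hx := (hS x.1 x.2 hx).2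

variable [DecidableEq V] {M : ℕ}

/-- The states in which paths are attached to the robustly connected part. -/
def attachStates (k M B m : ℕ) : Set (SimpleGraph V) :=
  {F | ∃ (C : PathCover V) (A : Finset V), C.Attachable F k M A ∧
    C.flexSum F + 2 * C.need F k A ≤ B ∧ m ≤ C.mass A}

/-- The states in which attached vertices of degree less than `k` are joined. -/
def fillStates (k M q X : ℕ) : Set (SimpleGraph V) :=
  {F | ∃ (C : PathCover V) (A : Finset V), C.Attachable F k M A ∧ (C.labels \ A).card < q ∧
    excess F k ≤ X}

/-- The states in which the last vertices of degree less than `k` are joined to arbitrary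
vertices. -/
def finalStates (k M q X : ℕ) : Set (SimpleGraph V) :=
  {F | ∃ (C : PathCover V) (A : Finset V), C.Attachable F k M A ∧ (C.labels \ A).card < q ∧
    excess F k + deficit F k ≤ X}

theorem PathCover.Attachable.exists_isMaximal_of_card_lt {C : PathCover V} {A : Finset V} {q : ℕ}
    (h : C.Attachable F k M A) (hq : (C.labels \ A).card < q) :
    ∃ A', C.Attachable F k M A' ∧ (C.labels \ A').card < q ∧ C.IsMaximal F k A' := by
  obtain ⟨A', hsub, h', -, hmax⟩ := h.exists_isMaximal
  exact ⟨A', h', (Finset.card_le_card (Finset.sdiff_subset_sdiff subset_rfl hsub)).trans_lt hq,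
    hmax⟩

open scoped Classical in
theorem PathCover.hasMoves_attachStates {C : PathCover V} {A : Finset V} {B m L : ℕ}
    (h : C.Attachable F k M A) (hmax : C.IsMaximal F k A)
    (hflex : C.flexSum F + 2 * C.need F k A ≤ B) (hm : m ≤ C.mass A)
    (hL : L ≤ (C.labels \ A).card * (C.mass A - excess F k - (3 * k + 2) * M)) :
    HasMoves F (attachStates k M B m) L := by
  refine ⟨({x | C.label x.1 ∉ A ∧ C.CanJoin F k A x.1 x.2} : Finset (V × V)),
    hL.trans ((Nat.mul_le_mul_right _ (h.card_labels_sdiff_le hmax)).trans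
      (mul_le_card_of_forall_le_card fun a ha => ?_)),
    isMoves_of_canJoin (C := C) (A := A) (k := k) fun a b hx => ?_⟩
  · simp only [Finset.mem_filter, Finset.mem_univ, true_and] at ha
    have := h.fits.mass_le_card_canJoin_add hmax ha.2
    exact ⟨Finset.univ.filter (C.CanJoin F k A a), by lia, fun b hb => by simpa [ha.1] using hb⟩
  · simp only [Finset.mem_filter, Finset.mem_univ, true_and] at hx
    refine ⟨hx.2, C, A, h.addPair hx.2, ?_, hm⟩
    rw [flexSum_addPair hx.2.label_ne hx.2.not_adj]
    have := hx.2.need_addPair_lt hmax hx.1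
    lia

theorem hasMoves_or_mem_fillStates {B m q X L : ℕ} (h : F ∈ attachStates k M B m) (hk : 2 ≤ k)
    (hB : B ≤ (k - 1) * X)
    (hL : ∀ u mass, q ≤ u → m ≤ mass → Fintype.card V ≤ mass + u * M →
      L ≤ u * (mass - X - (3 * k + 2) * M)) :
    HasMoves F (attachStates k M B m) L ∨ F ∈ fillStates k M q X := by
  obtain ⟨C, A₀, hatt₀, hflex₀, hm₀⟩ := h
  obtain ⟨A, hA, hatt, hneed, hmax⟩ := hatt₀.exists_isMaximal
  have hm : m ≤ C.mass A := hm₀.trans (mass_mono hA)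
  have hkX : (k - 1) * excess F k ≤ (k - 1) * X := hatt.fits.mul_excess_le.trans (by lia)
  have hX : excess F k ≤ X := Nat.le_of_mul_le_mul_left hkX (by lia)
  rcases lt_or_ge (C.labels \ A).card q with hq | hq
  · exact Or.inr ⟨C, A, hatt, hq, hX⟩
  · refine Or.inl (hasMoves_attachStates hatt hmax (by lia) hm
      ((hL _ _ hq hm (hatt.fits.card_le_mass_add A)).trans (Nat.mul_le_mul_left _ ?_)))
    lia

open scoped Classical in
theorem PathCover.hasMoves_fillStates {C : PathCover V} {A : Finset V} {q X D L : ℕ}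
    (h : C.Attachable F k M A) (hmax : C.IsMaximal F k A) (hq : (C.labels \ A).card < q)
    (hX : excess F k ≤ X) (hD : D ≤ Finset.card {v | C.label v ∈ A ∧ (nbrs F v).card < k})
    (hL : L ≤ D * (D - (3 * k + 2) * M)) : HasMoves F (fillStates k M q X) L := by
  set E : Finset V := {v | C.label v ∈ A ∧ (nbrs F v).card < k}
  have hmem : ∀ v ∈ E, C.label v ∈ A ∧ (nbrs F v).card < k := fun v hv => (Finset.mem_filter.1 hv).2
  refine ⟨({x | x.1 ∈ E ∧ x.2 ∈ E ∧ C.CanJoin F k A x.1 x.2} : Finset (V × V)),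
    hL.trans ((Nat.mul_le_mul hD (Nat.sub_le_sub_right hD _)).trans
      (mul_le_card_of_forall_le_card fun a ha => ?_)),
    isMoves_of_canJoin (C := C) (A := A) (k := k) fun a b hx => ?_⟩
  · have := h.fits.card_le_card_canJoin_add hmax (hmem a ha).2
      (D := E) fun b hb => ⟨(hmem b hb).1, (hmem b hb).2.le⟩
    refine ⟨{b ∈ E | C.CanJoin F k A a b}, by lia, fun b hb => ?_⟩
    rw [Finset.mem_filter] at hb
    exact Finset.mem_filter.2 ⟨Finset.mem_univ _, ha, hb⟩
  · simp only [Finset.mem_filter_univ] at hx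
    obtain ⟨-, hb, hj⟩ := hx
    exact ⟨hj, C, A, h.addPair hj, hq,
      (excess_addPair_le hj.ne hj.not_adj hj.deg_left (hmem b hb).2).trans hX⟩

theorem hasMoves_or_mem_finalStates {q X X' D L : ℕ} (h : F ∈ fillStates k M q X)
    (hX : X + k * (D + q * M) ≤ X') (hL : L ≤ D * (D - (3 * k + 2) * M)) :
    HasMoves F (fillStates k M q X) L ∨ F ∈ finalStates k M q X' := by
  obtain ⟨C, A₀, hatt₀, hq₀, hex⟩ := h
  obtain ⟨A, hatt, hq, hmax⟩ := hatt₀.exists_isMaximal_of_card_lt hq₀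
  rcases le_or_gt D (Finset.card {v | C.label v ∈ A ∧ (nbrs F v).card < k}) with hD | hD
  · exact Or.inl (hasMoves_fillStates hatt hmax hq hex hD hL)
  have hlow : Finset.card {v | (nbrs F v).card < k} ≤ D + q * M := by
    have hsplit : ({v | (nbrs F v).card < k} : Finset V) ⊆
        ({v | C.label v ∈ A ∧ (nbrs F v).card < k} : Finset V) ∪
          ({v | C.label v ∉ A} : Finset V) := fun v hv => by
      simp_all only [Finset.mem_filter, Finset.mem_univ, true_and, Finset.mem_union, and_true]
      exact em _
    exact (Finset.card_le_card hsplit).trans ((Finset.card_union_le _ _).trans (add_le_add hD.le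
      ((hatt.fits.card_label_notMem_le A).trans (Nat.mul_le_mul_right M hq.le))))
  have hdeficit := (deficit_le_mul_card F k).trans (Nat.mul_le_mul_left k hlow)
  exact Or.inr ⟨C, A, hatt, hq, by lia⟩

theorem PathCover.addPair_mem_finalStates {C : PathCover V} {A : Finset V} {q X : ℕ}
    (h : C.Attachable F k M A) (hq : (C.labels \ A).card < q)
    (hX : excess F k + deficit F k ≤ X) {a b : V} (hj : C.CanJoin F k A a b) :
    addPair F (a, b) ∈ finalStates k M q X :=
  ⟨C, A, h.addPair hj, hq,
    (excess_add_deficit_addPair_le hj.ne hj.not_adj hj.deg_left hj.deg_right).trans hX⟩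

open scoped Classical in
theorem hasMoves_or_hasStar_finalStates [Nonempty V] {q X D L w : ℕ}
    (h : F ∈ finalStates k M q X) (hw : q * M + X + (3 * k + 2) * M ≤ w)
    (hL : L ≤ D * (Fintype.card V - w)) :
    IsKConnected k F ∨ HasMoves F (finalStates k M q X) L ∨
      (deficit F k ≤ k * D ∧ HasStar F k (finalStates k M q X) w) := by
  obtain ⟨C, A₀, hatt₀, hq₀, hX⟩ := h
  obtain ⟨A, hatt, hq, hmax⟩ := hatt₀.exists_isMaximal_of_card_lt hq₀
  set S : Finset (V × V) := {x | C.CanJoin F k A x.1 x.2} with hS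
  have hmem : ∀ a b, (a, b) ∈ S ↔ C.CanJoin F k A a b := fun a b => by simp [hS]
  have hmoves : IsMoves (finalStates k M q X) F S := isMoves_of_canJoin fun a b hx =>
    ⟨(hmem a b).1 hx, addPair_mem_finalStates hatt hq hX ((hmem a b).1 hx)⟩
  have hmany : ∀ a, (nbrs F a).card < k →
      Fintype.card V ≤ Finset.card {b | C.CanJoin F k A a b} + w := fun a ha => by
    have := hatt.fits.mass_le_card_canJoin_add hmax ha
    have := hatt.fits.card_le_mass_add A
    have := Nat.mul_le_mul_right M hq.le
    lia
  rcases le_or_gt D (Finset.card {v | (nbrs F v).card < k}) with hD | hD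
  · refine Or.inr (Or.inl ⟨S, hL.trans ((Nat.mul_le_mul_right _ hD).trans
      (mul_le_card_of_forall_le_card fun a ha => ?_)), hmoves⟩)
    have := hmany a (Finset.mem_filter.1 ha).2
    exact ⟨Finset.univ.filter (C.CanJoin F k A a), by lia, fun b hb =>
      (hmem a b).2 (Finset.mem_filter.1 hb).2⟩
  by_cases hdeg : ∀ v, k ≤ (nbrs F v).card
  · exact Or.inl (hatt.isKConnected hmax hdeg)
  push Not at hdeg
  obtain ⟨a, ha⟩ := hdeg
  refine Or.inr (Or.inr ⟨(deficit_le_mul_card F k).trans (Nat.mul_le_mul_left k hD.le), S, a,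
    Finset.univ.filter (¬ C.CanJoin F k A a ·), ?_,
    fun b _ hb => (hmem a b).2 (by simpa using hb), hmoves, fun x hx => ?_⟩)
  · have := hmany a ha
    have := Finset.card_filter_add_card_filter_not (s := Finset.univ) (C.CanJoin F k A a)
    rw [Finset.card_univ] at this
    lia
  · have hj := (hmem x.1 x.2).1 hx
    exact deficit_addPair_lt hj.ne hj.not_adj hj.deg_left

end States

namespace PathCover

section Growing

variable {V : Type*} {C : PathCover V}

theorem lt_card_piece [Fintype V] [DecidableEq V] (t : V) :
    C.pos t < (C.piece (C.label t)).card := by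
  rw [← Nat.succ_le_iff, ← Finset.card_range (C.pos t).succ]
  refine (Finset.card_le_card fun j hj => ?_).trans (Finset.card_image_le (f := C.pos))
  rw [Finset.mem_range_succ_iff] at hj
  obtain ⟨u, hu, hp⟩ := C.exists_of_le t hj
  exact Finset.mem_image.2 ⟨u, C.mem_piece.2 hu, hp⟩

theorem mul_le_mass [Fintype V] [DecidableEq V] {A : Finset V} {m : ℕ}
    (h : ∀ p ∈ A, m ≤ (C.piece p).card) : A.card * m ≤ C.mass A := by
  have hmaps : ∀ v ∈ Finset.univ.filter (C.label · ∈ A), C.label v ∈ A :=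
    fun v hv => (Finset.mem_filter.1 hv).2
  rw [mass, Finset.card_eq_sum_card_fiberwise hmaps, ← smul_eq_mul]
  refine Finset.card_nsmul_le_sum _ _ _ fun p hp => (h p hp).trans (Finset.card_le_card ?_)
  intro v hv
  rw [mem_piece] at hv
  simp [hv, hp]

variable (C) in
/-- The vertex is alone on its path. -/
def IsSingle (w : V) : Prop := ∀ u, C.label u = C.label w → u = w

theorem IsSingle.pos_eq_zero {w : V} (hw : C.IsSingle w) : C.pos w = 0 := by
  obtain ⟨b, hb, h0⟩ := C.exists_bottom w
  rwa [hw b hb] at h0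

theorem IsSingle.isTop {w : V} (hw : C.IsSingle w) : C.IsTop w := fun u hu hp => by
  rw [hw u hu] at hp
  lia

theorem IsTop.isSingle {w : V} (hw : C.IsTop w) (h0 : C.pos w = 0) : C.IsSingle w := fun u hu =>
  C.inj u w hu (by have := hw.le hu; lia)

open scoped Classical in
variable (C) in
/-- The last vertices of the nontrivial paths with fewer than `M` vertices. -/
noncomputable def unfinished [Fintype V] (M : ℕ) : Finset V :=
  {e | C.IsTop e ∧ 0 < C.pos e ∧ C.pos e + 1 < M}

theorem mem_unfinished [Fintype V] {M : ℕ} {v : V} :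
    v ∈ C.unfinished M ↔ C.IsTop v ∧ 0 < C.pos v ∧ C.pos v + 1 < M := by
  simp [unfinished]

variable [DecidableEq V] {e w : V}

/-- Append the single vertex `w` to the path that ends in `e`. -/
def extend (he : C.IsTop e) (hw : C.IsSingle w) (hne : e ≠ w) : PathCover V where
  label := Function.update C.label w (C.label e)
  pos := Function.update C.pos w (C.pos e + 1)
  inj u v hl hp := by
    have := C.inj u v
    grind [IsTop, IsSingle, Function.update_apply]
  down v j h := by
    by_cases hv : v = w
    · exact ⟨e, by grind [Function.update_apply]⟩
    · obtain ⟨u, hu, hj⟩ := C.down v j (by grind [Function.update_apply])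
      exact ⟨u, by grind [IsSingle, Function.update_apply]⟩

variable (he : C.IsTop e) (hw : C.IsSingle w) (hne : e ≠ w)

theorem graph_extend : (C.extend he hw hne).graph = addPair C.graph (e, w) := by
  ext a b
  have hlast : ∀ c, C.label c = C.label e → (C.pos c = C.pos e + 1 + 1 ∨
      C.pos e + 1 = C.pos c + 1) → c = e := fun c hc hp =>
    C.inj c e hc (by have := he.le hc; lia)
  rw [addPair_adj (x := (e, w)) hne, graph_adj, graph_adj]
  simp only [extend, Function.update_apply]
  grind [IsSingle]

theorem pos_extend_lt {M : ℕ} (hM : ∀ v, C.pos v < M) (heM : C.pos e + 1 < M) (v : V) :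
    (C.extend he hw hne).pos v < M := by
  simp only [extend, Function.update_apply]
  split_ifs
  exacts [heM, hM v]

variable [Fintype V] {M : ℕ}

theorem unfinished_extend_subset :
    (C.extend he hw hne).unfinished M ⊆ insert w ((C.unfinished M).erase e) := by
  intro v hv
  rw [mem_unfinished] at hv
  obtain ⟨htop, hpos, hM⟩ := hv
  rw [Finset.mem_insert, Finset.mem_erase, mem_unfinished]
  have hw' := htop w
  simp only [IsTop, extend, Function.update_apply] at htop hpos hM hw' ⊢
  grind [IsSingle]

end Growing

end PathCover

section Forests

open PathCover

variable {V : Type*} [Fintype V] {M J : ℕ}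

/-- The states in which paths on at most `M` vertices are built. -/
def forestStates (M J : ℕ) : Set (SimpleGraph V) :=
  {F | ∃ C : PathCover V, F = C.graph ∧ (∀ v, C.pos v < M) ∧ (C.unfinished M).card ≤ J}

theorem bot_mem_forestStates (hM : 0 < M) : (⊥ : SimpleGraph V) ∈ forestStates M J := by
  refine ⟨⟨id, fun _ => 0, fun u v h _ => h, fun v j h => absurd h (by simp)⟩, ?_, fun _ => hM, ?_⟩
  · ext a b
    simp [graph_adj]
  · simp [unfinished]

theorem card_nbrs_le_of_mem_forestStates {F : SimpleGraph V} (h : F ∈ forestStates M J) (v : V) :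
    (nbrs F v).card ≤ 2 := by
  classical
  obtain ⟨C, rfl, -, -⟩ := h
  have hflex : C.flex C.graph v = ∅ :=
    Finset.filter_eq_empty_iff.2 fun w hw => not_not.2 (mem_nbrs.1 hw).1.symm
  simpa [hflex] using Induced.card_nbrs_le_two_add (C := C) (fun u v h _ => h) v

variable {C : PathCover V}

theorem PathCover.addPair_mem_forestStates [DecidableEq V] (hM : ∀ v, C.pos v < M) {e w : V}
    (he : C.IsTop e) (hw : C.IsSingle w) (hne : e ≠ w) (heM : C.pos e + 1 < M)
    (hJ : (insert w ((C.unfinished M).erase e)).card ≤ J) :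
    addPair C.graph (e, w) ∈ forestStates M J :=
  ⟨C.extend he hw hne, (graph_extend he hw hne).symm, pos_extend_lt he hw hne hM heM,
    (Finset.card_le_card (unfinished_extend_subset he hw hne)).trans hJ⟩

theorem PathCover.isMoves_forestStates [DecidableEq V] (hM : ∀ v, C.pos v < M)
    {S : Finset (V × V)}
    (hS : ∀ e w, (e, w) ∈ S → e ≠ w ∧ C.IsTop e ∧ C.IsSingle w ∧ C.pos e + 1 < M ∧
      (insert w ((C.unfinished M).erase e)).card ≤ J) :
    IsMoves (forestStates M J) C.graph S where
  ne x hx := (hS x.1 x.2 hx).1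
  not_adj x hx hadj := (hS x.1 x.2 hx).1 ((hS x.1 x.2 hx).2.2.1 x.1 hadj.1)
  addPair_mem x hx :=
    have ⟨hne, he, hw, heM, hJ⟩ := hS x.1 x.2 hx
    addPair_mem_forestStates hM he hw hne heM hJ

open scoped Classical in
theorem PathCover.hasMoves_forestStates {ι L : ℕ} (hM : ∀ v, C.pos v < M) (hM₂ : 2 ≤ M)
    (hJ : (C.unfinished M).card ≤ J) (hι : ι ≤ Finset.card {v | C.IsSingle v}) (hL₁ : L ≤ J * ι)
    (hL₂ : L ≤ ι * (ι - 1)) : HasMoves C.graph (forestStates M J) L := by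
  set I : Finset V := {v | C.IsSingle v}
  have hI : ∀ v ∈ I, C.IsSingle v := fun v hv => (Finset.mem_filter.1 hv).2
  by_cases hJ' : (C.unfinished M).card = J
  · refine ⟨C.unfinished M ×ˢ I, ?_, isMoves_forestStates hM fun e w hx => ?_⟩
    · rw [Finset.card_product, hJ']
      exact hL₁.trans (Nat.mul_le_mul_left _ hι)
    · rw [Finset.mem_product] at hx
      obtain ⟨he, hpos, heM⟩ := mem_unfinished.1 hx.1
      have hw := hI w hx.2
      refine ⟨fun hew => hpos.ne' (hew ▸ hw.pos_eq_zero), he, hw, heM,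
        (Finset.card_insert_le _ _).trans ?_⟩
      rw [Finset.card_erase_add_one hx.1, hJ']
  · refine ⟨I.offDiag, ?_, isMoves_forestStates hM fun e w hx => ?_⟩
    · rw [Finset.offDiag_card, ← Nat.mul_sub_one]
      exact hL₂.trans (Nat.mul_le_mul hι (Nat.sub_le_sub_right hι 1))
    · rw [Finset.mem_offDiag] at hx
      have he := hI e hx.1
      have := he.pos_eq_zero
      have := Finset.card_le_card (Finset.erase_subset e (C.unfinished M))
      exact ⟨hx.2.2, he.isTop, hI w hx.2.1, by lia, (Finset.card_insert_le _ _).trans (by lia)⟩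

end Forests

namespace PathCover

section Finished

variable {V : Type*} [Fintype V] [DecidableEq V] {C : PathCover V} {M J ι K P : ℕ}

open scoped Classical in
variable (C M) in
/-- The labels of the paths with at least `M` vertices. -/
noncomputable def finished : Finset V :=
  ({e | C.IsTop e ∧ M ≤ C.pos e + 1} : Finset V).image C.label

theorem le_card_piece_of_mem_finished {p : V} (hp : p ∈ C.finished M) : M ≤ (C.piece p).card := by
  classical
  obtain ⟨t, ht, rfl⟩ := Finset.mem_image.1 hp
  exact (Finset.mem_filter.1 ht).2.2.trans (C.lt_card_piece t)

theorem card_finished_mul_le : (C.finished M).card * M ≤ Fintype.card V :=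
  (mul_le_mass fun _ => le_card_piece_of_mem_finished).trans (Finset.card_le_univ _)

theorem isSingle_or_label_mem (M : ℕ) (v : V) : C.IsSingle v ∨
    C.label v ∈ (C.unfinished M).image C.label ∨ C.label v ∈ C.finished M := by
  classical
  obtain ⟨t, ht, htop⟩ := C.exists_top v
  rw [← ht]
  by_cases h0 : C.pos t = 0
  · exact Or.inl (htop.isSingle h0 v ht.symm ▸ htop.isSingle h0)
  by_cases h1 : C.pos t + 1 < M
  · exact Or.inr (Or.inl (Finset.mem_image_of_mem _ (mem_unfinished.2 ⟨htop, by lia, h1⟩)))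
  · exact Or.inr (Or.inr (Finset.mem_image_of_mem _
      (Finset.mem_filter.2 ⟨Finset.mem_univ _, htop, by lia⟩)))

open scoped Classical in
theorem card_le_card_finished_mul_add (hM : ∀ v, C.pos v < M) : Fintype.card V ≤
    Finset.card {v | C.IsSingle v} + (C.unfinished M).card * M + (C.finished M).card * M := by
  have hcover : Finset.univ ⊆ ({v | C.IsSingle v} : Finset V) ∪
      ({v | C.label v ∈ (C.unfinished M).image C.label} : Finset V) ∪
      ({v | C.label v ∈ C.finished M} : Finset V) := fun v _ => by
    simpa only [Finset.mem_union, Finset.mem_filter_univ, or_assoc] using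
      C.isSingle_or_label_mem M v
  rw [← Finset.card_univ]
  refine (Finset.card_le_card hcover).trans ((Finset.card_union_le _ _).trans (add_le_add
    ((Finset.card_union_le _ _).trans (add_le_add_right ?_ _)) (C.card_label_mem_le hM _)))
  exact (C.card_label_mem_le hM _).trans (Nat.mul_le_mul_right M Finset.card_image_le)

open scoped Classical in
theorem card_labels_le (M : ℕ) : C.labels.card ≤
    Finset.card {v | C.IsSingle v} + (C.unfinished M).card + (C.finished M).card := by
  have hcover : C.labels ⊆ ({v | C.IsSingle v} : Finset V).image C.label ∪
      (C.unfinished M).image C.label ∪ C.finished M := fun p hp => by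
    obtain ⟨v, -, rfl⟩ := Finset.mem_image.1 hp
    simp only [Finset.mem_union, or_assoc]
    exact (C.isSingle_or_label_mem M v).imp_left fun hv => Finset.mem_image_of_mem _
      (Finset.mem_filter.2 ⟨Finset.mem_univ _, hv⟩)
  refine (Finset.card_le_card hcover).trans ((Finset.card_union_le _ _).trans
    (Nat.add_le_add_right ((Finset.card_union_le _ _).trans ?_) _))
  exact add_le_add Finset.card_image_le Finset.card_image_le

end Finished

end PathCover

section Hub

open PathCover

variable {V : Type*} [Fintype V] [DecidableEq V]

/-- `K` paths on at least `M` vertices, with labels in `Λ`, are joined to each other: each pair of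
them by at most one edge, and these edges are disjoint and avoid the ends of the paths. -/
structure IsHub (C : PathCover V) (Λ : Finset V) (K M P : ℕ) (F : SimpleGraph V) : Prop where
  le : C.graph ≤ F
  internal : C.Induced F
  small : ∀ v, C.pos v < M
  card_labels : C.labels.card ≤ P
  card_eq : Λ.card = K
  card_piece : ∀ p ∈ Λ, M ≤ (C.piece p).card
  inner : ∀ u v, F.Adj u v → C.label u ≠ C.label v → C.label u ∈ Λ ∧ 0 < C.pos u ∧ ¬ C.IsTop u
  unique : ∀ u v u' v', F.Adj u v → F.Adj u' v' → C.label u = C.label u' →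
    C.label v = C.label v' → C.label u ≠ C.label v → u = u'
  flex_eq : ∀ u v w, F.Adj u v → F.Adj u w → C.label v ≠ C.label u → C.label w ≠ C.label u → v = w

/-- The states in which `K` paths on `M` vertices are joined to each other. -/
def hubStates (K M P : ℕ) : Set (SimpleGraph V) :=
  {F | ∃ (C : PathCover V) (Λ : Finset V), IsHub C Λ K M P F}

theorem PathCover.exists_isHub_graph {C : PathCover V} {K M P : ℕ} (hM : ∀ v, C.pos v < M)
    (hP : C.labels.card ≤ P) (hK : K ≤ (C.finished M).card) : ∃ Λ, IsHub C Λ K M P C.graph := by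
  obtain ⟨Λ, hΛ, hΛK⟩ := Finset.exists_subset_card_eq hK
  exact ⟨Λ, le_rfl, fun u v h _ => h, hM, hP, hΛK,
    fun p hp => le_card_piece_of_mem_finished (hΛ hp), fun u v h hn => absurd h.1 hn,
    fun u v _ _ h _ _ _ hn => absurd h.1 hn, fun u v w h _ hn => absurd h.1.symm hn⟩

theorem hasMoves_or_mem_hubStates {M J ι K P L : ℕ} {F : SimpleGraph V} (h : F ∈ forestStates M J)
    (hM : 2 ≤ M) (hL₁ : L ≤ J * ι) (hL₂ : L ≤ ι * (ι - 1))
    (hK : K * M + J * M + ι ≤ Fintype.card V) (hP : ι + J + Fintype.card V / M ≤ P) :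
    HasMoves F (forestStates M J) L ∨ F ∈ hubStates K M P := by
  classical
  obtain ⟨C, rfl, hsmall, hJ⟩ := h
  rcases le_or_gt ι (Finset.card {v | C.IsSingle v}) with hι | hι
  · exact Or.inl (hasMoves_forestStates hsmall hM hJ hι hL₁ hL₂)
  have hfinished := (Nat.le_div_iff_mul_le (by lia)).2 (C.card_finished_mul_le (M := M))
  have hlabels := C.card_labels_le M
  have hcard := C.card_le_card_finished_mul_add hsmall
  have hunfinished := Nat.mul_le_mul_right M hJ
  have hKM : K * M ≤ (C.finished M).card * M := by lia
  exact Or.inr ⟨C, exists_isHub_graph hsmall (by lia) (Nat.le_of_mul_le_mul_right hKM (by lia))⟩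

namespace IsHub

variable {C : PathCover V} {Λ : Finset V} {K M P : ℕ} {F : SimpleGraph V}

theorem card_flex_le_one (h : IsHub C Λ K M P F) (v : V) : (C.flex F v).card ≤ 1 := by
  rw [Finset.card_le_one]
  intro a ha b hb
  rw [mem_flex] at ha hb
  exact h.flex_eq v a b ha.1 hb.1 ha.2 hb.2

theorem flex_eq_empty (h : IsHub C Λ K M P F) {v : V} (hv : C.pos v = 0 ∨ C.IsTop v) :
    C.flex F v = ∅ := by
  refine Finset.eq_empty_iff_forall_notMem.2 fun w hw => ?_
  rw [mem_flex] at hw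
  obtain ⟨-, hpos, htop⟩ := h.inner v w hw.1 hw.2.symm
  exact hv.elim hpos.ne' htop

theorem fits (h : IsHub C Λ K M P F) {k : ℕ} (hk : 2 ≤ k) : C.Fits F k M where
  le := h.le
  internal := h.internal
  distinct u v w huv huw hvw hne := h.flex_eq u v w huv huw hne (hvw ▸ hne)
  small := h.small
  deg v := by
    have := h.internal.card_nbrs_le_two_add v
    have := h.card_flex_le_one v
    lia

theorem card_filter_flex_nonempty_le (h : IsHub C Λ K M P F) (p : V) :
    Finset.card {v ∈ C.piece p | (C.flex F v).Nonempty} ≤ K := by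
  choose! f hf using fun v (hv : (C.flex F v).Nonempty) => hv
  rw [← h.card_eq]
  refine Finset.card_le_card_of_injOn (fun v => C.label (f v)) (fun v hv => ?_)
    fun u hu v hv huv => ?_
  · obtain ⟨-, hv⟩ := Finset.mem_filter.1 hv
    have := C.mem_flex.1 (hf v hv)
    exact (h.inner _ _ this.1.symm this.2).1
  · obtain ⟨hup, hu⟩ := Finset.mem_filter.1 hu
    obtain ⟨hvp, hv⟩ := Finset.mem_filter.1 hv
    rw [mem_piece] at hup hvp
    have h1 := C.mem_flex.1 (hf u hu)
    have h2 := C.mem_flex.1 (hf v hv)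
    exact h.unique u _ v _ h1.1 h2.1 (hup.trans hvp.symm) huv h1.2.symm

theorem flexSum_le (h : IsHub C Λ K M P F) : C.flexSum F ≤ K * K := by
  have hle : ∀ v, (C.flex F v).card ≤ if (C.flex F v).Nonempty then 1 else 0 := fun v => by
    split_ifs with hv
    · exact h.card_flex_le_one v
    · rw [Finset.not_nonempty_iff_eq_empty.1 hv, Finset.card_empty]
  have hcover : ({v | (C.flex F v).Nonempty} : Finset V) ⊆
      Λ.biUnion fun p => {v ∈ C.piece p | (C.flex F v).Nonempty} := fun v hv => by
    rw [Finset.mem_filter_univ] at hv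
    obtain ⟨w, hw⟩ := hv
    have := C.mem_flex.1 hw
    exact Finset.mem_biUnion.2 ⟨C.label v, (h.inner v w this.1 this.2.symm).1,
      Finset.mem_filter.2 ⟨C.mem_piece.2 rfl, w, hw⟩⟩
  calc C.flexSum F ≤ Finset.card {v | (C.flex F v).Nonempty} := by
        rw [Finset.card_filter]
        exact Finset.sum_le_sum fun v _ => hle v
    _ ≤ Λ.card * K := (Finset.card_le_card hcover).trans
        (Finset.card_biUnion_le_card_mul _ _ _ fun p _ => h.card_filter_flex_nonempty_le p)
    _ = K * K := by rw [h.card_eq]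

theorem le_freeEnds (h : IsHub C Λ K M P F) {k : ℕ} (hk : 2 ≤ k) (v : V) :
    k ≤ C.freeEnds F k (C.label v) := by
  obtain ⟨b, hb, hb0⟩ := C.exists_bottom v
  obtain ⟨t, ht, htop⟩ := C.exists_top v
  have hdb := h.internal.card_nbrs_le b
  have hdt := h.internal.card_nbrs_le t
  rw [h.flex_eq_empty (Or.inl hb0), preds_eq_empty hb0] at hdb
  rw [h.flex_eq_empty (Or.inr htop), htop.succs_eq_empty] at hdt
  have := C.card_succs_le_one b
  have := C.card_preds_le_one t
  simp only [Finset.card_empty] at hdb hdt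
  rcases eq_or_ne b t with rfl | hbt
  · rw [htop.succs_eq_empty, Finset.card_empty] at hdb
    refine le_trans ?_ (Finset.single_le_sum (f := fun u => k - (nbrs F u).card)
      (fun _ _ => Nat.zero_le _) (C.mem_piece.2 hb))
    lia
  · refine le_trans ?_ (Finset.sum_le_sum_of_subset (s := {b, t}) ?_)
    · rw [Finset.sum_pair hbt]
      lia
    · simp [Finset.insert_subset_iff, mem_piece, hb, ht]

variable (C Λ F) in
/-- The pairs of distinct paths with labels in `Λ` that are not adjacent. -/
noncomputable def missing : Finset (V × V) := {x ∈ Λ.offDiag | x.2 ∉ C.adjLabels F x.1}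

variable (C F) in
open scoped Classical in
/-- The inner vertices of the path `p` with no neighbour on another path. -/
noncomputable def free (p : V) : Finset V :=
  {v ∈ C.piece p | 0 < C.pos v ∧ ¬ C.IsTop v ∧ C.flex F v = ∅}

theorem mem_free {p v : V} :
    v ∈ free C F p ↔ C.label v = p ∧ 0 < C.pos v ∧ ¬ C.IsTop v ∧ C.flex F v = ∅ := by
  simp [free, mem_piece]

theorem le_card_free (h : IsHub C Λ K M P F) {p : V} (hp : p ∈ Λ) :
    M - 2 - K ≤ (free C F p).card := by
  classical
  have hcover : C.piece p ⊆ free C F p ∪ {v ∈ C.piece p | C.pos v = 0} ∪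
      {v ∈ C.piece p | C.IsTop v} ∪ {v ∈ C.piece p | (C.flex F v).Nonempty} := fun v hv => by
    simp only [free, Finset.mem_union, Finset.mem_filter, hv, true_and,
      Finset.nonempty_iff_ne_empty, Nat.pos_iff_ne_zero]
    tauto
  have hbottom : Finset.card {v ∈ C.piece p | C.pos v = 0} ≤ 1 := by
    simp only [Finset.card_le_one, Finset.mem_filter, mem_piece]
    exact fun a ha b hb => C.inj a b (ha.1.trans hb.1.symm) (ha.2.trans hb.2.symm)
  have htop : Finset.card {v ∈ C.piece p | C.IsTop v} ≤ 1 := by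
    simp only [Finset.card_le_one, Finset.mem_filter, mem_piece]
    exact fun a ha b hb => ha.2.eq hb.2 (ha.1.trans hb.1.symm)
  have hunion : (C.piece p).card ≤ (free C F p).card +
      Finset.card {v ∈ C.piece p | C.pos v = 0} + Finset.card {v ∈ C.piece p | C.IsTop v} +
      Finset.card {v ∈ C.piece p | (C.flex F v).Nonempty} := by
    grw [hcover, Finset.card_union_le, Finset.card_union_le, Finset.card_union_le]
  have := h.card_filter_flex_nonempty_le p
  have := h.card_piece p hp
  lia

theorem addPair (h : IsHub C Λ K M P F) {a b : V} (hmiss : (C.label a, C.label b) ∈ missing C Λ F)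
    (ha : a ∈ free C F (C.label a)) (hb : b ∈ free C F (C.label b)) :
    IsHub C Λ K M P (addPair F (a, b)) := by
  obtain ⟨hoff, hadj⟩ := Finset.mem_filter.1 hmiss
  obtain ⟨haΛ, hbΛ, hab⟩ := Finset.mem_offDiag.1 hoff
  obtain ⟨-, hapos, hatop, haflex⟩ := mem_free.1 ha
  obtain ⟨-, hbpos, hbtop, hbflex⟩ := mem_free.1 hb
  have hadj_iff : ∀ u v, (USTSR.addPair F (a, b)).Adj u v ↔
      F.Adj u v ∨ (u = a ∧ v = b) ∨ (u = b ∧ v = a) := fun u v =>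
    addPair_adj (x := (a, b)) fun h => hab (congrArg C.label h)
  have hnone : ∀ u v, F.Adj u v → C.label u = C.label a → C.label v ≠ C.label b :=
    fun u v huv hu hv => hadj (C.mem_adjLabels.2 ⟨hab.symm, u, v, hu, hv, huv⟩)
  have hflex : ∀ c, C.flex F c = ∅ → ∀ v, F.Adj c v → C.label v = C.label c := fun c hc v hv => by
    by_contra hl
    simpa [hc] using C.mem_flex.2 ⟨hv, hl⟩
  have ha' := hflex a haflex
  have hb' := hflex b hbflex
  refine { h with
    le := h.le.trans (le_addPair _ _)
    internal := ?_
    inner := ?_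
    unique := ?_
    flex_eq := ?_ }
  · simp only [hadj_iff, PathCover.Induced]
    rintro u v (huv | ⟨rfl, rfl⟩ | ⟨rfl, rfl⟩) hl
    · exact h.internal u v huv hl
    · exact absurd hl hab
    · exact absurd hl.symm hab
  · simp only [hadj_iff]
    rintro u v (huv | ⟨rfl, rfl⟩ | ⟨rfl, rfl⟩) hl
    · exact h.inner u v huv hl
    · exact ⟨haΛ, hapos, hatop⟩
    · exact ⟨hbΛ, hbpos, hbtop⟩
  · intro u v u' v'
    have := h.unique u v u' v'
    have := fun u v (huv : F.Adj u v) => huv.symm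
    grind
  · intro u v w
    have := h.flex_eq u v w
    grind

theorem mul_le_card_of_missing (h : IsHub C Λ K M P F) {S : Finset (V × V)}
    (hS : ∀ x, x ∈ S ↔ (C.label x.1, C.label x.2) ∈ missing C Λ F ∧
      x.1 ∈ free C F (C.label x.1) ∧ x.2 ∈ free C F (C.label x.2)) :
    (missing C Λ F).card * ((M - 2 - K) * (M - 2 - K)) ≤ S.card := by
  rw [Finset.card_eq_sum_card_fiberwise (f := fun x => (C.label x.1, C.label x.2))
    (t := missing C Λ F) (fun x hx => ((hS x).1 hx).1), ← smul_eq_mul]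
  refine Finset.card_nsmul_le_sum _ _ _ ?_
  rintro ⟨p, r⟩ hx
  have hoff := Finset.mem_offDiag.1 (Finset.mem_filter.1 hx).1
  refine (Nat.mul_le_mul (h.le_card_free hoff.1) (h.le_card_free hoff.2.1)).trans ?_
  rw [← Finset.card_product]
  refine Finset.card_le_card ?_
  rintro ⟨a, b⟩ hab
  rw [Finset.mem_product] at hab
  obtain rfl : C.label a = p := (mem_free.1 hab.1).1
  obtain rfl : C.label b = r := (mem_free.1 hab.2).1
  exact Finset.mem_filter.2 ⟨(hS _).2 ⟨hx, hab⟩, rfl⟩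

theorem hasMoves {L : ℕ} (h : IsHub C Λ K M P F)
    (hL : L ≤ (missing C Λ F).card * ((M - 2 - K) * (M - 2 - K))) :
    HasMoves F (hubStates K M P) L := by
  classical
  set S : Finset (V × V) := {x | (C.label x.1, C.label x.2) ∈ missing C Λ F ∧
    x.1 ∈ free C F (C.label x.1) ∧ x.2 ∈ free C F (C.label x.2)} with hS
  have hmem : ∀ x, x ∈ S ↔ (C.label x.1, C.label x.2) ∈ missing C Λ F ∧
      x.1 ∈ free C F (C.label x.1) ∧ x.2 ∈ free C F (C.label x.2) := fun x => by simp [hS]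
  have hmissing : ∀ x ∈ S, C.label x.1 ≠ C.label x.2 ∧ C.label x.2 ∉ C.adjLabels F (C.label x.1) :=
    fun x hx =>
      have ⟨hoff, hadj⟩ := Finset.mem_filter.1 ((hmem x).1 hx).1
      ⟨(Finset.mem_offDiag.1 hoff).2.2, hadj⟩
  exact ⟨S, hL.trans (h.mul_le_card_of_missing hmem),
    fun x hx => ne_of_apply_ne _ (hmissing x hx).1,
    fun x hx hF => (hmissing x hx).2
      (C.mem_adjLabels.2 ⟨(hmissing x hx).1.symm, x.1, x.2, rfl, rfl, hF⟩),
    fun x hx =>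
      have ⟨hmiss, hfree₁, hfree₂⟩ := (hmem x).1 hx
      ⟨C, Λ, h.addPair hmiss hfree₁ hfree₂⟩⟩

theorem attachable {k : ℕ} (h : IsHub C Λ K M P F) (hk : 2 ≤ k) :
    C.Attachable F k M (Λ \ (missing C Λ F).image Prod.fst) where
  fits := h.fits hk
  robust := robust_of_pairwise h.le fun a ha b hb hab => by
    by_contra hadj
    rw [Finset.mem_sdiff] at ha hb
    exact ha.2 (Finset.mem_image.2 ⟨(a, b), Finset.mem_filter.2
      ⟨Finset.mem_offDiag.2 ⟨ha.1, hb.1, hab⟩, hadj⟩, rfl⟩)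
  supply v _ := (h.le_freeEnds hk v).trans (Nat.le_add_left _ _)

theorem need_le (h : IsHub C Λ K M P F) (k : ℕ) (A : Finset V) : C.need F k A ≤ P * k :=
  (Finset.sum_le_card_nsmul _ _ k fun _ _ => Nat.sub_le _ _).trans
    (Nat.mul_le_mul_right k ((Finset.card_le_card Finset.sdiff_subset).trans h.card_labels))

end IsHub

theorem hasMoves_or_mem_attachStates {k K M P B m L : ℕ} {F : SimpleGraph V}
    (h : F ∈ hubStates K M P) (hk : 2 ≤ k) (hB : K * K + 2 * (k * P) ≤ B) (hm : 2 * m ≤ K * M)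
    (hL : 2 * L ≤ K * ((M - 2 - K) * (M - 2 - K))) :
    HasMoves F (hubStates K M P) L ∨ F ∈ attachStates k M B m := by
  obtain ⟨C, Λ, h⟩ := h
  rcases lt_or_ge K (2 * (IsHub.missing C Λ F).card) with hmiss | hmiss
  · have := Nat.mul_le_mul_right ((M - 2 - K) * (M - 2 - K)) hmiss.le
    exact Or.inl (h.hasMoves (by lia))
  refine Or.inr ⟨C, _, h.attachable hk, ?_, ?_⟩
  · have := h.flexSum_le
    have := h.need_le k (Λ \ (IsHub.missing C Λ F).image Prod.fst)
    lia
  · have hsdiff := Finset.le_card_sdiff ((IsHub.missing C Λ F).image Prod.fst) Λ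
    have himage : ((IsHub.missing C Λ F).image Prod.fst).card ≤ (IsHub.missing C Λ F).card :=
      Finset.card_image_le
    rw [h.card_eq] at hsdiff
    have hhalf : K ≤ 2 * (Λ \ (IsHub.missing C Λ F).image Prod.fst).card := by lia
    have := Nat.mul_le_mul_right M hhalf
    have := mul_le_mass (C := C) (A := Λ \ (IsHub.missing C Λ F).image Prod.fst) (m := M)
      fun p hp => h.card_piece p (Finset.mem_sdiff.1 hp).1
    lia

end Hub

section Strategies

variable {n k : ℕ}

theorem IsMoves.mono {V : Type*} {F : SimpleGraph V} {Valid Valid' : Set (SimpleGraph V)}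
    {S : Finset (V × V)} (h : IsMoves Valid F S) (hsub : Valid ⊆ Valid') : IsMoves Valid' F S :=
  { h with addPair_mem := fun x hx => hsub (h.addPair_mem x hx) }

theorem HasMoves.mono {V : Type*} {F : SimpleGraph V} {Valid Valid' : Set (SimpleGraph V)} {L : ℕ}
    (h : HasMoves F Valid L) (hsub : Valid ⊆ Valid') : HasMoves F Valid' L :=
  let ⟨S, hL, hS⟩ := h
  ⟨S, hL, hS.mono hsub⟩

theorem HasStar.mono {V : Type*} [Fintype V] {F : SimpleGraph V}
    {Valid Valid' : Set (SimpleGraph V)} {w : ℕ} (h : HasStar F k Valid w) (hsub : Valid ⊆ Valid') :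
    HasStar F k Valid' w :=
  let ⟨S, a, W, hW, haS, hS, hdef⟩ := h
  ⟨S, a, W, hW, haS, hS.mono hsub, hdef⟩

theorem IsMoves.isAdvance_of_star (hn : 2 ≤ n) {F : SimpleGraph (Fin n)}
    {Valid : Set (SimpleGraph (Fin n))} {Φ Ψ : SimpleGraph (Fin n) → ℝ}
    {S : Finset (Fin n × Fin n)} {v : Fin n} {W : Finset (Fin n)} {L : ℕ} {δ : ℝ}
    (h : IsMoves Valid F S) (hS : ∀ u ≠ v, u ∉ W → (v, u) ∈ S) (hW : 4 * W.card ≤ n)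
    (hδ : 2 * W.card / n ≤ δ ∨ L ≤ (adjPairs F).card ∧ n * Real.exp (-(L / n)) ≤ δ)
    (hΦ : ∀ x ∈ S, Φ (addPair F x) + 2 * δ ≤ Φ F) (hΨ : ∀ x ∈ S, Ψ (addPair F x) + 1 ≤ Ψ F) :
    IsAdvance Valid Φ Ψ F S (1 / 2) δ := by
  have : NeZero n := ⟨by lia⟩
  have hn₀ : (0 : ℝ) < n := by exact_mod_cast Nat.pos_of_neZero n
  have hmiss := treeLaw_real_compl_hits_star_le hn hS
  have hhalf : 2 * (W.card : ℝ) / n ≤ 1 / 2 := by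
    rw [div_le_iff₀ hn₀]
    have : (4 * W.card : ℝ) ≤ n := by exact_mod_cast hW
    linarith
  refine { h with
    pos := by norm_num
    le_hits := ?_
    lost_le := ?_
    failure_le := fun x hx => by linarith [hΦ x hx]
    waiting_le := fun x hx => by linarith [hΨ x hx] }
  · rw [probReal_compl_eq_one_sub .of_discrete] at hmiss
    linarith
  · rcases hδ with hδ | ⟨hL, hδ⟩
    · exact (measureReal_mono Set.inter_subset_left (measure_ne_top _ _)).trans (hmiss.trans hδ)
    · exact lost_le_of_le_card_adjPairs S hL hδ

/-- Charges `c` for each of the at most `N` edges still to be added, and `δ` for each unit of the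
deficit, of which at most `D` units are missing once star moves are used. -/
noncomputable def potential (k N D : ℕ) (c δ : ℝ) (F : SimpleGraph (Fin n)) : ℝ :=
  c * (N - F.edgeSet.ncard : ℕ) + δ * (min (deficit F k) D : ℕ)

section Potential

variable {N D : ℕ} {c δ : ℝ} {F : SimpleGraph (Fin n)} {x : Fin n × Fin n}

theorem potential_nonneg (hc : 0 ≤ c) (hδ : 0 ≤ δ) (F : SimpleGraph (Fin n)) :
    0 ≤ potential k N D c δ F := by
  unfold potential
  positivity

theorem potential_le (hc : 0 ≤ c) (hδ : 0 ≤ δ) (F : SimpleGraph (Fin n)) :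
    potential k N D c δ F ≤ c * N + δ * D := by
  unfold potential
  gcongr
  exacts [Nat.sub_le _ _, min_le_right _ _]

theorem sub_ncard_edgeSet_addPair (hne : x.1 ≠ x.2) (hF : ¬ F.Adj x.1 x.2)
    (hN : (addPair F x).edgeSet.ncard ≤ N) :
    N - F.edgeSet.ncard = N - (addPair F x).edgeSet.ncard + 1 := by
  rw [ncard_edgeSet_addPair hne hF] at hN ⊢
  lia

theorem potential_addPair_le (hδ : 0 ≤ δ) (hne : x.1 ≠ x.2) (hF : ¬ F.Adj x.1 x.2)
    (hN : (addPair F x).edgeSet.ncard ≤ N) :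
    potential k N D c δ (addPair F x) + c ≤ potential k N D c δ F := by
  have hdef : min (deficit (addPair F x) k) D ≤ min (deficit F k) D :=
    min_le_min_right _ (deficit_anti (le_addPair F x) k)
  have hdef' : δ * (min (deficit (addPair F x) k) D : ℕ) ≤ δ * (min (deficit F k) D : ℕ) := by
    gcongr
  rw [potential, potential, sub_ncard_edgeSet_addPair hne hF hN, Nat.cast_add_one]
  linarith

theorem potential_addPair_le_of_deficit_lt (hc : 0 ≤ c) (hδ : 0 ≤ δ) (hne : x.1 ≠ x.2)
    (hF : ¬ F.Adj x.1 x.2) (hN : (addPair F x).edgeSet.ncard ≤ N) (hD : deficit F k ≤ D)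
    (hdef : deficit (addPair F x) k < deficit F k) :
    potential k N D c δ (addPair F x) + δ ≤ potential k N D c δ F := by
  have hmin : min (deficit (addPair F x) k) D + 1 ≤ min (deficit F k) D := by lia
  have hmin' := mul_le_mul_of_nonneg_left (Nat.cast_le (α := ℝ).2 hmin) hδ
  rw [potential, potential, sub_ncard_edgeSet_addPair hne hF hN]
  push_cast at hmin' ⊢
  linarith

end Potential

theorem exists_strategy_of_moves (hn : 2 ≤ n) {Valid P : Set (SimpleGraph (Fin n))}
    {N D L w W : ℕ} {η δ : ℝ} (hW : 0 < W) (hbot : ⊥ ∈ Valid)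
    (hN : ∀ F ∈ Valid, F.edgeSet.ncard ≤ N) (hη : n * Real.exp (-(L / n)) ≤ η) (hη₂ : η ≤ 1 / 2)
    (hw : 4 * w ≤ n) (hδ : 2 * (w : ℝ) / n ≤ δ ∨ L + D ≤ n * k ∧ η ≤ δ)
    (hstep : ∀ F ∈ Valid \ P,
      HasMoves F Valid L ∨ deficit F k ≤ D ∧ HasStar F k Valid w) :
    ∃ σ : Strategy n, 1 - (2 * η * N + 2 * δ * D + (2 * η * N + D) / W) ≤
      (treesLaw n).real {T | ∃ t < N + W, hittingTime σ P T = (t : ℕ∞) ∧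
        graphAfter σ T t ∈ Valid ∩ P} := by
  have : NeZero n := ⟨by lia⟩
  have hη₀ : 0 ≤ 2 * η := mul_nonneg zero_le_two (le_trans (by positivity) hη)
  have hδ₀ : 0 ≤ 2 * δ := by
    rcases hδ with h | h
    · exact mul_nonneg zero_le_two (le_trans (by positivity) h)
    · exact hη₀.trans (by linarith)
  obtain ⟨σ, hσ⟩ := exists_strategy_of_potential hn hW
    (potential_nonneg (k := k) (N := N) (D := D) hη₀ hδ₀)
    (potential_nonneg (k := k) (N := N) (D := D) hη₀ zero_le_one) hbot hN (fun F hF => by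
      rcases hstep F hF with ⟨S, hSL, hS⟩ | ⟨hD, S, v, Z, hZ, hvS, hS, hdef⟩
      · exact ⟨S, _, _, hS.isAdvance_of_le_card hSL hη hη₂
          (fun x hx => potential_addPair_le hδ₀ (hS.ne x hx) (hS.not_adj x hx)
            (hN _ (hS.addPair_mem x hx)))
          fun x hx => potential_addPair_le zero_le_one (hS.ne x hx) (hS.not_adj x hx)
            (hN _ (hS.addPair_mem x hx))⟩
      · refine ⟨S, _, _, hS.isAdvance_of_star (L := L) hn hvS (by lia) (hδ.imp (fun h => ?_) ?_)
          (fun x hx => potential_addPair_le_of_deficit_lt hη₀ hδ₀ (hS.ne x hx) (hS.not_adj x hx)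
            (hN _ (hS.addPair_mem x hx)) hD (hdef x hx))
          fun x hx => potential_addPair_le_of_deficit_lt hη₀ zero_le_one (hS.ne x hx)
            (hS.not_adj x hx) (hN _ (hS.addPair_mem x hx)) hD (hdef x hx)⟩
        · grw [← h, hZ]
        · rintro ⟨hL, h⟩
          have hedges := le_two_mul_ncard_edgeSet F k
          rw [Fintype.card_fin] at hedges
          exact ⟨by rw [card_adjPairs]; lia, hη.trans h⟩)
  refine ⟨σ, le_trans ?_ hσ⟩
  have hΦ := potential_le (k := k) (N := N) (D := D) hη₀ hδ₀ (⊥ : SimpleGraph (Fin n))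
  have hΨ := potential_le (k := k) (N := N) (D := D) hη₀ zero_le_one (⊥ : SimpleGraph (Fin n))
  rw [one_mul] at hΨ
  gcongr

/-- The event aimed at: a `k`-connected graph appears for the first time after `t < N` rounds, and
it has a spanning `k`-connected subgraph with all degrees `k` or `k + 1`. -/
def successEvent (σ : Strategy n) (k N : ℕ) : Set (ℕ → SpanningTree n) :=
  {T | ∃ t < N, hittingTime σ (kConnectedGraphs n k) T = (t : ℕ∞) ∧
    ∃ H ≤ graphAfter σ T t, IsKConnected k H ∧ DegreesKOrSucc k H}

theorem subset_successEvent (σ : Strategy n) {Valid : Set (SimpleGraph (Fin n))} {N N' : ℕ}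
    (hdeg : ∀ F ∈ Valid, ∀ v, (nbrs F v).card ≤ k + 1) (hN : N ≤ N') :
    {T | ∃ t < N, hittingTime σ (kConnectedGraphs n k) T = (t : ℕ∞) ∧
      graphAfter σ T t ∈ Valid ∩ kConnectedGraphs n k} ⊆ successEvent σ k N' := by
  rintro T ⟨t, ht, hτ, hvalid, hconn⟩
  exact ⟨t, ht.trans_le hN, hτ, _, le_rfl, hconn, hconn.degreesKOrSucc (hdeg _ hvalid)⟩

end Strategies

section Scale

theorem mul_pow_le_pow {r c i j : ℕ} (hr : 0 < r) (hc : c ≤ r) (hij : i < j) :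
    c * r ^ i ≤ r ^ j :=
  calc c * r ^ i ≤ r * r ^ i := Nat.mul_le_mul_right _ hc
    _ = r ^ (i + 1) := (pow_succ' r i).symm
    _ ≤ r ^ j := Nat.pow_le_pow_right hr hij

/-- `r` is large and is the `80`-th root of `n`, up to a constant factor. All parameters of the
strategies are powers of `r`, up to constants. -/
structure IsScale (n r : ℕ) : Prop where
  le : 200 ≤ r
  pow_le : r ^ 80 ≤ n
  le_two_mul_pow : n ≤ 2 * r ^ 80

namespace IsScale

variable {n r : ℕ}

theorem pos (h : IsScale n r) : 0 < r := by
  have := h.le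
  lia

theorem mul_pow_le_pow (h : IsScale n r) (c i j : ℕ) (hc : c ≤ 200 := by norm_num)
    (hij : i < j := by norm_num) : c * r ^ i ≤ r ^ j :=
  USTSR.mul_pow_le_pow h.pos (hc.trans h.le) hij

theorem le_pow (h : IsScale n r) (c j : ℕ) (hc : c ≤ 200 := by norm_num)
    (hj : 0 < j := by norm_num) : c ≤ r ^ j := by
  simpa using h.mul_pow_le_pow c 0 j hc hj

theorem two_le (h : IsScale n r) : 2 ≤ n :=
  (h.le_pow 2 80).trans h.pow_le

theorem mul_le (h : IsScale n r) : n * r ≤ 2 * r ^ 81 :=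
  calc n * r ≤ 2 * r ^ 80 * r := Nat.mul_le_mul_right r h.le_two_mul_pow
    _ = 2 * r ^ 81 := by ring

end IsScale

end Scale

section BuildStates

variable {n k r : ℕ} {F : SimpleGraph (Fin n)}

/-- The states that the strategy for small `k` passes through. -/
def buildStates (n k r : ℕ) : Set (SimpleGraph (Fin n)) :=
  forestStates (r ^ 30) (r ^ 32) ∪ hubStates (2 * r ^ 26) (r ^ 30) (2 * r ^ 52) ∪
    attachStates k (r ^ 30) ((k - 1) * (12 * r ^ 52)) (r ^ 56) ∪
    fillStates k (r ^ 30) (r ^ 2) (12 * r ^ 52) ∪ finalStates k (r ^ 30) (r ^ 2) (2 * (k * r ^ 56))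

theorem bot_mem_buildStates (hr : 0 < r) : ⊥ ∈ buildStates n k r :=
  Or.inl (Or.inl (Or.inl (Or.inl (bot_mem_forestStates (pow_pos hr 30)))))

theorem excess_eq_zero {V : Type*} [Fintype V] {F : SimpleGraph V} (h : ∀ v, (nbrs F v).card ≤ k) :
    excess F k = 0 :=
  Finset.card_eq_zero.2 (Finset.filter_eq_empty_iff.2 fun v _ => not_lt.2 (h v))

theorem PathCover.Fits.excess_le {V : Type*} [Fintype V] [DecidableEq V] {F : SimpleGraph V}
    {C : PathCover V} {M X : ℕ} (h : C.Fits F k M) (hk : 2 ≤ k) (hX : C.flexSum F ≤ (k - 1) * X) :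
    excess F k ≤ X :=
  Nat.le_of_mul_le_mul_left (h.mul_excess_le.trans hX) (by lia)

theorem card_nbrs_le_of_mem_buildStates (hk : 2 ≤ k) (hF : F ∈ buildStates n k r) (v : Fin n) :
    (nbrs F v).card ≤ k + 1 := by
  rcases hF with (((h | ⟨C, Λ, h⟩) | ⟨C, A, h, -⟩) | ⟨C, A, h, -⟩) | ⟨C, A, h, -⟩
  · exact (card_nbrs_le_of_mem_forestStates h v).trans (by lia)
  · exact (h.fits hk).deg v
  all_goals exact h.fits.deg v

theorem hub_flexSum_le (r : ℕ) : 2 * r ^ 26 * (2 * r ^ 26) ≤ 12 * r ^ 52 := by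
  have : 2 * r ^ 26 * (2 * r ^ 26) = 4 * r ^ 52 := by ring
  lia

theorem excess_le_of_mem_buildStates (hr : IsScale n r) (hk : 2 ≤ k) (hF : F ∈ buildStates n k r) :
    excess F k ≤ 2 * (k * r ^ 56) := by
  have hpow := hr.mul_pow_le_pow 12 52 56
  have hk₁ : 1 * r ^ 56 ≤ k * r ^ 56 := Nat.mul_le_mul_right _ (by lia)
  rcases hF with (((h | ⟨C, Λ, h⟩) | ⟨C, A, h, hflex, -⟩) | ⟨C, A, -, -, hX⟩) | ⟨C, A, -, -, hX⟩
  · rw [excess_eq_zero fun v => (card_nbrs_le_of_mem_forestStates h v).trans hk]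
    exact Nat.zero_le _
  · have hflex := h.flexSum_le.trans (hub_flexSum_le r)
    have := (h.fits hk).excess_le hk
      (hflex.trans (Nat.le_mul_of_pos_left _ (show 0 < k - 1 by lia)))
    lia
  · have := h.fits.excess_le hk ((Nat.le_add_right _ _).trans hflex)
    lia
  all_goals lia

theorem ncard_edgeSet_le_of_mem_buildStates (hr : IsScale n r) (hk : 2 ≤ k)
    (hF : F ∈ buildStates n k r) : F.edgeSet.ncard ≤ n * k / 2 + k * r ^ 56 := by
  have hedges := two_mul_ncard_edgeSet_le (card_nbrs_le_of_mem_buildStates hk hF)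
  have hexcess := excess_le_of_mem_buildStates hr hk hF
  rw [Fintype.card_fin] at hedges
  lia

theorem hasMoves_or_mem_hubStates_of_isScale (hr : IsScale n r)
    (hF : F ∈ forestStates (r ^ 30) (r ^ 32)) :
    HasMoves F (forestStates (r ^ 30) (r ^ 32)) (n * r) ∨
      F ∈ hubStates (2 * r ^ 26) (r ^ 30) (2 * r ^ 52) := by
  have hnr := hr.mul_le
  refine hasMoves_or_mem_hubStates (ι := r ^ 52) hF (hr.le_pow 2 30) ?_ ?_ ?_ ?_
  · have := hr.mul_pow_le_pow 2 81 84
    rw [← pow_add]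
    lia
  · have hsub : r ^ 51 ≤ r ^ 52 - 1 := by
      have := hr.mul_pow_le_pow 2 51 52
      have := hr.le_pow 1 51
      lia
    have := hr.mul_pow_le_pow 2 81 103
    calc n * r ≤ r ^ 52 * r ^ 51 := by
          rw [← pow_add]
          lia
      _ ≤ r ^ 52 * (r ^ 52 - 1) := Nat.mul_le_mul_left _ hsub
  · have := hr.mul_pow_le_pow 4 56 80
    have := hr.mul_pow_le_pow 4 62 80
    have := hr.mul_pow_le_pow 4 52 80
    have := hr.pow_le
    rw [Fintype.card_fin, mul_assoc, ← pow_add, ← pow_add]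
    lia
  · have hdiv : n / r ^ 30 ≤ 2 * r ^ 50 :=
      Nat.div_le_of_le_mul (hr.le_two_mul_pow.trans_eq (by ring))
    have := hr.mul_pow_le_pow 4 50 52
    have := hr.mul_pow_le_pow 2 32 52
    rw [Fintype.card_fin]
    lia

theorem hasMoves_or_mem_attachStates_of_isScale (hr : IsScale n r) (hk : 2 ≤ k)
    (hF : F ∈ hubStates (2 * r ^ 26) (r ^ 30) (2 * r ^ 52)) :
    HasMoves F (hubStates (2 * r ^ 26) (r ^ 30) (2 * r ^ 52)) (n * r) ∨
      F ∈ attachStates k (r ^ 30) ((k - 1) * (12 * r ^ 52)) (r ^ 56) := by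
  refine hasMoves_or_mem_attachStates hF hk ?_ ?_ ?_
  · obtain ⟨j, rfl⟩ := Nat.exists_eq_add_of_le' hk
    calc 2 * r ^ 26 * (2 * r ^ 26) + 2 * ((j + 2) * (2 * r ^ 52))
        = (4 * j + 12) * r ^ 52 := by ring
      _ ≤ (12 * j + 12) * r ^ 52 := Nat.mul_le_mul_right _ (by lia)
      _ = (j + 2 - 1) * (12 * r ^ 52) := by
          rw [Nat.add_sub_assoc one_le_two]
          ring
  · rw [mul_assoc, ← pow_add]
  · have hsub : r ^ 29 ≤ r ^ 30 - 2 - 2 * r ^ 26 := by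
      have := hr.mul_pow_le_pow 4 29 30
      have := hr.mul_pow_le_pow 2 26 29
      have := hr.le_pow 2 29
      lia
    have hnr := hr.mul_le
    have := hr.mul_pow_le_pow 2 81 84
    calc 2 * (n * r) ≤ 2 * r ^ 84 := by lia
      _ = 2 * r ^ 26 * (r ^ 29 * r ^ 29) := by ring
      _ ≤ _ := by gcongr

theorem attachment_cost_le (hr : IsScale n r) (hk : k ≤ r ^ 22) :
    (3 * k + 2) * r ^ 30 ≤ 4 * r ^ 52 := by
  have := hr.le_pow 2 22
  calc (3 * k + 2) * r ^ 30 ≤ 4 * r ^ 22 * r ^ 30 := Nat.mul_le_mul_right _ (by lia)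
    _ = 4 * r ^ 52 := by ring

theorem hasMoves_or_mem_fillStates_of_isScale (hr : IsScale n r) (hk₂ : 2 ≤ k) (hk : k ≤ r ^ 22)
    (hF : F ∈ attachStates k (r ^ 30) ((k - 1) * (12 * r ^ 52)) (r ^ 56)) :
    HasMoves F (attachStates k (r ^ 30) ((k - 1) * (12 * r ^ 52)) (r ^ 56)) (n * r) ∨
      F ∈ fillStates k (r ^ 30) (r ^ 2) (12 * r ^ 52) := by
  refine hasMoves_or_mem_fillStates hF hk₂ le_rfl fun u mass hu hmass hcover => ?_
  rw [Fintype.card_fin] at hcover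
  have hcost := attachment_cost_le hr hk
  have hpow := hr.mul_pow_le_pow 32 52 56
  set s := mass - 12 * r ^ 52 - (3 * k + 2) * r ^ 30
  have hmass₂ : mass ≤ 2 * s := by lia
  have hr₂ := hr.mul_pow_le_pow 4 1 2
  by_cases hlarge : n ≤ 2 * mass
  · calc n * r ≤ 4 * s * r := Nat.mul_le_mul_right r (by lia)
      _ = 4 * r ^ 1 * s := by ring
      _ ≤ u * s := Nat.mul_le_mul_right s (hr₂.trans hu)
  · have hs : 2 * r ^ 31 ≤ s := by
      have := hr.mul_pow_le_pow 4 31 56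
      lia
    calc n * r ≤ 2 * (u * r ^ 30) * r := Nat.mul_le_mul_right r (by lia)
      _ = u * (2 * r ^ 31) := by ring
      _ ≤ u * s := Nat.mul_le_mul_left u hs

theorem hasMoves_or_mem_finalStates_of_isScale (hr : IsScale n r) (hk₂ : 2 ≤ k) (hk : k ≤ r ^ 22)
    (hF : F ∈ fillStates k (r ^ 30) (r ^ 2) (12 * r ^ 52)) :
    HasMoves F (fillStates k (r ^ 30) (r ^ 2) (12 * r ^ 52)) (n * r) ∨
      F ∈ finalStates k (r ^ 30) (r ^ 2) (2 * (k * r ^ 56)) := by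
  have hcost := attachment_cost_le hr hk
  refine hasMoves_or_mem_finalStates (D := r ^ 56) hF ?_ ?_
  · have hk₁ : 2 * r ^ 56 ≤ k * r ^ 56 := Nat.mul_le_mul_right _ hk₂
    have := Nat.mul_le_mul_left k (hr.mul_pow_le_pow 2 32 56)
    have := hr.mul_pow_le_pow 24 52 56
    rw [← pow_add, mul_add]
    lia
  · have hsub : r ^ 55 ≤ r ^ 56 - (3 * k + 2) * r ^ 30 := by
      have := hr.mul_pow_le_pow 2 55 56
      have := hr.mul_pow_le_pow 4 52 55
      lia
    have := hr.mul_pow_le_pow 2 81 111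
    have hnr := hr.mul_le
    calc n * r ≤ r ^ 56 * r ^ 55 := by
          rw [← pow_add]
          lia
      _ ≤ _ := Nat.mul_le_mul_left _ hsub

theorem star_exceptions_le (hr : IsScale n r) (hk : k ≤ r ^ 22) : 4 * (3 * (k * r ^ 56)) ≤ n :=
  calc 4 * (3 * (k * r ^ 56)) = 12 * (k * r ^ 56) := by ring
    _ ≤ 12 * (r ^ 22 * r ^ 56) := by gcongr
    _ = 12 * r ^ 78 := by ring
    _ ≤ r ^ 80 := hr.mul_pow_le_pow 12 78 80
    _ ≤ n := hr.pow_le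

theorem hasMoves_or_hasStar_finalStates_of_isScale (hr : IsScale n r) (hk₂ : 2 ≤ k)
    (hk : k ≤ r ^ 22) (hF : F ∈ finalStates k (r ^ 30) (r ^ 2) (2 * (k * r ^ 56))) :
    IsKConnected k F ∨ HasMoves F (finalStates k (r ^ 30) (r ^ 2) (2 * (k * r ^ 56))) (n * r) ∨
      (deficit F k ≤ k * (2 * r) ∧
        HasStar F k (finalStates k (r ^ 30) (r ^ 2) (2 * (k * r ^ 56))) (3 * (k * r ^ 56))) := by
  have : Nonempty (Fin n) := ⟨⟨0, by linarith [hr.two_le]⟩⟩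
  refine hasMoves_or_hasStar_finalStates hF ?_ ?_
  · have hcost := attachment_cost_le hr hk
    have hk₁ : 2 * r ^ 56 ≤ k * r ^ 56 := Nat.mul_le_mul_right _ hk₂
    have := hr.mul_pow_le_pow 2 32 56
    have := hr.mul_pow_le_pow 8 52 56
    rw [← pow_add]
    lia
  · have hhalf : n ≤ 2 * (n - 3 * (k * r ^ 56)) := by
      have := star_exceptions_le hr hk
      lia
    rw [Fintype.card_fin]
    calc n * r ≤ 2 * (n - 3 * (k * r ^ 56)) * r := Nat.mul_le_mul_right r hhalf
      _ = _ := by ring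

theorem hasMoves_or_hasStar_buildStates (hr : IsScale n r) (hk₂ : 2 ≤ k) (hk : k ≤ r ^ 22)
    (hF : F ∈ buildStates n k r) (hconn : ¬ IsKConnected k F) :
    HasMoves F (buildStates n k r) (n * r) ∨
      deficit F k ≤ k * (2 * r) ∧ HasStar F k (buildStates n k r) (3 * (k * r ^ 56)) := by
  rw [or_iff_not_imp_left]
  intro hmoves
  have hhub (h : F ∈ forestStates (r ^ 30) (r ^ 32)) : F ∈ hubStates _ _ _ :=
    (hasMoves_or_mem_hubStates_of_isScale hr h).resolve_left fun h => hmoves (h.mono fun _ h =>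
      Or.inl (Or.inl (Or.inl (Or.inl h))))
  have hattach (h : F ∈ hubStates _ _ _) : F ∈ attachStates k _ _ _ :=
    (hasMoves_or_mem_attachStates_of_isScale hr hk₂ h).resolve_left fun h =>
      hmoves (h.mono fun _ h => Or.inl (Or.inl (Or.inl (Or.inr h))))
  have hfill (h : F ∈ attachStates k _ _ _) : F ∈ fillStates k _ _ _ :=
    (hasMoves_or_mem_fillStates_of_isScale hr hk₂ hk h).resolve_left fun h =>
      hmoves (h.mono fun _ h => Or.inl (Or.inl (Or.inr h)))
  have hfinal (h : F ∈ fillStates k _ _ _) : F ∈ finalStates k _ _ _ :=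
    (hasMoves_or_mem_finalStates_of_isScale hr hk₂ hk h).resolve_left fun h =>
      hmoves (h.mono fun _ h => Or.inl (Or.inr h))
  have hend : F ∈ finalStates k (r ^ 30) (r ^ 2) (2 * (k * r ^ 56)) := by
    rcases hF with (((h | h) | h) | h) | h
    exacts [hfinal (hfill (hattach (hhub h))), hfinal (hfill (hattach h)), hfinal (hfill h),
      hfinal h, h]
  rcases hasMoves_or_hasStar_finalStates_of_isScale hr hk₂ hk hend with h | h | ⟨hdef, h⟩
  · exact absurd h hconn
  · exact absurd (h.mono fun _ h => Or.inr h) hmoves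
  · exact ⟨hdef, h.mono fun _ h => Or.inr h⟩

end BuildStates

section FailureProbability

/-- A bound for the probability of failure of the strategies at scale `r`. -/
noncomputable def failureBound (r : ℕ) : ℝ :=
  200 * ((r : ℝ) ^ 321 * Real.exp (-r)) + (100 + 972 * Real.log r) / r

theorem tendsto_failureBound : Tendsto failureBound atTop (𝓝 0) := by
  have hexp := (Real.tendsto_pow_mul_exp_neg_atTop_nhds_zero 321).const_mul 200
  have hlog := (tendsto_const_nhds (x := (100 : ℝ)).div_atTop tendsto_id).add
    (Real.isLittleO_log_id_atTop.tendsto_div_nhds_zero.const_mul 972)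
  have hsum := (hexp.add hlog).comp (tendsto_natCast_atTop_atTop (R := ℝ))
  simp only [mul_zero, add_zero] at hsum
  refine hsum.congr fun r => ?_
  simp only [Function.comp_apply, failureBound, id]
  ring

namespace IsScale

variable {n k r : ℕ}

theorem one_le_cast (h : IsScale n r) : (1 : ℝ) ≤ r := by
  exact_mod_cast h.pos

theorem cast_pos (h : IsScale n r) : (0 : ℝ) < n := by
  exact_mod_cast zero_lt_two.trans_le h.two_le

theorem mul_pow_mul_exp_le (h : IsScale n r) {c : ℕ} (hc : c ≤ 4) :
    r * ((n : ℝ) ^ c * Real.exp (-r)) ≤ 16 * ((r : ℝ) ^ 321 * Real.exp (-r)) := by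
  have hn : (n : ℝ) ≤ 2 * (r : ℝ) ^ 80 := by exact_mod_cast h.le_two_mul_pow
  have hone : (1 : ℝ) ≤ 2 * (r : ℝ) ^ 80 := by linarith [one_le_pow₀ h.one_le_cast (n := 80)]
  calc r * ((n : ℝ) ^ c * Real.exp (-r))
      ≤ r * ((2 * (r : ℝ) ^ 80) ^ 4 * Real.exp (-r)) := by
        gcongr r * (?_ * _)
        exact (pow_le_pow_left₀ n.cast_nonneg hn c).trans (pow_le_pow_right₀ hone hc)
    _ = 16 * ((r : ℝ) ^ 321 * Real.exp (-r)) := by ring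

theorem pow_mul_exp_le (h : IsScale n r) {c : ℕ} (hc : c ≤ 4) :
    (n : ℝ) ^ c * Real.exp (-r) ≤ 16 * ((r : ℝ) ^ 321 * Real.exp (-r)) :=
  (le_mul_of_one_le_left (by positivity) h.one_le_cast).trans (h.mul_pow_mul_exp_le hc)

theorem mul_exp_neg_div (h : IsScale n r) :
    (n : ℝ) * Real.exp (-((n * r : ℕ) / n)) = n * Real.exp (-r) := by
  rw [Nat.cast_mul, mul_div_cancel_left₀ _ h.cast_pos.ne']

theorem mul_exp_le_half (h : IsScale n r) (hr : failureBound r ≤ 1 / 2) :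
    (n : ℝ) * Real.exp (-r) ≤ 1 / 2 := by
  have hexp := h.pow_mul_exp_le (c := 1) (by norm_num)
  have hlog : 0 ≤ (100 + 972 * Real.log r) / r := by
    have := Real.log_nonneg h.one_le_cast
    positivity
  have hpos : 0 ≤ (r : ℝ) ^ 321 * Real.exp (-r) := by positivity
  rw [pow_one] at hexp
  rw [failureBound] at hr
  linarith

theorem edges_loss_le (h : IsScale n r) {N : ℕ} (hN : N ≤ n * n) :
    2 * (n * Real.exp (-r)) * N ≤ 32 * ((r : ℝ) ^ 321 * Real.exp (-r)) := by
  have hN' : (N : ℝ) ≤ n ^ 2 := by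
    rw [sq]
    exact_mod_cast hN
  calc 2 * (n * Real.exp (-r)) * N ≤ 2 * (n * Real.exp (-r)) * (n : ℝ) ^ 2 := by gcongr
    _ = 2 * ((n : ℝ) ^ 3 * Real.exp (-r)) := by ring
    _ ≤ 32 * ((r : ℝ) ^ 321 * Real.exp (-r)) := by
      linarith [h.pow_mul_exp_le (c := 3) (by norm_num)]

theorem star_loss_le_of_lt (h : IsScale n r) (hk : k < 2 * r) :
    2 * (2 * (3 * (k * r ^ 56) : ℕ) / n) * (k * (2 * r) : ℕ) ≤ (96 / r : ℝ) := by
  have hr₁ := h.one_le_cast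
  have hn := h.cast_pos
  have hk' : (k : ℝ) ≤ 2 * r := by exact_mod_cast hk.le
  have hpow : (r : ℝ) ^ 60 ≤ n := by
    have := Nat.pow_le_pow_right h.pos (show 60 ≤ 80 by norm_num)
    exact_mod_cast this.trans h.pow_le
  push_cast
  calc 2 * (2 * (3 * (k * (r : ℝ) ^ 56)) / n) * (k * (2 * r))
      = 24 * k ^ 2 * (r : ℝ) ^ 57 / n := by ring
    _ ≤ 24 * (2 * r) ^ 2 * (r : ℝ) ^ 57 / n := by gcongr
    _ = 96 * (r : ℝ) ^ 60 / (r * n) := by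
      field_simp
      ring
    _ ≤ 96 * n / (r * n) := by gcongr
    _ = 96 / r := by field_simp

theorem star_loss_le_of_le (h : IsScale n r) (hk : k ≤ n) :
    2 * (n * Real.exp (-r)) * (k * (2 * r) : ℕ) ≤ 64 * ((r : ℝ) ^ 321 * Real.exp (-r)) := by
  push_cast
  calc 2 * (n * Real.exp (-r)) * (k * (2 * r)) ≤ 2 * (n * Real.exp (-r)) * (n * (2 * r)) := by
        gcongr
    _ = 4 * (r * ((n : ℝ) ^ 2 * Real.exp (-r))) := by ring
    _ ≤ 64 * ((r : ℝ) ^ 321 * Real.exp (-r)) := by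
      linarith [h.mul_pow_mul_exp_le (c := 2) (by norm_num)]

/-- For small `k` the exceptions of a star are few enough, and for larger `k` the graph already
has so many edges that losing a round without repeating an edge is unlikely. -/
theorem exists_star_loss (h : IsScale n r) (hk : k ≤ n) :
    ∃ δ : ℝ, (2 * ((3 * (k * r ^ 56) : ℕ) : ℝ) / n ≤ δ ∨
      n * r + k * (2 * r) ≤ n * k ∧ n * Real.exp (-r) ≤ δ) ∧
      2 * δ * (k * (2 * r) : ℕ) ≤ 64 * ((r : ℝ) ^ 321 * Real.exp (-r)) + 96 / r := by
  rcases lt_or_ge k (2 * r) with hkr | hkr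
  · refine ⟨_, Or.inl le_rfl, (h.star_loss_le_of_lt hkr).trans ?_⟩
    exact le_add_of_nonneg_left (by positivity)
  · have hedges : n * r + k * (2 * r) ≤ n * k := by
      have hn : 4 * r ≤ n := by simpa using (h.mul_pow_le_pow 4 1 80).trans h.pow_le
      have hkn := Nat.mul_le_mul_left k hn
      have hnk := Nat.mul_le_mul_left n hkr
      lia
    refine ⟨_, Or.inr ⟨hedges, le_rfl⟩, (h.star_loss_le_of_le hk).trans ?_⟩
    exact le_add_of_nonneg_right (by positivity)

end IsScale

end FailureProbability

section StrategiesAtScale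

variable {n k r : ℕ}

theorem IsScale.le_of_le_pow (h : IsScale n r) (hk : k ≤ r ^ 22) : k ≤ n :=
  hk.trans ((Nat.pow_le_pow_right h.pos (by norm_num)).trans h.pow_le)

theorem IsScale.build_edges_le (h : IsScale n r) (hk : k ≤ r ^ 22) :
    n * k / 2 + k * r ^ 56 ≤ n * n := by
  have hstar := star_exceptions_le h hk
  have hkn := Nat.mul_le_mul_left n (h.le_of_le_pow hk)
  have hn := Nat.mul_le_mul_left n h.two_le
  lia

theorem IsScale.div_build_waiting_le (h : IsScale n r) (hk : 0 < k) :
    ((k * (2 * r) : ℕ) : ℝ) / (k * r ^ 58 : ℕ) ≤ 2 / r := by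
  have hr₁ := h.one_le_cast
  have hr₀ := h.pos
  rw [div_le_div_iff₀ (by positivity) (by positivity)]
  push_cast
  calc k * (2 * r) * r = 2 * (k * (r : ℝ) ^ 2) := by ring
    _ ≤ 2 * (k * (r : ℝ) ^ 58) := by
      gcongr
      norm_num

theorem exists_strategy_of_le_pow (h : IsScale n r) (hr : failureBound r ≤ 1 / 2) (hk₂ : 2 ≤ k)
    (hk : k ≤ r ^ 22) : ∃ σ : Strategy n, 1 - failureBound r ≤
      (treesLaw n).real (successEvent σ k (n * k / 2 + 2 * k * r ^ 60)) := by
  have hW : 0 < k * r ^ 58 := Nat.mul_pos (by lia) (pow_pos h.pos _)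
  obtain ⟨δ, hδ, hstar⟩ := h.exists_star_loss (h.le_of_le_pow hk)
  obtain ⟨σ, hσ⟩ := exists_strategy_of_moves (P := kConnectedGraphs n k) h.two_le hW
    (bot_mem_buildStates h.pos) (fun F => ncard_edgeSet_le_of_mem_buildStates h hk₂)
    h.mul_exp_neg_div.le (h.mul_exp_le_half hr) (star_exceptions_le h hk) hδ
    fun F hF => hasMoves_or_hasStar_buildStates h hk₂ hk hF.1 hF.2
  have : NeZero n := ⟨(zero_lt_two.trans_le h.two_le).ne'⟩
  refine ⟨σ, le_trans ?_ (hσ.trans (measureReal_mono (subset_successEvent σ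
    (fun F => card_nbrs_le_of_mem_buildStates hk₂) ?_) (measure_ne_top _ _)))⟩
  · have hedges := h.edges_loss_le (h.build_edges_le hk)
    have hwait := h.div_build_waiting_le (k := k) (by lia)
    have hedges' := (div_le_self (by positivity) (Nat.one_le_cast.2 hW)).trans hedges
    have hlog : (98 : ℝ) / r ≤ (100 + 972 * Real.log r) / r := by
      have := Real.log_nonneg h.one_le_cast
      gcongr
      linarith
    have hpos : 0 ≤ (r : ℝ) ^ 321 * Real.exp (-r) := by positivity
    have hsum : (98 : ℝ) / r = 96 / r + 2 / r := by ring
    rw [add_div, failureBound]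
    linarith
  · have := Nat.mul_le_mul_left k (h.mul_pow_le_pow 1 56 60)
    have := Nat.mul_le_mul_left k (h.mul_pow_le_pow 1 58 60)
    lia

theorem IsScale.log_le (h : IsScale n r) {m : ℕ} (hm : m ≤ n * n) :
    Real.log m ≤ 162 * Real.log r := by
  rcases m.eq_zero_or_pos with rfl | hm₀
  · have := Real.log_nonneg h.one_le_cast
    simpa using this
  · have hn : n ≤ r ^ 81 := h.le_two_mul_pow.trans (h.mul_pow_le_pow 2 80 81)
    have hpow : m ≤ r ^ 162 := hm.trans ((Nat.mul_le_mul hn hn).trans_eq (pow_add r 81 81).symm)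
    calc Real.log m ≤ Real.log ((r : ℝ) ^ 162) :=
          Real.log_le_log (by exact_mod_cast hm₀) (by exact_mod_cast hpow)
      _ = 162 * Real.log r := by simp

theorem IsScale.target_loss_le (h : IsScale n r) {m : ℕ} (hm : m ≤ n * n) :
    6 * (n * r : ℕ) * (n * Real.exp (-r)) * m ≤ 96 * ((r : ℝ) ^ 321 * Real.exp (-r)) := by
  have hm' : (m : ℝ) ≤ n ^ 2 := by
    rw [sq]
    exact_mod_cast hm
  push_cast
  calc 6 * ((n : ℝ) * r) * (n * Real.exp (-r)) * m
      ≤ 6 * ((n : ℝ) * r) * (n * Real.exp (-r)) * (n : ℝ) ^ 2 := by gcongr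
    _ = 6 * (r * ((n : ℝ) ^ 4 * Real.exp (-r))) := by ring
    _ ≤ 96 * ((r : ℝ) ^ 321 * Real.exp (-r)) := by linarith [h.mul_pow_mul_exp_le le_rfl]

theorem IsScale.target_waiting_le (h : IsScale n r) (hk : r ^ 22 < k) {m : ℕ} (hm : m ≤ n * n) :
    3 * (n * r : ℕ) * (1 + Real.log m) / (k * r ^ 60 : ℕ) ≤ (6 + 972 * Real.log r) / (r : ℝ) := by
  have hr₀ : 0 < r := h.pos
  have := Real.log_nonneg h.one_le_cast
  have hlog := h.log_le hm
  have hn : (n : ℝ) ≤ 2 * (r : ℝ) ^ 80 := by exact_mod_cast h.le_two_mul_pow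
  have hk' : (r : ℝ) ^ 22 ≤ k := by exact_mod_cast hk.le
  have hk₀ : 0 < k := by lia
  rw [div_le_div_iff₀ (by positivity) (by positivity)]
  push_cast
  calc 3 * ((n : ℝ) * r) * (1 + Real.log m) * r
      ≤ 3 * (2 * (r : ℝ) ^ 80 * r) * (1 + 162 * Real.log r) * r := by gcongr
    _ = (6 + 972 * Real.log r) * ((r : ℝ) ^ 22 * (r : ℝ) ^ 60) := by ring
    _ ≤ (6 + 972 * Real.log r) * (k * (r : ℝ) ^ 60) := by gcongr

/-- Above `r ^ 22` it is affordable to collect all the edges of a fixed `k`-connected graph of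
degrees at most `k + 1`. -/
theorem exists_strategy_of_pow_lt (h : IsScale n r) (hr : failureBound r ≤ 1 / 2) (hk : r ^ 22 < k)
    (hkn : k < n) : ∃ σ : Strategy n, 1 - failureBound r ≤
      (treesLaw n).real (successEvent σ k (n * k / 2 + 2 * k * r ^ 60)) := by
  have : NeZero n := ⟨(zero_lt_two.trans_le h.two_le).ne'⟩
  set H := cyclePower n ((k + 1) / 2)
  have hW : 0 < k * r ^ 60 := Nat.mul_pos (by lia) (pow_pos h.pos _)
  have hconn : IsKConnected k H := isKConnected_cyclePower (by lia) hkn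
  have hdeg : ∀ v, (nbrs H v).card ≤ k + 1 := fun v =>
    (card_nbrs_cyclePower_le (by lia) v).trans (Nat.mul_div_le (k + 1) 2)
  have hedges : 2 * H.edgeSet.ncard ≤ n * (k + 1) :=
    (Nat.mul_le_mul_left 2 (ncard_edgeSet_cyclePower_le (by lia))).trans <|
      (Nat.mul_left_comm 2 n _).trans_le (Nat.mul_le_mul_left n (Nat.mul_div_le (k + 1) 2))
  have hrk : 2 * r ≤ k := by simpa using (h.mul_pow_le_pow 2 1 22).trans hk.le
  have hL := Nat.mul_left_comm 2 n r
  obtain ⟨σ, hσ⟩ := exists_strategy_fixed_target (L := n * r) h.two_le hconn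
    (Nat.mul_pos (by lia) h.pos) (hL.trans_le (Nat.mul_le_mul_left n (by lia)))
    (hL.trans_le (Nat.mul_le_mul_left n hrk)) h.mul_exp_neg_div.le (h.mul_exp_le_half hr) hW
  refine ⟨σ, le_trans ?_ (hσ.trans (measureReal_mono (subset_successEvent σ
    (fun F hF v => (Finset.card_le_card (nbrs_mono hF v)).trans (hdeg v)) ?_)
    (measure_ne_top _ _)))⟩
  · have hm : H.edgeSet.ncard ≤ n * n := by
      have := Nat.mul_le_mul_left n hkn
      lia
    have hloss := h.edges_loss_le hm
    have hloss' := (div_le_self (by positivity) (Nat.one_le_cast.2 hW)).trans hloss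
    have hwait := h.target_waiting_le hk hm
    have hloss₀ := h.target_loss_le hm
    have hlog : (6 + 972 * Real.log r) / r ≤ (100 + 972 * Real.log r) / r := by
      gcongr
      norm_num
    have hpos : 0 ≤ (r : ℝ) ^ 321 * Real.exp (-r) := by positivity
    rw [add_div, failureBound]
    linarith
  · have hn := h.le_two_mul_pow
    have hpow := h.mul_pow_le_pow 2 80 82
    have hk' : r ^ 82 ≤ k * r ^ 60 := by
      rw [show r ^ 82 = r ^ 22 * r ^ 60 from pow_add r 22 60]
      exact Nat.mul_le_mul_right _ hk.le
    lia

end StrategiesAtScale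

section ChoiceOfScale

theorem add_one_pow_le_two_mul_pow {r m : ℕ} (hr : 2 * m ≤ r + 1) :
    (r + 1) ^ m ≤ 2 * r ^ m := by
  have hr₀ : (0 : ℝ) < r + 1 := by positivity
  have hr' : 2 * (m : ℝ) ≤ r + 1 := by exact_mod_cast hr
  have hinv : (-2 : ℝ) ≤ -1 / (r + 1) := by
    rw [le_div_iff₀ hr₀]
    have := r.cast_nonneg (α := ℝ)
    linarith
  have hhalf : (1 : ℝ) / 2 ≤ 1 + m * (-1 / (r + 1)) := by
    rw [mul_div_assoc', mul_neg_one, neg_div, ← sub_eq_add_neg, le_sub_comm, div_le_iff₀ hr₀]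
    linarith
  have hpow : (1 : ℝ) / 2 ≤ (r / (r + 1)) ^ m := by
    have heq : (1 : ℝ) + -1 / (r + 1) = r / (r + 1) := by
      field_simp
      ring
    exact heq ▸ hhalf.trans (one_add_mul_le_pow hinv m)
  rw [div_pow, le_div_iff₀ (by positivity)] at hpow
  have : ((r : ℝ) + 1) ^ m ≤ 2 * (r : ℝ) ^ m := by linarith
  exact_mod_cast this

theorem isScale_nthRoot {n : ℕ} (hn : 200 ^ 80 ≤ n) : IsScale n (Nat.nthRoot 80 n) := by
  have hlt := Nat.lt_pow_nthRoot_add_one (n := 80) (by norm_num) n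
  have hle : 200 ≤ Nat.nthRoot 80 n :=
    Nat.lt_succ_iff.1 (lt_of_pow_lt_pow_left₀ 80 (Nat.zero_le _) (hn.trans_lt hlt))
  exact ⟨hle, Nat.pow_nthRoot_le (Or.inl (by norm_num)),
    hlt.le.trans (add_one_pow_le_two_mul_pow (by lia))⟩

theorem tendsto_nthRoot {m : ℕ} (hm : m ≠ 0) : Tendsto (Nat.nthRoot m) atTop atTop := by
  refine tendsto_atTop_atTop.2 fun b => ⟨b ^ m, fun n hn => Nat.lt_succ_iff.1 ?_⟩
  exact lt_of_pow_lt_pow_left₀ m (Nat.zero_le _) (hn.trans_lt (Nat.lt_pow_nthRoot_add_one hm n))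

theorem IsScale.pow_le_rpow {n r : ℕ} (h : IsScale n r) :
    (r : ℝ) ^ 60 ≤ (n : ℝ) ^ (3 / 4 : ℝ) := by
  have hpow : (r : ℝ) ^ 80 ≤ n := by exact_mod_cast h.pow_le
  calc (r : ℝ) ^ 60 = ((r : ℝ) ^ 80) ^ (3 / 4 : ℝ) := by
        rw [← Real.rpow_natCast_mul r.cast_nonneg]
        norm_num
    _ ≤ (n : ℝ) ^ (3 / 4 : ℝ) := by gcongr

end ChoiceOfScale

section Whp

theorem whp_of_le_real {A : (n : ℕ) → Set (ℕ → SpanningTree n)} {ε : ℕ → ℝ}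
    (hε : Tendsto ε atTop (𝓝 0)) (h : ∀ᶠ n in atTop, 1 - ε n ≤ (treesLaw n).real (A n)) :
    Whp A := by
  have hone : Tendsto (fun n => ENNReal.ofReal (1 - ε n)) atTop (𝓝 1) := by
    simpa using ENNReal.tendsto_ofReal (hε.const_sub 1)
  refine tendsto_of_tendsto_of_tendsto_of_le_of_le' hone tendsto_const_nhds
    (h.mono fun n hn => ENNReal.ofReal_le_of_le_toReal hn) ?_
  filter_upwards [eventually_ne_atTop 0] with n hn
  have : NeZero n := ⟨hn⟩
  exact prob_le_one

theorem Whp.mono {A B : (n : ℕ) → Set (ℕ → SpanningTree n)} (h : Whp A)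
    (hAB : ∀ᶠ n in atTop, A n ⊆ B n) : Whp B := by
  refine tendsto_of_tendsto_of_tendsto_of_le_of_le' h tendsto_const_nhds
    (hAB.mono fun n hn => measure_mono hn) ?_
  filter_upwards [eventually_ne_atTop 0] with n hn
  have : NeZero n := ⟨hn⟩
  exact prob_le_one

theorem exists_strategies {p : (n : ℕ) → Strategy n → Prop} (h : ∀ᶠ n in atTop, ∃ σ, p n σ) :
    ∃ σ : (n : ℕ) → 2 ≤ n → Strategy n, ∀ᶠ n in atTop, ∃ hn : 2 ≤ n, p n (σ n hn) := by
  classical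
  have hσ : ∀ n, 2 ≤ n → ∃ σ : Strategy n, (∃ σ', p n σ') → p n σ := fun n hn => by
    by_cases hp : ∃ σ, p n σ
    · exact hp.imp fun σ hσ _ => hσ
    · exact (exists_prefers hn fun _ => ∅).imp fun σ _ hp' => absurd hp' hp
  choose σ hσ using hσ
  refine ⟨σ, ?_⟩
  filter_upwards [h, eventually_ge_atTop 2] with n hp hn using ⟨hn, hσ n hn hp⟩

theorem eventually_lt_of_isLittleO {k : ℕ → ℕ}
    (hk : (fun n : ℕ => (k n : ℝ)) =o[atTop] (fun n : ℕ => (n : ℝ))) :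
    ∀ᶠ n in atTop, k n < n := by
  filter_upwards [hk.bound one_half_pos, eventually_gt_atTop 0] with n hle hn
  have hn' : (0 : ℝ) < n := by exact_mod_cast hn
  rw [Real.norm_natCast, Real.norm_natCast] at hle
  have : (k n : ℝ) < n := by linarith
  exact_mod_cast this

theorem exists_le_of_mem_successEvent {n k r : ℕ} (h : IsScale n r) {σ : Strategy n}
    {T : ℕ → SpanningTree n} (hT : T ∈ successEvent σ k (n * k / 2 + 2 * k * r ^ 60)) :
    ∃ t : ℕ, hittingTime σ (kConnectedGraphs n k) T = (t : ℕ∞) ∧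
      (t : ℝ) ≤ n * k / 2 + 2 * k * (n : ℝ) ^ (3 / 4 : ℝ) ∧
      ∃ H ≤ graphAfter σ T t, IsKConnected k H ∧ DegreesKOrSucc k H := by
  obtain ⟨t, ht, hhit, hH⟩ := hT
  refine ⟨t, hhit, ?_, hH⟩
  have hdiv : ((n * k / 2 : ℕ) : ℝ) ≤ n * k / 2 := by exact_mod_cast Nat.cast_div_le (α := ℝ)
  calc (t : ℝ) ≤ (n * k / 2 : ℕ) + 2 * k * (r : ℝ) ^ 60 := by exact_mod_cast ht.le
    _ ≤ n * k / 2 + 2 * k * (n : ℝ) ^ (3 / 4 : ℝ) := by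
      gcongr
      exact h.pow_le_rpow

end Whp

end USTSR

theorem mainTheorem4_general (k : ℕ → ℕ) (hk2 : ∀ᶠ n in atTop, 2 ≤ k n)
    (hkn : ∀ᶠ n in atTop, k n < n) :
    ∃ σ : (n : ℕ) → 2 ≤ n → USTSR.Strategy n,
      USTSR.Whp (fun n => {T | ∃ hn : 2 ≤ n, ∃ t : ℕ,
        USTSR.hittingTime (σ n hn) (USTSR.kConnectedGraphs n (k n)) T = (t : ℕ∞) ∧
        (t : ℝ) ≤ (n : ℝ) * (k n : ℝ) / 2 + 2 * (k n : ℝ) * (n : ℝ) ^ (3 / 4 : ℝ) ∧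
        ∃ H ≤ USTSR.graphAfter (σ n hn) T t,
          USTSR.IsKConnected (k n) H ∧ USTSR.DegreesKOrSucc (k n) H}) := by
  have hε := USTSR.tendsto_failureBound.comp (USTSR.tendsto_nthRoot (m := 80) (by norm_num))
  have hex : ∀ᶠ n in atTop, ∃ σ : USTSR.Strategy n, 1 - USTSR.failureBound (Nat.nthRoot 80 n) ≤
      (USTSR.treesLaw n).real (USTSR.successEvent σ (k n)
        (n * k n / 2 + 2 * k n * Nat.nthRoot 80 n ^ 60)) := by
    filter_upwards [hk2, hkn, eventually_ge_atTop (200 ^ 80), hε.eventually_le_const one_half_pos]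
      with n hk₂ hk hn hr
    rcases le_or_gt (k n) (Nat.nthRoot 80 n ^ 22) with hsmall | hlarge
    · exact USTSR.exists_strategy_of_le_pow (USTSR.isScale_nthRoot hn) hr hk₂ hsmall
    · exact USTSR.exists_strategy_of_pow_lt (USTSR.isScale_nthRoot hn) hr hlarge hk
  obtain ⟨σ, hσ⟩ := USTSR.exists_strategies hex
  refine ⟨σ, USTSR.whp_of_le_real hε ?_⟩
  filter_upwards [hσ, eventually_ge_atTop (200 ^ 80)] with n ⟨hn, hprob⟩ hn'
  have : NeZero n := ⟨by lia⟩
  refine hprob.trans (measureReal_mono (fun T hT => ⟨hn, ?_⟩) (measure_ne_top _ _))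
  exact USTSR.exists_le_of_mem_successEvent (USTSR.isScale_nthRoot hn') hT

theorem mainTheorem4 (k : ℕ → ℕ) (ω : ℕ → ℝ)
    (hk2 : ∀ᶠ n in atTop, 2 ≤ k n)
    (hk : (fun n : ℕ => (k n : ℝ)) =o[atTop] (fun n : ℕ => (n : ℝ)))
    (hω : Tendsto ω atTop atTop) :
    ∃ σ : (n : ℕ) → 2 ≤ n → USTSR.Strategy n,
      USTSR.Whp (fun n => {T | ∃ hn : 2 ≤ n, ∃ t : ℕ,
        USTSR.hittingTime (σ n hn) (USTSR.kConnectedGraphs n (k n)) T = (t : ℕ∞) ∧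
        (t : ℝ) ≤ (n : ℝ) * (k n : ℝ) / 2 +
          ω n * (k n : ℝ) * max (k n : ℝ) ((n : ℝ) ^ (3 / 4 : ℝ))}) ∧
      ((fun n : ℕ => (k n : ℝ)) =o[atTop]
          (fun n : ℕ => (n : ℝ) ^ (1 / 2 : ℝ) / (Real.log (n : ℝ)) ^ 2) →
        USTSR.Whp (fun n => {T | ∃ hn : 2 ≤ n, ∃ t : ℕ,
          USTSR.hittingTime (σ n hn) (USTSR.kConnectedGraphs n (k n)) T = (t : ℕ∞) ∧
          ∃ H : SimpleGraph (Fin n), H ≤ USTSR.graphAfter (σ n hn) T t ∧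
            USTSR.IsKConnected (k n) H ∧ USTSR.DegreesKOrSucc (k n) H})) := by
  obtain ⟨σ, h⟩ := mainTheorem4_general k hk2 (USTSR.eventually_lt_of_isLittleO hk)
  refine ⟨σ, h.mono ?_, fun _ => h.mono (.of_forall fun n T ⟨hn, t, ht, _, hH⟩ => ⟨hn, t, ht, hH⟩)⟩
  filter_upwards [hω.eventually_ge_atTop 2] with n hω₂ T ⟨hn, t, ht, hle, _⟩
  refine ⟨hn, t, ht, hle.trans ?_⟩
  gcongr
  exact le_max_right _ _
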